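/- **Model.** Let $n_G,n_L,n_c\ge 0$ be integers and $T\ge0$. Generator $k\in\{1,\dots,n_G\}$ has finitely many (at least one) production set-points $0\le\theta_{k,1}<\dots<\theta_{k,n_k}$ and a set $\Lambda_k$ of allowed switches $(l,m)$ between them. A switch $(l,m)\in\Lambda_k$ has a duration $\delta_{k,(l,m)}>0$, a cost $K_{k,(l,m)}\ge0$, and a monotone production curve $\theta^T_{k,(l,m)}:[0,\delta_{k,(l,m)}]\to\mathbb R$ from $\theta_{k,l}$ to $\theta_{k,m}$; these curves are Lipschitz with a common constant. Put $D_G=\prod_k[\theta_{k,1},\theta_{k,n_k}]$ and let $C_G:D_G\to\mathbb R$ be continuous. An operation mode $a=(a_k)_k$ gives for each generator either a set-point (stationary) or an allowed switch (in transition); $N_T(a)$ is the number of generators in transition. Write $\delta_{k,a_k}=0$ for stationary $k$ and $\varsigma(a)=\sum_k\delta_{k,a_k}$. Let $H(a)$ be the set of $r\in\mathbb R^{n_G}$ with $r_k=0$ if $k$ is stationary and $0\le r_k<\delta_{k,a_k}$ if $k$ is in transition, let $S(r)=\sum_kr_k$, and let $\zeta_k(a,r)$ be the set-point $a_k$ if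 $k$ is stationary and $\theta^T_{k,a_k}(r_k)$ otherwise. For $i=0,\dots,n_c$ let $G_i\subset\mathbb R^{n_G}\times\mathbb R^{n_L}_+$ be convex and compact, such that for all $p_G\in D_G$: for every $p_D\ge0$ there is $z\ge0$ with $(p_G,p_D-z)\in G_i$; some $(p_G,p_D)$ lies in the interior of $G_i$; and $(p_G,p_D)\in G_i$ (for any $p_G\in\mathbb R^{n_G}$) with $0\le p_D'\le p_D$ implies $(p_G,p_D')\in G_i$. Let $c\in\mathbb R^{n_L}$, $c>0$, and $q_i\ge0$. Set $$f(x,a,r)=C_G(\zeta(a,r))+\sum_{i=0}^{n_c}q_i\min\{c^\top z:\ z\ge0,\ (\zeta(a,r),x^+-z)\in G_i\},$$ where $x^+$ is the componentwise positive part. Let $W$ be a standard $n_L$-dimensional Brownian motion on a probability space, $\gamma\ge0$, $\sigma\in\mathbb R^{n_L\times n_L}$ non-singular, $m:[0,T]\to\mathbb R^{n_L}_+$ smooth and Lipschitz, $x_0\in\mathbb R^{n_L}$. For $s\in[t,T]$ let $X^{t,x}_s=m(s)+Z_s$, where $dZ_s=-\gamma Z_s\,ds+\sigma\,dW_s$,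 $Z_t=x-m(t)$. Let $(\mathcal F_s)_{0\le s\le T}$ be the filtration generated by $X=X^{0,x_0}$. Generated filtrations are augmented by the null sets, and the pathwise conditions on controls below are required almost surely. **Original problem.** Let $t\in[0,T]$ and $r\in H(a)$. A control $v\in\mathcal V_{t,a,r}$ consists of finitely many (a random number $N$ of) $\mathcal F$-stopping times $t\le\tau_1\le\dots\le\tau_N\le T$ and $\mathcal F_{\tau_j}$-measurable requests $\beta_j=(k,(l,m))$, $(l,m)\in\Lambda_k$, the times being strictly increasing for each generator. The mode $\alpha$ starts from $\alpha(t^-)=a$; a request $\beta_j$ puts generator $k$ in the transition $(l,m)$ on $[\tau_j,\tau_j+\delta_{\beta_j})$, after which it is stationary at $m$ until its next request; an initial transition of $k$ ends at time $t+\delta_{k,a_k}-r_k$. It is required that $\alpha_k(\tau_j^-)=l$ (stationary). The progression $\xi_k(s)$ is the time that $k$ has spent in its current transition at time $s$ (counting the initial $r_k$) and $0$ if $k$ is stationary. Then $$V(t,x,a,r)=\inf_{v\in\mathcal V_{t,a,r}}\mathbb E\Big[\int_t^Tf(X^{t,x}_s,\alpha(s),\xi(s))\,ds+\sum_{\tau_j\le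 T}K_{\beta_j}\Big].$$ **Lower bound problem.** Let $\eta_L\in\mathbb R^{n_L}$ be a Euclidean unit vector with all components positive, and let $\eta_G^1,\dots,\eta_G^{N_\eta}\in\mathbb R^{n_G}$, $N_\eta\ge1$. Put $$d_{i,j}=\max\{(\eta_G^j)^\top p_G+\eta_L^\top p_D:\ (p_G,p_D)\in G_i,\ p_G\in D_G\},$$ $$f_1^\eta(y,a,r)=C_G(\zeta(a,r))+\max_j\sum_{i=0}^{n_c}q_i\min\{c^\top z:\ z\ge0,\ (\eta_G^j)^\top\zeta(a,r)+y-\eta_L^\top z\le d_{i,j}\},$$ $$f_2^\eta(y,a,w)=\inf\{f_1^\eta(y,a,r):\ r\in H(a),\ S(r)=w\}.$$ Let $\sigma^\eta=\|\eta_L^\top\sigma\|$ and $W^\eta=(\sigma^\eta)^{-1}\eta_L^\top\sigma W$, with generated filtration $\mathcal F^\eta$ on $[0,T]$, and let $X^{\eta,t,y}_s=\eta_L^\top m(s)+Z^\eta_s$, where $dZ^\eta_s=-\gamma Z^\eta_s\,ds+\sigma^\eta\,dW^\eta_s$, $Z^\eta_t=y-\eta_L^\top m(t)$. A control $v\in\mathcal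 V^{\eta,R}_{t,a,w}$ consists of $\mathcal F^\eta$-stopping times $\tau_j$ and $\mathcal F^\eta_{\tau_j}$-measurable requests $\beta_j$ as above and, in addition, of $[t,\infty]$-valued $\mathcal F^\eta$-stopping times: a completion time $\vartheta_j\ge\tau_j$ for each request and one for each generator in transition in the initial mode $a$. The mode process $\alpha^\eta$ is defined as before, except that each transition ends at its completion time, and requests must be admissible for $\alpha^\eta(\tau_j^-)$ as before. With $$\rho(s)=w+\int_t^sN_T(\alpha^\eta(u))\,du-\sum_{t\le\vartheta_j\le s}\delta_{\beta_j}$$ (the sum includes the initial transitions) it is required that $0\le\rho(s)\le\varsigma(\alpha^\eta(s))$ for all $s\in[t,T]$. Then $$V^\eta(t,y,a,w)=\inf_{v\in\mathcal V^{\eta,R}_{t,a,w}}\mathbb E\Big[\int_t^Tf_2^\eta(X^{\eta,t,y}_s,\alpha^\eta(s),\rho(s))\,ds+\sum_{t<\tau_j\le T}K_{\beta_j}\Big].$$ **Corollary.** Let $U\subset\{\eta_L\in S^{n_L-1}:\eta_L>0\}$ be non-empty and compact, let $N_\eta\ge1$ be fixed, and let the vectors $\eta_G^j$ be fixed or, more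 generally, depend continuously on $\eta_L\in U$; write $V^\eta$ for the value function that belongs to $\eta_L$ and these vectors. Then for all $t\in[0,T]$, $x\in\mathbb R^{n_L}$, all operation modes $a$ and all $r\in H(a)$, the minimum $$V^{\rm LB}(t,x,a,r):=\min_{\eta\in U}V^\eta(t,\eta_L^\top x,a,S(r))$$ exists and satisfies $V^{\rm LB}(t,x,a,r)\le V(t,x,a,r)$. -/

import Mathlib

open MeasureTheory ProbabilityTheory Filter Topology Set
open scoped Matrix NNReal

noncomputable section

namespace GenPlan

/-! ### Linear stochastic differential equations with additive noise -/

/-- The solution at time `s` of `dZ = -γ Z ds + dw`, `Z t = z`, driven by the path `w`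
(variation of constants, written without a stochastic integral since the noise is additive). -/
def ouPath {E : Type*} [NormedAddCommGroup E] [NormedSpace ℝ E]
    (γ t : ℝ) (z : E) (w : ℝ → E) (s : ℝ) : E :=
  Real.exp (-γ * (s - t)) • z + (w s - w t)
    - γ • ∫ u in t..s, Real.exp (-γ * (s - u)) • (w u - w t)

/-- For every continuous driving path, `ouPath` solves the integrated equation
`Z s = z - ∫ u in t..s, γ Z u + (w s - w t)`. -/
theorem ouPath_solves {E : Type*} [NormedAddCommGroup E] [NormedSpace ℝ E] [CompleteSpace E]
    (γ t : ℝ) (z : E) (w : ℝ → E) (hw : Continuous w) (s : ℝ) :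
    ouPath γ t z w s = z - (∫ u in t..s, γ • ouPath γ t z w u) + (w s - w t) := by
  set g : ℝ → E := fun u => w u - w t with hg
  have hgc : Continuous g := by fun_prop
  set I : ℝ → E := fun v => ∫ u in t..v, Real.exp (γ * (u - t)) • g u with hI
  have hIc : Continuous fun u => Real.exp (γ * (u - t)) • g u := by fun_prop
  have hId : ∀ v, HasDerivAt I (Real.exp (γ * (v - t)) • g v) v := fun v =>
    intervalIntegral.integral_hasDerivAt_right (hIc.intervalIntegrable _ _)
      (hIc.stronglyMeasurableAtFilter _ _) hIc.continuousAt
  have hform : ∀ v, ouPath γ t z w v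
      = Real.exp (-γ * (v - t)) • (z - γ • I v) + g v := by
    intro v
    have h1 : (∫ u in t..v, Real.exp (-γ * (v - u)) • (w u - w t))
        = Real.exp (-γ * (v - t)) • I v := by
      rw [hI, ← intervalIntegral.integral_smul]
      refine intervalIntegral.integral_congr fun u _ => ?_
      simp only [hg]
      rw [smul_smul, ← Real.exp_add]
      congr 2
      ring
    unfold ouPath
    rw [h1, smul_sub, smul_comm γ]
    simp only [hg]
    abel
  have hYd : ∀ v, HasDerivAt (fun v => Real.exp (-γ * (v - t)) • (z - γ • I v))
      (-(γ • ouPath γ t z w v)) v := by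
    intro v
    have he : HasDerivAt (fun v => Real.exp (-γ * (v - t)))
        (Real.exp (-γ * (v - t)) * -γ) v := by
      have h0 : HasDerivAt (fun v : ℝ => -γ * (v - t)) (-γ) v := by
        simpa using ((hasDerivAt_id v).sub_const t).const_mul (-γ)
      exact h0.exp
    have h2 := he.smul (((hId v).const_smul γ).const_sub z)
    refine h2.congr_deriv ?_
    rw [hform v]
    have h3 : Real.exp (-γ * (v - t)) • -(γ • Real.exp (γ * (v - t)) • g v) = -(γ • g v) := by
      rw [smul_neg, smul_comm, smul_smul, smul_smul, mul_assoc, ← Real.exp_add]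
      simp [show -(γ * (v - t)) + γ * (v - t) = 0 by ring]
    rw [h3, mul_comm, ← smul_smul, smul_add, neg_smul]
    abel
  have hoc : Continuous fun v => ouPath γ t z w v := by
    have : (fun v => ouPath γ t z w v)
        = fun v => Real.exp (-γ * (v - t)) • (z - γ • I v) + g v := funext hform
    rw [this]
    exact (continuous_iff_continuousAt.2 fun v => (hYd v).continuousAt).add hgc
  have hftc := intervalIntegral.integral_eq_sub_of_hasDerivAt (a := t) (b := s)
    (fun v _ => hYd v) ((hoc.const_smul γ).neg.intervalIntegrable _ _)
  rw [intervalIntegral.integral_neg] at hftc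
  have hIt : I t = 0 := by simp [hI]
  rw [hIt, sub_self, mul_zero, Real.exp_zero, smul_zero, sub_zero, one_smul] at hftc
  rw [hform s, sub_eq_iff_eq_add.1 hftc.symm]
  simp only [hg]
  abel

/-! ### The generation planning model -/

/-- The data of the planning problem, with `nG` controllable generators, `nL` load nodes and `nc`
contingencies (index `0` is the non-contingent system). -/
structure Model (nG nL nc : ℕ) where
  /-- length of the operating period -/
  T : ℝ
  /-- generator `k` has `lvl k + 1` production set-points -/
  lvl : Fin nG → ℕ
  /-- production set-points -/
  setpt : (k : Fin nG) → Fin (lvl k + 1) → ℝ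
  /-- allowed switches `(l, m)` of each generator -/
  allowed : (k : Fin nG) → Set (Fin (lvl k + 1) × Fin (lvl k + 1))
  /-- transition times -/
  delay : (k : Fin nG) → allowed k → ℝ
  /-- production of generator `k` as a function of the time spent in a transition -/
  ramp : (k : Fin nG) → allowed k → ℝ → ℝ
  /-- switching costs -/
  swCost : (k : Fin nG) → allowed k → ℝ
  /-- feasible sets of pairs (production, demand) -/
  feas : Fin (nc + 1) → Set ((Fin nG → ℝ) × (Fin nL → ℝ))
  /-- nodal costs of disconnected load -/
  c : Fin nL → ℝ
  /-- weights of the system states -/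
  q : Fin (nc + 1) → ℝ
  /-- running production cost -/
  prodCost : (Fin nG → ℝ) → ℝ
  /-- demand forecast -/
  m : ℝ → Fin nL → ℝ
  /-- initial demand -/
  x₀ : Fin nL → ℝ
  /-- mean reversion rate of the forecast error -/
  γ : ℝ
  /-- volatility matrix of the forecast error -/
  σ : Matrix (Fin nL) (Fin nL) ℝ

namespace Model

variable {nG nL nc : ℕ} (M : Model nG nL nc)

/-- The box of production vectors between the lowest and the highest set-points. -/
def prodBox : Set (Fin nG → ℝ) :=
  {p | ∀ k, M.setpt k 0 ≤ p k ∧ p k ≤ M.setpt k (Fin.last (M.lvl k))}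

/-- The standing assumptions on the data. -/
structure Valid : Prop where
  setpt_mono : ∀ k, StrictMono (M.setpt k)
  setpt_nonneg : ∀ k l, 0 ≤ M.setpt k l
  delay_pos : ∀ k e, 0 < M.delay k e
  ramp_start : ∀ k e, M.ramp k e 0 = M.setpt k e.1.1
  ramp_end : ∀ k e, M.ramp k e (M.delay k e) = M.setpt k e.1.2
  ramp_mono : ∀ k e, MonotoneOn (M.ramp k e) (Icc 0 (M.delay k e)) ∨
    AntitoneOn (M.ramp k e) (Icc 0 (M.delay k e))
  ramp_rate : ∃ C : ℝ, 0 < C ∧ ∀ k e, ∀ s ∈ Icc 0 (M.delay k e), ∀ s' ∈ Icc 0 (M.delay k e),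
    |M.ramp k e s - M.ramp k e s'| ≤ C * |s - s'|
  swCost_nonneg : ∀ k e, 0 ≤ M.swCost k e
  feas_nonneg : ∀ i, ∀ p ∈ M.feas i, 0 ≤ p.2
  feas_convex : ∀ i, Convex ℝ (M.feas i)
  feas_compact : ∀ i, IsCompact (M.feas i)
  feas_rescue : ∀ i, ∀ pG ∈ M.prodBox, ∀ pD : Fin nL → ℝ, 0 ≤ pD →
    ∃ z : Fin nL → ℝ, 0 ≤ z ∧ (pG, pD - z) ∈ M.feas i
  feas_interior : ∀ i, ∀ pG ∈ M.prodBox, ∃ pD : Fin nL → ℝ, (pG, pD) ∈ interior (M.feas i)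
  feas_lower : ∀ i pG pD pD', (pG, pD) ∈ M.feas i → 0 ≤ pD' → pD' ≤ pD → (pG, pD') ∈ M.feas i
  c_pos : ∀ k, 0 < M.c k
  q_nonneg : ∀ i, 0 ≤ M.q i
  prodCost_cont : ContinuousOn M.prodCost M.prodBox
  m_nonneg : ∀ s ∈ Icc 0 M.T, 0 ≤ M.m s
  m_smooth : ContDiffOn ℝ (⊤ : ℕ∞) M.m (Icc 0 M.T)
  m_lipschitz : ∃ C : ℝ, 0 < C ∧ ∀ s ∈ Icc 0 M.T, ∀ s' ∈ Icc 0 M.T,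
    ‖M.m s - M.m s'‖ ≤ C * |s - s'|
  γ_nonneg : 0 ≤ M.γ
  σ_nonsing : IsUnit M.σ.det

/-- Operation mode of one generator: stationary at a set-point, or in an allowed transition. -/
abbrev GenMode (k : Fin nG) : Type := Fin (M.lvl k + 1) ⊕ M.allowed k

/-- Operation modes of the system. -/
abbrev Mode : Type := (k : Fin nG) → M.GenMode k

/-- Switching requests: a generator and an allowed switch of this generator. -/
abbrev Request : Type := (k : Fin nG) × M.allowed k

variable {M} in
/-- Duration of the transition of a generator, zero if it is stationary. -/
def genDelay {k : Fin nG} : M.GenMode k → ℝ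
  | Sum.inl _ => 0
  | Sum.inr e => M.delay k e

/-- The set-point that a generator is at, or is heading to. -/
def target {k : Fin nG} : M.GenMode k → Fin (M.lvl k + 1)
  | Sum.inl l => l
  | Sum.inr e => e.1.2

/-- Transition progression vectors compatible with the mode `a`. -/
def progSet (a : M.Mode) : Set (Fin nG → ℝ) :=
  {r | ∀ k, match a k with
    | Sum.inl _ => r k = 0
    | Sum.inr e => 0 ≤ r k ∧ r k < M.delay k e}

/-- Production vector in mode `a` with transition progression `r`. -/
def prod (a : M.Mode) (r : Fin nG → ℝ) : Fin nG → ℝ := fun k =>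
  match a k with
  | Sum.inl l => M.setpt k l
  | Sum.inr e => M.ramp k e (r k)

/-- Number of generators in transition. -/
def numTrans (a : M.Mode) : ℝ := ∑ k, match a k with
  | Sum.inl _ => (0 : ℝ)
  | Sum.inr _ => 1

/-- Total duration of the transitions of the mode `a`. -/
def totDelay (a : M.Mode) : ℝ := ∑ k, genDelay (a k)

/-- Minimal cost of the load disconnection that makes `(pG, pD)` feasible in system state `i`. -/
def shedCost (i : Fin (nc + 1)) (pG : Fin nG → ℝ) (pD : Fin nL → ℝ) : ℝ :=
  sInf {v | ∃ z : Fin nL → ℝ, 0 ≤ z ∧ (pG, pD - z) ∈ M.feas i ∧ v = M.c ⬝ᵥ z}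

/-- Running cost; only the positive part of `x` is demanded. -/
def runCost (x : Fin nL → ℝ) (a : M.Mode) (r : Fin nG → ℝ) : ℝ :=
  M.prodCost (M.prod a r) + ∑ i, M.q i * M.shedCost i (M.prod a r) (x ⊔ 0)

/-! ### Schedules and operation modes (one scenario) -/

/-- A schedule of switching requests: request number `j` is `req j`, it is made at `time j` and its
transition is completed at `done j`. There are finitely many requests; the numbers `j` beyond them
have `time j = ⊤` and `req j = none`. The initial transition of generator `k`, if there is one, is
completed at `initDone k`. -/
structure Schedule where
  time : ℕ → WithTop ℝ
  req : ℕ → Option M.Request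
  initDone : Fin nG → WithTop ℝ
  done : ℕ → WithTop ℝ

end Model

namespace Model.Schedule

variable {nG nL nc : ℕ} {M : Model nG nL nc} (S : M.Schedule)

/-- Request number `j`, if it concerns generator `k`. -/
def reqOf (k : Fin nG) (j : ℕ) : Option (M.allowed k) :=
  (S.req j).bind fun b => if h : b.1 = k then some (h ▸ b.2) else none

open Classical in
/-- The last request for generator `k` made up to and including time `s`, with its number. -/
def lastReq (k : Fin nG) (s : ℝ) : Option (ℕ × M.allowed k) :=
  if {j | S.time j ≤ s ∧ (S.reqOf k j).isSome}.Nonempty then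
    (S.reqOf k (sSup {j | S.time j ≤ s ∧ (S.reqOf k j).isSome})).map fun e =>
      (sSup {j | S.time j ≤ s ∧ (S.reqOf k j).isSome}, e)
  else none

open Classical in
/-- Operation mode at time `s` when the schedule is applied from the initial mode `a`. -/
def mode (a : M.Mode) (s : ℝ) : M.Mode := fun k =>
  match S.lastReq k s with
  | some (j, e) => if (s : WithTop ℝ) < S.done j then Sum.inr e else Sum.inl e.1.2
  | none => if (s : WithTop ℝ) < S.initDone k then a k else Sum.inl (M.target (a k))

open Classical in
/-- Transition progression at time `s` when the schedule is applied from the initial mode `a`, with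
initial transition progression `r` at time `t`. -/
def prog (t : ℝ) (a : M.Mode) (r : Fin nG → ℝ) (s : ℝ) : Fin nG → ℝ := fun k =>
  match S.lastReq k s with
  | some (j, _) => if (s : WithTop ℝ) < S.done j then s - (S.time j).untopD 0 else 0
  | none => match a k with
    | Sum.inl _ => 0
    | Sum.inr _ => if (s : WithTop ℝ) < S.initDone k then s - (t - r k) else 0

/-- Transition duration of request number `j` (zero if there is no such request). -/
def reqDelay (j : ℕ) : ℝ := (S.req j).elim 0 fun b => M.delay b.1 b.2

/-- Switching cost of request number `j` (zero if there is no such request). -/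
def reqCost (j : ℕ) : ℝ := (S.req j).elim 0 fun b => M.swCost b.1 b.2

open Classical in
/-- Total transition progression at time `s`, started from `w` at time `t` in mode `a`. -/
def totProg (t : ℝ) (a : M.Mode) (w s : ℝ) : ℝ :=
  w + (∫ u in t..s, M.numTrans (S.mode a u))
    - (∑ k, if t ≤ S.initDone k ∧ S.initDone k ≤ s then genDelay (a k) else 0)
    - ∑' j, if t ≤ S.done j ∧ S.done j ≤ s then S.reqDelay j else 0

/-- Requests are made at nondecreasing times in `[t, T]`, they are finitely many, the times are
strictly increasing for each generator, and each request is admissible for the mode just before it: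
the generator is then stationary at the set-point from which the request starts. -/
structure Admissible (t : ℝ) (a : M.Mode) : Prop where
  time_mem : ∀ j, S.time j = ⊤ ∨ (t ≤ S.time j ∧ S.time j ≤ M.T)
  time_mono : Monotone S.time
  time_top : ∀ j, S.time j = ⊤ ↔ S.req j = none
  finite : {j | S.time j ≠ ⊤}.Finite
  time_strict : ∀ k i j, i < j → (S.reqOf k i).isSome → (S.reqOf k j).isSome →
    S.time i < S.time j
  mode_before : ∀ j k e, S.req j = some ⟨k, e⟩ →
    ∀ᶠ u in 𝓝[<] ((S.time j).untopD 0), S.mode a u k = Sum.inl e.1.1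

end Model.Schedule

/-! ### Controls -/

section Controls

variable {nG nL nc : ℕ} (M : Model nG nL nc) {Ω : Type*} [mΩ : MeasurableSpace Ω]

/-- The filtration generated on `[0, T]` by a process, augmented by the null sets of `P`. -/
def genFiltration {E : Type*} [MeasurableSpace E] (P : Measure Ω) (T : ℝ) (Y : ℝ → Ω → E) :
    Filtration ℝ mΩ where
  seq s := eventuallyMeasurableSpace
    (⨆ u ∈ Icc (0 : ℝ) (min s T), MeasurableSpace.comap (Y u) inferInstance) (ae P) ⊓ mΩ
  mono' s s' h := by
    refine inf_le_inf_right _ ?_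
    rintro A ⟨B, hB, hAB⟩
    refine ⟨B, ?_, hAB⟩
    have hle : (⨆ u ∈ Icc (0 : ℝ) (min s T), MeasurableSpace.comap (Y u) inferInstance)
        ≤ ⨆ u ∈ Icc (0 : ℝ) (min s' T), MeasurableSpace.comap (Y u) inferInstance :=
      biSup_mono fun u hu => ⟨hu.1, hu.2.trans (min_le_min_right T h)⟩
    exact hle B hB
  le' _ := inf_le_right

/-- A random sequence of intervention times and switching requests. -/
structure Control (Ω : Type*) where
  time : ℕ → Ω → WithTop ℝ
  req : ℕ → Ω → Option M.Request

/-- A control of the lower bound problem also chooses the completion times of the transitions. -/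
structure RControl (Ω : Type*) extends Control M Ω where
  initDone : Fin nG → Ω → WithTop ℝ
  done : ℕ → Ω → WithTop ℝ

variable {M}

/-- Intervention times are stopping times, and each request is known when it is made. -/
def Control.NonAnticipating (v : Control M Ω) (F : Filtration ℝ mΩ) : Prop :=
  ∀ j, ∃ h : IsStoppingTime F (v.time j),
    ∀ b, MeasurableSet[h.measurableSpace] {ω | v.req j ω = some b}

/-- The schedule of a control of the original problem, where each transition takes exactly its
prescribed duration and where the initial transitions have progressed by `r` at time `t`. -/
def Control.schedule (v : Control M Ω) (t : ℝ) (a : M.Mode) (r : Fin nG → ℝ) (ω : Ω) :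
    M.Schedule where
  time j := v.time j ω
  req j := v.req j ω
  initDone k := ((t - r k + Model.genDelay (a k) : ℝ) : WithTop ℝ)
  done j := v.time j ω + (((v.req j ω).elim 0 fun b => M.delay b.1 b.2 : ℝ) : WithTop ℝ)

/-- The schedule of a control of the lower bound problem. -/
def RControl.schedule (v : RControl M Ω) (ω : Ω) : M.Schedule where
  time j := v.time j ω
  req j := v.req j ω
  initDone k := v.initDone k ω
  done j := v.done j ω

variable (M)

/-! ### The original problem -/

/-- Driving noise `σ W`, as a process indexed by real times. -/
def noise (W : ℝ≥0 → Ω → Fin nL → ℝ) (s : ℝ) (ω : Ω) : Fin nL → ℝ :=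
  M.σ *ᵥ W s.toNNReal ω

/-- The demand process started from `x` at time `t`: forecast plus forecast error. -/
def demand (W : ℝ≥0 → Ω → Fin nL → ℝ) (t : ℝ) (x : Fin nL → ℝ) (s : ℝ) (ω : Ω) : Fin nL → ℝ :=
  M.m s + ouPath M.γ t (x - M.m t) (fun u => noise M W u ω) s

/-- Admissible controls for starting at time `t` in mode `a` with transition progression `r`. -/
def controls (P : Measure Ω) (W : ℝ≥0 → Ω → Fin nL → ℝ) (t : ℝ) (a : M.Mode) (r : Fin nG → ℝ) :
    Set (Control M Ω) :=
  {v | v.NonAnticipating (genFiltration P M.T (demand M W 0 M.x₀)) ∧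
    ∀ᵐ ω ∂P, (v.schedule t a r ω).Admissible t a}

open Classical in
/-- Expected cost-to-go of a control. -/
def costToGo (P : Measure Ω) (W : ℝ≥0 → Ω → Fin nL → ℝ) (t : ℝ) (x : Fin nL → ℝ) (a : M.Mode)
    (r : Fin nG → ℝ) (v : Control M Ω) : ℝ :=
  ∫ ω, ((∫ s in t..M.T, M.runCost (demand M W t x s ω) ((v.schedule t a r ω).mode a s)
      ((v.schedule t a r ω).prog t a r s))
    + ∑' j, if v.time j ω ≤ M.T then (v.schedule t a r ω).reqCost j else 0) ∂P

/-- Value function of the original problem. -/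
def value (P : Measure Ω) (W : ℝ≥0 → Ω → Fin nL → ℝ) (t : ℝ) (x : Fin nL → ℝ) (a : M.Mode)
    (r : Fin nG → ℝ) : ℝ :=
  sInf (costToGo M P W t x a r '' controls M P W t a r)

/-! ### The lower bound problem

Here `η` is the vector of weights of the demands and `g j` are vectors of weights of the
productions. -/

/-- Largest value on the feasible set of the linear functional with weights `(g, η)`. -/
def supportVal (η : Fin nL → ℝ) (g : Fin nG → ℝ) (i : Fin (nc + 1)) : ℝ :=
  sSup {v | ∃ p ∈ M.feas i, p.1 ∈ M.prodBox ∧ 0 ≤ p.2 ∧ v = g ⬝ᵥ p.1 + η ⬝ᵥ p.2}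

/-- Minimal disconnection cost when the feasible set is replaced by the half-space that contains
it, at weighted production `y` and weighted demand `x`. -/
def shedCostLB (η : Fin nL → ℝ) (g : Fin nG → ℝ) (i : Fin (nc + 1)) (y x : ℝ) : ℝ :=
  sInf {v | ∃ z : Fin nL → ℝ, 0 ≤ z ∧ y + x - η ⬝ᵥ z ≤ supportVal M η g i ∧ v = M.c ⬝ᵥ z}

/-- Running cost with the approximated feasible sets. -/
def runCost₁ {N : ℕ} (η : Fin nL → ℝ) (g : Fin N → Fin nG → ℝ) (y : ℝ) (a : M.Mode)
    (r : Fin nG → ℝ) : ℝ :=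
  M.prodCost (M.prod a r) +
    ⨆ j, ∑ i, M.q i * shedCostLB M η (g j) i (g j ⬝ᵥ M.prod a r) y

/-- Running cost that depends on the transition progression only through its sum. -/
def runCost₂ {N : ℕ} (η : Fin nL → ℝ) (g : Fin N → Fin nG → ℝ) (y : ℝ) (a : M.Mode)
    (w : ℝ) : ℝ :=
  sInf {v | ∃ r ∈ M.progSet a, ∑ k, r k = w ∧ v = runCost₁ M η g y a r}

/-- Volatility of the weighted demand. -/
def volLB (η : Fin nL → ℝ) : ℝ := ‖WithLp.toLp 2 (η ᵥ* M.σ)‖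

/-- The Brownian motion that drives the weighted demand. -/
def brownLB (η : Fin nL → ℝ) (W : ℝ≥0 → Ω → Fin nL → ℝ) (s : ℝ) (ω : Ω) : ℝ :=
  (volLB M η)⁻¹ * (η ⬝ᵥ (M.σ *ᵥ W s.toNNReal ω))

/-- The weighted demand process started from `y` at time `t`. -/
def demandLB (η : Fin nL → ℝ) (W : ℝ≥0 → Ω → Fin nL → ℝ) (t y s : ℝ) (ω : Ω) : ℝ :=
  η ⬝ᵥ M.m s + ouPath M.γ t (y - η ⬝ᵥ M.m t) (fun u => volLB M η * brownLB M η W u ω) s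

/-- Admissible controls of the lower bound problem for starting at time `t` in mode `a` with total
transition progression `w`. -/
def controlsLB (P : Measure Ω) (η : Fin nL → ℝ) (W : ℝ≥0 → Ω → Fin nL → ℝ) (t : ℝ) (a : M.Mode)
    (w : ℝ) : Set (RControl M Ω) :=
  {v | v.NonAnticipating (genFiltration P M.T (brownLB M η W)) ∧
    (∀ k, IsStoppingTime (genFiltration P M.T (brownLB M η W)) (v.initDone k)) ∧
    (∀ j, IsStoppingTime (genFiltration P M.T (brownLB M η W)) (v.done j)) ∧
    ∀ᵐ ω ∂P, (v.schedule ω).Admissible t a ∧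
      (∀ k, t ≤ v.initDone k ω) ∧
      (∀ j, v.time j ω ≤ v.done j ω) ∧
      ∀ s ∈ Icc t M.T, 0 ≤ (v.schedule ω).totProg t a w s ∧
        (v.schedule ω).totProg t a w s ≤ M.totDelay ((v.schedule ω).mode a s)}

open Classical in
/-- Expected cost-to-go of a control in the lower bound problem. -/
def costToGoLB {N : ℕ} (P : Measure Ω) (η : Fin nL → ℝ) (g : Fin N → Fin nG → ℝ)
    (W : ℝ≥0 → Ω → Fin nL → ℝ) (t y : ℝ) (a : M.Mode) (w : ℝ) (v : RControl M Ω) : ℝ :=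
  ∫ ω, ((∫ s in t..M.T, runCost₂ M η g (demandLB M η W t y s ω) ((v.schedule ω).mode a s)
      ((v.schedule ω).totProg t a w s))
    + ∑' j, if t < v.time j ω ∧ v.time j ω ≤ M.T then (v.schedule ω).reqCost j else 0) ∂P

/-- Value function of the lower bound problem. -/
def valueLB {N : ℕ} (P : Measure Ω) (η : Fin nL → ℝ) (g : Fin N → Fin nG → ℝ)
    (W : ℝ≥0 → Ω → Fin nL → ℝ) (t y : ℝ) (a : M.Mode) (w : ℝ) : ℝ :=
  sInf (costToGoLB M P η g W t y a w '' controlsLB M P η W t a w)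

end Controls

/-- Standard Brownian motion in `ℝⁿ`: independent real Brownian motions as coordinates. -/
structure IsBrownianVec {n : ℕ} {Ω : Type*} [MeasurableSpace Ω] (W : ℝ≥0 → Ω → Fin n → ℝ)
    (P : Measure Ω) : Prop where
  measurable : ∀ s, Measurable (W s)
  brownian : ∀ k, IsBrownianReal (fun s ω => W s ω k) P
  indep : iIndepFun (fun k ω (s : ℝ≥0) => W s ω k) P

end GenPlan

end

/-! Two facts give the result: every `valueLB` lies below `value`, and `valueLB` is lower
semicontinuous in the weights `η`, so that it attains its minimum on the compact set `U`.

Pathwise comparison. Each feasible set lies in the half-spaces cut out by its support values, and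
since `η > 0` replacing `x` by its positive part can only raise the weighted demand. Hence the
relaxed running cost is at most the true one (`runCost₁_le_runCost`), and minimising over all
progressions with the same sum lowers it further. When all transitions take exactly their prescribed
time, the progressions add up to the total progression `ρ` (`Admissible.sum_prog`). A schedule of
the original problem is therefore feasible for the lower bound problem and costs no more there
(`costLB_le_costOrig`).

Information. A control of the original problem observes the whole demand, one of the lower bound
problem only the scalar Brownian motion `B = u ⬝ᵥ W`, with `u` the normalised `η ᵥ* σ`. The residual
`C = W - u B` is independent of `B`, because the two are jointly Gaussian and uncorrelated. A
control is almost surely a functional of `(C, B)`; freezing `C = c` leaves a control driven by `B`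
alone, and by Fubini the expected cost is the mean over `c` of the frozen costs, so some `c` does at
least as well (`exists_transfer`). That frozen stopping times are again stopping times holds for
almost every `c` at all rational times by Fubini, and then at all times because the augmented
Brownian filtration is right-continuous (`measurableSet_genFiltration_of_gt`), a form of
Blumenthal's zero-one law.

Semicontinuity. The Brownian motions belonging to two weights have the same law on path space, so
the same transfer, with trivial `C`, carries a control for `η` to one for `η₀`
(`exists_controlsLB_le`). For `η` near `η₀` the running costs differ by at most `ε (1 + |d|)`, where
`d` is the mean reverting deviation (`abs_runCost₂_sub_le`), and the expected time integral of `|d|`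
does not depend on `η`. This gives `V^{η₀} ≤ V^η + ε` near `η₀` (`eventually_valueLB_le`).

Integrability rests on a deterministic bound for the switching costs: `ρ ≥ 0` at the final time
limits the total duration of completed transitions (`Admissible.sum_reqCost_le`). All costs then
have an integrable majorant that depends on the path only, not on the control. -/

/-! ### σ-algebras modulo null sets -/

section EventuallyMeasurable

/-- Augmenting twice is the same as augmenting once. -/
theorem eventuallyMeasurableSpace_le_of_le {α : Type*} {m m' : MeasurableSpace α} {l : Filter α}
    [CountableInterFilter l] (h : m ≤ eventuallyMeasurableSpace m' l) :
    eventuallyMeasurableSpace m l ≤ eventuallyMeasurableSpace m' l := by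
  rintro A ⟨B, hB, hAB⟩
  obtain ⟨D, hD, hBD⟩ := h B hB
  exact ⟨D, hD, hAB.trans hBD⟩

theorem comap_le_eventuallyMeasurableSpace {α β : Type*} {m : MeasurableSpace α}
    {mβ : MeasurableSpace β} {l : Filter α} [CountableInterFilter l] {f g : α → β}
    (hg : Measurable[m] g) (hfg : f =ᶠ[l] g) :
    mβ.comap f ≤ eventuallyMeasurableSpace m l := by
  rintro _ ⟨s, hs, rfl⟩
  exact ⟨g ⁻¹' s, hg hs, hfg.preimage s⟩

/-- A function that is measurable modulo null sets with respect to the σ-algebra of `φ` is almost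
everywhere a measurable function of `φ`. -/
theorem exists_measurable_comp_ae_eq {Ω X Z : Type*}
    {mX : MeasurableSpace X} [MeasurableSpace Z] [StandardBorelSpace Z] [Nonempty Z]
    {l : Filter Ω} [CountableInterFilter l] {φ : Ω → X} {f : Ω → Z}
    (hf : Measurable[eventuallyMeasurableSpace (mX.comap φ) l] f) :
    ∃ h : X → Z, Measurable h ∧ f =ᶠ[l] h ∘ φ := by
  let := upgradeStandardBorel Z
  have hs : StronglyMeasurable[eventuallyMeasurableSpace (mX.comap φ) l] f :=
    @Measurable.stronglyMeasurable Ω Z f (eventuallyMeasurableSpace (mX.comap φ) l) _ _ _ _ _ hf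
  -- Factorisation is proved for constants and passes to piecewise definitions and to pointwise
  -- limits, which generate all strongly measurable functions.
  have key : ∃ h : X → Z, StronglyMeasurable h ∧ f =ᶠ[l] h ∘ φ := by
    let mE : MeasurableSpace Ω := eventuallyMeasurableSpace (mX.comap φ) l
    clear hf
    induction f, hs using StronglyMeasurable.induction' with
    | const z => exact ⟨fun _ => z, stronglyMeasurable_const, EventuallyEq.rfl⟩
    | @pcw g₁ g₂ s hg₁ hg₂ hs h₁ h₂ =>
      obtain ⟨_, ⟨t, ht, rfl⟩, hst⟩ := hs
      obtain ⟨h₁, mh₁, e₁⟩ := h₁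
      obtain ⟨h₂, mh₂, e₂⟩ := h₂
      classical
      refine ⟨t.piecewise h₁ h₂, mh₁.piecewise ht mh₂, ?_⟩
      filter_upwards [hst.mem_iff, e₁, e₂] with ω hω h1 h2
      by_cases hm : ω ∈ s
      · have : φ ω ∈ t := hω.1 hm
        simp [hm, this, h1]
      · have : φ ω ∉ t := fun h => hm (hω.2 h)
        simp [hm, this, h2]
    | @lim g i hg hi h₁ h₂ =>
      choose h mh hh using h₁
      -- The factors converge only at points `φ ω` with `ω` outside a null set; `limUnder` has a
      -- default value elsewhere and remains measurable.
      refine ⟨fun y => limUnder atTop (h · y), StronglyMeasurable.limUnder mh, ?_⟩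
      have := eventually_countable_forall.2 hh
      filter_upwards [this] with ω hω
      rw [Function.comp_apply, Tendsto.limUnder_eq]
      refine (h₂ ω).congr fun n => ?_
      rw [hω n, Function.comp_apply]
  obtain ⟨h, mh, hh⟩ := key
  exact ⟨h, mh.measurable, hh⟩

/-- Encoding a time by its finite value together with a flag for `⊤` reduces the claim to the
standard Borel target `ℝ × Bool`; decoding is measurable as well. -/
theorem exists_measurable_comp_ae_eq_withTop {Ω X : Type*} {mX : MeasurableSpace X}
    {l : Filter Ω} [CountableInterFilter l] {φ : Ω → X} {f : Ω → WithTop ℝ}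
    (hf : Measurable[eventuallyMeasurableSpace (mX.comap φ) l] f) :
    ∃ h : X → WithTop ℝ, Measurable h ∧ f =ᶠ[l] h ∘ φ := by
  classical
  have he : Measurable fun y : WithTop ℝ => (y.untopD 0, decide (y = ⊤)) := by
    refine (WithTop.measurable_untopD 0).prodMk (measurable_to_bool ?_)
    convert! measurableSet_singleton (⊤ : WithTop ℝ)
    ext y
    simp
  have he' : Measurable fun p : ℝ × Bool => if p.2 = true then (⊤ : WithTop ℝ) else p.1 :=
    Measurable.ite (measurable_snd (measurableSet_singleton true)) measurable_const
      measurable_fst.withTop_coe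
  obtain ⟨h, hm, hh⟩ := exists_measurable_comp_ae_eq (he.comp hf)
  refine ⟨_, he'.comp hm, ?_⟩
  filter_upwards [hh] with ω hω
  simp only [Function.comp_apply] at hω ⊢
  rw [← hω]
  cases f ω <;> simp

end EventuallyMeasurable

/-! ### Blumenthal's zero-one law -/

section Blumenthal

variable {Ω : Type*}

/-- Independence is insensitive to null sets. -/
theorem indep_of_le_eventuallyMeasurableSpace {m₁ m₂ m₂' mΩ : MeasurableSpace Ω} {P : Measure Ω}
    (h : Indep m₁ m₂ P) (h' : m₂' ≤ eventuallyMeasurableSpace m₂ (ae P)) :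
    Indep m₁ m₂' P := by
  rw [Indep_iff] at h ⊢
  intro A B hA hB
  obtain ⟨D, hD, hBD⟩ := h' B hB
  rw [measure_congr hBD, measure_congr ((EventuallyEq.refl _ A).inter hBD), h A D hA hD]

/-- If `m` is independent of `H`, then an event of `m` that is determined, up to null sets, by
`H` together with a sub-σ-algebra `G` of `m`, is already determined by `G`. -/
theorem eventuallyMeasurableSet_of_indep {G H m mΩ : MeasurableSpace Ω} {P : Measure Ω}
    [IsProbabilityMeasure P]
    (hG : G ≤ m) (hm : m ≤ mΩ) (hH : H ≤ mΩ) (hind : Indep H m P) {A : Set Ω}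
    (hA : MeasurableSet[m] A) (hA' : MeasurableSet[eventuallyMeasurableSpace (G ⊔ H) (ae P)] A) :
    MeasurableSet[eventuallyMeasurableSpace G (ae P)] A := by
  have hGΩ : G ≤ mΩ := hG.trans hm
  have hle : G ⊔ H ≤ mΩ := sup_le hGΩ hH
  have hAm : MeasurableSet A := hm A hA
  set f : Ω → ℝ := A.indicator fun _ => (1 : ℝ) with hf
  have hfi : Integrable f P := (integrable_const (1 : ℝ)).indicator hAm
  -- The aim is `g = f` almost everywhere, for then `A` is a superlevel set of a `G`-measurable
  -- function.
  set g : Ω → ℝ := P[f | G] with hg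
  have hgi : Integrable g P := integrable_condExp
  have hgG : StronglyMeasurable[G] g := stronglyMeasurable_condExp
  -- Both `f` and `g` are `m`-measurable, so independence splits off the factor `P E` in either
  -- integral, and what remains agrees by the definition of `g`.
  have hrect : ∀ D E, MeasurableSet[G] D → MeasurableSet[H] E →
      ∫ ω in D ∩ E, g ω ∂P = ∫ ω in D ∩ E, f ω ∂P := by
    intro D E hD hE
    have split : ∀ h : Ω → ℝ, StronglyMeasurable[m] h → Integrable h P →
        ∫ ω in D ∩ E, h ω ∂P = P.real E * ∫ ω in D, h ω ∂P := by
      intro h hh hi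
      have hDm : MeasurableSet D := hGΩ D hD
      have hEm : MeasurableSet E := hH E hE
      have h1 : StronglyMeasurable[m] (D.indicator h) := hh.indicator (hG D hD)
      have h2 : P[D.indicator h | H] =ᵐ[P] fun _ => P[D.indicator h] :=
        condExp_indep_eq hm hH h1 hind.symm
      calc ∫ ω in D ∩ E, h ω ∂P = ∫ ω in E, D.indicator h ω ∂P := by
            rw [setIntegral_indicator hDm, inter_comm]
        _ = ∫ ω in E, (P[D.indicator h | H]) ω ∂P :=
            (setIntegral_condExp hH (hi.indicator hDm) hE).symm
        _ = ∫ ω in E, P[D.indicator h] ∂P := integral_congr_ae (ae_restrict_of_ae h2)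
        _ = P.real E * ∫ ω in D, h ω ∂P := by
            rw [setIntegral_const, smul_eq_mul, integral_indicator hDm]
    rw [split g (hgG.mono hG) hgi, split f (stronglyMeasurable_const.indicator hA) hfi,
      setIntegral_condExp hGΩ hfi hD]
  have hall : ∀ E, MeasurableSet[G ⊔ H] E → ∫ ω in E, g ω ∂P = ∫ ω in E, f ω ∂P := by
    have hgen : G ⊔ H = MeasurableSpace.generateFrom
        (image2 (fun D E => D ∩ E) {D | MeasurableSet[G] D} {E | MeasurableSet[H] E}) := by
      refine le_antisymm (sup_le (fun D hD => ?_) fun E hE => ?_)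
        (MeasurableSpace.generateFrom_le ?_)
      · exact MeasurableSpace.measurableSet_generateFrom
          ⟨D, hD, univ, @MeasurableSet.univ _ H, inter_univ _⟩
      · exact MeasurableSpace.measurableSet_generateFrom
          ⟨univ, @MeasurableSet.univ _ G, E, hE, univ_inter _⟩
      · rintro _ ⟨D, hD, E, hE, rfl⟩
        exact @MeasurableSet.inter _ (G ⊔ H) _ _ ((le_sup_left : G ≤ G ⊔ H) D hD)
          ((le_sup_right : H ≤ G ⊔ H) E hE)
    have hpi : IsPiSystem
        (image2 (fun D E : Set Ω => D ∩ E) {D | MeasurableSet[G] D} {E | MeasurableSet[H] E}) := by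
      rintro _ ⟨D, hD, E, hE, rfl⟩ _ ⟨D', hD', E', hE', rfl⟩ _
      exact ⟨D ∩ D', @MeasurableSet.inter _ G _ _ hD hD', E ∩ E',
        @MeasurableSet.inter _ H _ _ hE hE', inter_inter_inter_comm _ _ _ _⟩
    intro E hE
    induction E, hE using MeasurableSpace.induction_on_inter hgen hpi with
    | empty => simp
    | basic E hE =>
      obtain ⟨D, hD, E, hE, rfl⟩ := hE
      exact hrect D E hD hE
    | compl E hE ih =>
      have h0 : ∫ ω, g ω ∂P = ∫ ω, f ω ∂P := integral_condExp hGΩ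
      rw [setIntegral_compl (hle E hE) hgi, setIntegral_compl (hle E hE) hfi, ih, h0]
    | iUnion F hd hF ih =>
      rw [integral_iUnion (fun i => hle _ (hF i)) hd hgi.integrableOn,
        integral_iUnion (fun i => hle _ (hF i)) hd hfi.integrableOn]
      exact tsum_congr ih
  obtain ⟨B, hB, hAB⟩ := hA'
  have hfB : f =ᵐ[P] B.indicator fun _ => (1 : ℝ) := by
    filter_upwards [hAB.mem_iff] with ω hω
    by_cases h : ω ∈ A
    · simp [hf, h, hω.1 h]
    · have h' : ω ∉ B := fun h' => h (hω.2 h')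
      simp [hf, h, h']
  -- By `hall`, `g` is also the conditional expectation of `f` given `G ⊔ H`; as `f` is `G ⊔
  -- H`-measurable up to a null set, that conditional expectation is `f`.
  have hgf : g =ᵐ[P] f := by
    have h1 : g =ᵐ[P] P[f | G ⊔ H] :=
      ae_eq_condExp_of_forall_setIntegral_eq hle hfi (fun _ _ _ => hgi.integrableOn)
        (fun s hs _ => hall s hs)
        (hgG.mono (le_sup_left : G ≤ G ⊔ H)).aestronglyMeasurable
    have h2 : P[f | G ⊔ H] =ᵐ[P] P[B.indicator fun _ => (1 : ℝ) | G ⊔ H] := condExp_congr_ae hfB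
    have h3 : P[B.indicator fun _ => (1 : ℝ) | G ⊔ H] = B.indicator fun _ => (1 : ℝ) :=
      condExp_of_stronglyMeasurable hle (stronglyMeasurable_const.indicator hB)
        ((integrable_const _).indicator (hle B hB))
    rw [h3] at h2
    exact h1.trans (h2.trans hfB.symm)
  -- Since `g` takes only the values `0` and `1` almost surely, any threshold strictly between them
  -- would do.
  refine ⟨{ω | 1 / 2 < g ω}, hgG.measurable measurableSet_Ioi, ?_⟩
  filter_upwards [hgf] with ω hω
  refine propext ?_
  change ω ∈ A ↔ 1 / 2 < g ω
  by_cases h : ω ∈ A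
  · simp only [hω, hf, h, indicator_of_mem]; norm_num
  · simp only [hω, hf, h, not_false_eq_true, indicator_of_notMem]; norm_num

end Blumenthal

namespace GenPlan

/-! ### Right-continuity of the augmented Brownian filtration. -/

section BrownianFiltration

variable {Ω : Type*} {mΩ : MeasurableSpace Ω} {P : Measure Ω}

/-- The events known from a process on `[0, min s T]`, before augmentation. -/
abbrev pastSpace {Ω E : Type*} [MeasurableSpace E] (T : ℝ) (Y : ℝ → Ω → E) (s : ℝ) :
    MeasurableSpace Ω :=
  ⨆ u ∈ Icc (0 : ℝ) (min s T), MeasurableSpace.comap (Y u) inferInstance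

theorem measurableSet_genFiltration {E : Type*} [MeasurableSpace E] {T : ℝ} {Y : ℝ → Ω → E}
    {s : ℝ} {A : Set Ω} :
    MeasurableSet[genFiltration P T Y s] A ↔
      MeasurableSet[eventuallyMeasurableSpace (pastSpace T Y s) (ae P)] A ∧ MeasurableSet A :=
  Iff.rfl

theorem genFiltration_congr_min {E : Type*} [MeasurableSpace E] {T : ℝ} {Y : ℝ → Ω → E}
    {s s' : ℝ} (h : Icc (0 : ℝ) (min s T) = Icc 0 (min s' T)) :
    genFiltration P T Y s = genFiltration P T Y s' := by
  change eventuallyMeasurableSpace (pastSpace T Y s) (ae P) ⊓ mΩ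
    = eventuallyMeasurableSpace (pastSpace T Y s') (ae P) ⊓ mΩ
  simp only [pastSpace, h]

theorem pastSpace_le {E : Type*} [MeasurableSpace E] {T : ℝ} {Y : ℝ → Ω → E} {s : ℝ}
    {m : MeasurableSpace Ω} (h : ∀ u, 0 ≤ u → u ≤ s → u ≤ T → Measurable[m] (Y u)) :
    pastSpace T Y s ≤ m :=
  iSup₂_le fun u hu => (h u hu.1 (hu.2.trans (min_le_left _ _))
    (hu.2.trans (min_le_right _ _))).comap_le

theorem measurable_pastSpace {Ω E : Type*} [MeasurableSpace E] {T : ℝ} {Y : ℝ → Ω → E} {s u : ℝ}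
    (h0 : 0 ≤ u) (hs : u ≤ s) (hT : u ≤ T) : Measurable[pastSpace T Y s] (Y u) := by
  refine Measurable.mono (comap_measurable (Y u)) ?_ le_rfl
  exact le_iSup₂_of_le u ⟨h0, le_min hs hT⟩ le_rfl

theorem pastSpace_mono {E : Type*} [MeasurableSpace E] {T : ℝ} {Y : ℝ → Ω → E} {s s' : ℝ}
    (h : s ≤ s') : pastSpace T Y s ≤ pastSpace T Y s' :=
  pastSpace_le fun _ h0 hs hT => measurable_pastSpace h0 (hs.trans h) hT

/-- The augmented filtration of a Brownian motion is right-continuous. -/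
theorem measurableSet_genFiltration_of_gt {B : ℝ≥0 → Ω → ℝ} (hB : IsPreBrownianReal B P)
    (hBm : ∀ s, Measurable (B s)) (hBc : ∀ ω, Continuous fun s => B s ω) {T : ℝ} {s : ℝ}
    {A : Set Ω}
    (hA : ∀ q > s, MeasurableSet[genFiltration P T (fun u => B u.toNNReal) q] A) :
    MeasurableSet[genFiltration P T (fun u => B u.toNNReal) s] A := by
  have : IsProbabilityMeasure P := hB.isGaussianProcess.isProbabilityMeasure
  -- Before time `0` and from time `T` on the filtration is constant, which settles these two
  -- ranges.
  rcases lt_or_ge s 0 with hs0 | hs0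
  · have h1 := hA (s / 2) (by linarith)
    rwa [genFiltration_congr_min (s' := s)] at h1
    have e1 : min (s / 2) T < 0 := (min_le_left _ _).trans_lt (by linarith)
    have e2 : min s T < 0 := (min_le_left _ _).trans_lt hs0
    rw [Icc_eq_empty e1.not_ge, Icc_eq_empty e2.not_ge]
  rcases le_or_gt T s with hsT | hsT
  · have h1 := hA (s + 1) (by linarith)
    rwa [genFiltration_congr_min (s' := s)] at h1
    rw [min_eq_right hsT, min_eq_right (by linarith)]
  set Y : ℝ → Ω → ℝ := fun u => B u.toNNReal with hY
  set s₀ : ℝ≥0 := s.toNNReal with hs₀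
  have hs₀' : (s₀ : ℝ) = s := Real.coe_toNNReal s hs0
  set ε : ℕ → ℝ≥0 := fun n => 1 / ((n : ℝ≥0) + 1) with hε
  have hεpos : ∀ n, 0 < ε n := fun n => by positivity
  have hεanti : Antitone ε := fun i j hij => by
    simp only [hε]
    gcongr
  have hεlim : Tendsto ε atTop (𝓝 0) := by
    have := tendsto_one_div_add_atTop_nhds_zero_nat (𝕜 := ℝ)
    rw [← NNReal.tendsto_coe]
    simpa [hε] using this
  -- Increments after `s + ε n` are independent of everything known at `s + ε n`, hence of the germ
  -- field `F` at `s+`. Letting `ε n` decrease to `0` exhausts all increments after `s`.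
  set Z : ℕ → Ω → ℝ≥0 → ℝ := fun n ω h => B (s₀ + ε n + h) ω - B (s₀ + ε n) ω with hZ
  set H : ℕ → MeasurableSpace Ω := fun n => MeasurableSpace.comap (Z n) inferInstance with hH
  have hZm : ∀ n, Measurable (Z n) := fun n => by fun_prop
  have hHle : ∀ n, H n ≤ mΩ := fun n => (hZm n).comap_le
  have hHmono : Monotone H := by
    intro i j hij
    have h1 : Measurable[H j] (Z i) := by
      rw [@measurable_pi_iff]
      intro h
      have e : (fun ω => Z i ω h) = fun ω => Z j ω (ε i - ε j + h) - Z j ω (ε i - ε j) := by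
        funext ω
        have h2 : s₀ + ε j + (ε i - ε j) = s₀ + ε i := by
          rw [add_assoc, add_tsub_cancel_of_le (hεanti hij)]
        simp only [hZ]
        rw [← add_assoc, h2]
        ring
      rw [e]
      have hc : Measurable[H j] (Z j) := comap_measurable _
      exact ((measurable_pi_apply _).comp hc).sub ((measurable_pi_apply _).comp hc)
    exact h1.comap_le
  set Fil := genFiltration P T Y with hFil
  set F : MeasurableSpace Ω := ⨅ q : {q : ℝ // s < q}, Fil.seq q with hF
  have hFm : ∀ D, MeasurableSet[F] D ↔ ∀ q > s, MeasurableSet[Fil q] D := by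
    intro D
    rw [hF, MeasurableSpace.measurableSet_iInf]
    exact Subtype.forall
  have hFle : F ≤ mΩ := fun D hD => ((hFm D).1 hD (s + 1) (by linarith)).2
  have hind : ∀ n, Indep (_mΩ := mΩ) (H n) F P := by
    intro n
    have h1 := (IndepFun_iff_Indep _ _ P).1 (hB.indepFun_shift (s₀ + ε n))
    refine indep_of_le_eventuallyMeasurableSpace h1 ?_
    intro D hD
    have h2 := ((hFm D).1 hD (s + ε n) (by have := hεpos n; simpa using this)).1
    refine eventuallyMeasurableSpace_le_of_le ?_ D h2
    refine le_trans (pastSpace_le fun u h0 hu _ => ?_) le_eventuallyMeasurableSpace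
    have hmem : u.toNNReal ∈ Iic (s₀ + ε n) := by
      rw [mem_Iic, ← NNReal.coe_le_coe, Real.coe_toNNReal u h0]
      push_cast
      rwa [hs₀']
    exact (measurable_pi_apply (X := fun _ : Iic (s₀ + ε n) => ℝ) ⟨u.toNNReal, hmem⟩).comp
      (comap_measurable fun ω (t : Iic (s₀ + ε n)) => B t ω)
  have hind' : Indep (_mΩ := mΩ) (⨆ n, H n) F P := indep_iSup_of_monotone hind hHle hFle hHmono
  have hGF : pastSpace T Y s ≤ F := by
    intro D hD
    refine (hFm D).2 fun q hq =>
      ⟨le_eventuallyMeasurableSpace D (pastSpace_mono (le_of_lt hq) D hD), ?_⟩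
    exact pastSpace_le (m := mΩ) (fun u _ _ _ => hBm _) D hD
  -- It remains to see that the past at `T` is generated by the past at `s` and the later
  -- increments.
  refine ⟨eventuallyMeasurableSet_of_indep hGF hFle (iSup_le hHle) hind' ((hFm A).2 hA) ?_,
    hFle A ((hFm A).2 hA)⟩
  refine eventuallyMeasurableSpace_le_of_le ?_ A (hA T hsT).1
  refine le_trans ?_ le_eventuallyMeasurableSpace
  set m : MeasurableSpace Ω := pastSpace T Y s ⊔ ⨆ n, H n with hm
  have hBs : Measurable[m] (B s₀) :=
    (measurable_pastSpace (Y := Y) hs0 le_rfl hsT.le).mono le_sup_left le_rfl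
  refine pastSpace_le fun u h0 _ huT => ?_
  rcases le_or_gt u s with hus | hus
  · exact (measurable_pastSpace h0 hus huT).mono le_sup_left le_rfl
  have hlt : s₀ < u.toNNReal := by
    rwa [← NNReal.coe_lt_coe, hs₀', Real.coe_toNNReal u h0]
  set v : ℝ≥0 := u.toNNReal with hv
  -- The increment from `s` itself belongs to no single `H n`; path continuity makes it a limit of
  -- increments from `s + ε n`.
  have hlimit : Measurable[m] fun ω => B v ω - B s₀ ω := by
    refine @measurable_of_tendsto_metrizable Ω ℝ m _ _ _ _
      (fun n ω => if s₀ + ε n ≤ v then B v ω - B (s₀ + ε n) ω else 0) _ ?_ ?_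
    · intro n
      by_cases hn : s₀ + ε n ≤ v
      · simp only [hn, if_true]
        have hc : Measurable[m] (Z n) :=
          (comap_measurable (Z n)).mono ((le_iSup H n).trans le_sup_right) le_rfl
        have e : (fun ω => B v ω - B (s₀ + ε n) ω) = fun ω => Z n ω (v - (s₀ + ε n)) := by
          funext ω
          simp only [hZ]
          rw [add_tsub_cancel_of_le hn]
        rw [e]
        exact (measurable_pi_apply _).comp hc
      · simp only [hn, if_false]
        exact measurable_const
    · rw [tendsto_pi_nhds]
      intro ω
      have h1 : Tendsto (fun n => s₀ + ε n) atTop (𝓝 s₀) := by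
        simpa using tendsto_const_nhds.add hεlim
      have h2 : Tendsto (fun n => B v ω - B (s₀ + ε n) ω) atTop (𝓝 (B v ω - B s₀ ω)) :=
        tendsto_const_nhds.sub (((hBc ω).tendsto s₀).comp h1)
      refine h2.congr' ?_
      filter_upwards [h1.eventually_lt_const hlt] with n hn
      rw [if_pos hn.le]
  have e : Y u = fun ω => (B v ω - B s₀ ω) + B s₀ ω := by
    funext ω
    simp [hY, hv]
  rw [e]
  exact hlimit.add hBs

end BrownianFiltration


/-! ### Gaussian structure of the vector Brownian motion and its law on path space. -/

section Gaussian

variable {Ω : Type*} {mΩ : MeasurableSpace Ω} {P : Measure Ω} {n : ℕ} {W : ℝ≥0 → Ω → Fin n → ℝ}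

theorem IsBrownianVec.isGaussianProcess_apply (hW : IsBrownianVec W P) (k : Fin n) :
    IsGaussianProcess (fun s ω => W s ω k) P :=
  IsPreBrownianReal.isGaussianProcess (hW.brownian k).toIsPreBrownianReal

/-- Independent Gaussian vectors are jointly Gaussian. A finite set of pairs (coordinate, time) is
enlarged to a rectangle, where independence of the coordinates applies, and is recovered by a linear
map. -/
theorem IsBrownianVec.isGaussianProcess [IsProbabilityMeasure P] (hW : IsBrownianVec W P) :
    IsGaussianProcess (fun (p : Fin n × ℝ≥0) ω => W p.2 ω p.1) P where
  hasGaussianLaw I := by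
    classical
    set J : Finset ℝ≥0 := I.image Prod.snd with hJ
    have h1 : HasGaussianLaw (fun ω (k : Fin n) => J.restrict fun s => W s ω k) P := by
      refine iIndepFun.hasGaussianLaw
        (fun k => (hW.isGaussianProcess_apply k).hasGaussianLaw J) ?_
      exact hW.indep.comp (fun _ => J.restrict) fun _ => Finset.measurable_restrict J
    let L : (Fin n → J → ℝ) →L[ℝ] I → ℝ :=
      { toFun x p := x p.1.1 ⟨p.1.2, Finset.mem_image_of_mem _ p.2⟩
        map_add' x y := by ext; simp
        map_smul' c x := by ext; simp }
    exact h1.map L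

theorem IsBrownianVec.memLp (hW : IsBrownianVec W P) (k : Fin n) (s : ℝ≥0) :
    MemLp (fun ω => W s ω k) 2 P :=
  ((hW.isGaussianProcess_apply k).hasGaussianLaw_eval s).memLp_two

theorem IsBrownianVec.covariance [IsProbabilityMeasure P] (hW : IsBrownianVec W P)
    (k l : Fin n) (s t : ℝ≥0) :
    cov[fun ω => W s ω k, fun ω => W t ω l; P] = if k = l then ((min s t : ℝ≥0) : ℝ) else 0 := by
  split_ifs with h
  · subst h
    rw [(hW.brownian k).toIsPreBrownianReal.covariance_fun_eval s t, NNReal.coe_min]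
  · exact ((hW.indep.indepFun h).comp (measurable_pi_apply s)
      (measurable_pi_apply t)).covariance_eq_zero (hW.memLp k s) (hW.memLp l t)

theorem IsBrownianVec.covariance_dotProduct [IsProbabilityMeasure P] (hW : IsBrownianVec W P)
    (b c : Fin n → ℝ) (s t : ℝ≥0) :
    cov[fun ω => b ⬝ᵥ W s ω, fun ω => c ⬝ᵥ W t ω; P] = (b ⬝ᵥ c) * (min s t : ℝ≥0) := by
  simp only [dotProduct]
  rw [covariance_fun_sum_fun_sum (fun k => (hW.memLp k s).const_mul (b k))
    fun k => (hW.memLp k t).const_mul (c k)]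
  simp only [covariance_const_mul_left, covariance_const_mul_right, hW.covariance, Finset.sum_mul]
  refine Finset.sum_congr rfl fun k _ => ?_
  simp
  ring

theorem IsBrownianVec.measurable_dotProduct (hW : IsBrownianVec W P) (b : Fin n → ℝ) (s : ℝ≥0) :
    Measurable fun ω => b ⬝ᵥ W s ω :=
  Finset.measurable_fun_sum _ fun k _ => ((measurable_pi_apply k).comp (hW.measurable s)).const_mul _

/-- Linear combinations of the coordinates of a Brownian motion form a Gaussian process. -/
theorem IsBrownianVec.isGaussianProcess_dotProduct [IsProbabilityMeasure P]
    (hW : IsBrownianVec W P) {ι : Type*} (b : ι → Fin n → ℝ) (s : ι → ℝ≥0) :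
    IsGaussianProcess (fun i ω => b i ⬝ᵥ W (s i) ω) P := by
  classical
  refine hW.isGaussianProcess.of_isGaussianProcess fun i => ?_
  let I : Finset (Fin n × ℝ≥0) := Finset.univ.image fun k => (k, s i)
  refine ⟨I, { toFun x := ∑ k, b i k * x ⟨(k, s i), Finset.mem_image_of_mem _ (Finset.mem_univ k)⟩
               map_add' x y := ?_
               map_smul' c x := ?_
               cont := by fun_prop }, fun ω => rfl⟩
  · simp only [Pi.add_apply, mul_add, Finset.sum_add_distrib]
  · simp only [Pi.smul_apply, smul_eq_mul, RingHom.id_apply, Finset.mul_sum]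
    exact Finset.sum_congr rfl fun k _ => by ring

theorem IsBrownianVec.isPreBrownianReal_dotProduct [IsProbabilityMeasure P]
    (hW : IsBrownianVec W P) {u : Fin n → ℝ} (hu : u ⬝ᵥ u = 1) :
    IsPreBrownianReal (fun s ω => u ⬝ᵥ W s ω) P := by
  refine IsGaussianProcess.isPreBrownianReal_of_covariance
    (hW.isGaussianProcess_dotProduct (fun _ => u) id) (fun s => ?_) fun s t hst => ?_
  · simp only [dotProduct]
    rw [integral_finsetSum _ fun k _ => ((hW.brownian k).integrable_eval s).const_mul (u k)]
    refine Finset.sum_eq_zero fun k _ => ?_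
    rw [integral_const_mul, (hW.brownian k).toIsPreBrownianReal.integral_eval s, mul_zero]
  · rw [hW.covariance_dotProduct, hu, one_mul, min_eq_left hst]

/-- The projection of a Brownian motion to a line is independent of its projection to the
orthogonal complement of the line. -/
theorem IsBrownianVec.indepFun_dotProduct [IsProbabilityMeasure P]
    (hW : IsBrownianVec W P) {u : Fin n → ℝ} (hu : u ⬝ᵥ u = 1) :
    IndepFun (fun ω (s : ℝ≥0) => u ⬝ᵥ W s ω)
      (fun ω (p : Fin n × ℝ≥0) => W p.2 ω p.1 - u p.1 * (u ⬝ᵥ W p.2 ω)) P := by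
  have e : (fun ω (p : Fin n × ℝ≥0) => W p.2 ω p.1 - u p.1 * (u ⬝ᵥ W p.2 ω))
      = fun ω (p : Fin n × ℝ≥0) => (Pi.single p.1 1 - u p.1 • u) ⬝ᵥ W p.2 ω := by
    funext ω p
    rw [sub_dotProduct, single_dotProduct, one_mul, smul_dotProduct, smul_eq_mul]
  rw [e]
  -- For jointly Gaussian families it suffices that the covariances vanish, and `u` is orthogonal to
  -- each `e_i - u_i u` because it is a unit vector.
  refine IsGaussianProcess.indepFun_of_covariance_eq_zero (X := fun s ω => u ⬝ᵥ W s ω)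
    (Y := fun (p : Fin n × ℝ≥0) ω => (Pi.single p.1 1 - u p.1 • u) ⬝ᵥ W p.2 ω) ?_
    (fun s => (hW.measurable_dotProduct _ _).aemeasurable)
    (fun s => (hW.measurable_dotProduct _ _).aemeasurable) fun s p => ?_
  · have h := hW.isGaussianProcess_dotProduct
      (Sum.elim (fun _ : ℝ≥0 => u) fun p : Fin n × ℝ≥0 => Pi.single p.1 1 - u p.1 • u)
      (Sum.elim id Prod.snd)
    refine h.congr fun i => ?_
    rcases i with s | p <;> exact EventuallyEq.rfl
  · rw [hW.covariance_dotProduct, dotProduct_sub, dotProduct_single, dotProduct_smul, hu]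
    simp

/-- Continuous paths. -/
abbrev Path : Type := {b : ℝ≥0 → ℝ // Continuous b}

/-- All Brownian motions have the same law on path space. -/
theorem map_path_eq {Ω' : Type*} {mΩ' : MeasurableSpace Ω'} {P' : Measure Ω'}
    {B : Ω → Path} {B' : Ω' → Path} (hBm : Measurable B) (hBm' : Measurable B')
    (hB : IsPreBrownianReal (fun s ω => (B ω).1 s) P)
    (hB' : IsPreBrownianReal (fun s ω => (B' ω).1 s) P') :
    P.map B = P'.map B' := by
  have : IsProbabilityMeasure P := hB.isGaussianProcess.isProbabilityMeasure
  have : IsProbabilityMeasure P' := hB'.isGaussianProcess.isProbabilityMeasure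
  have hv : Measurable fun ω => (B ω).1 := measurable_subtype_coe.comp hBm
  have hv' : Measurable fun ω => (B' ω).1 := measurable_subtype_coe.comp hBm'
  -- Both laws on the product space are projective limits of the same finite-dimensional
  -- distributions, and such a limit is unique.
  have h : P.map (fun ω => (B ω).1) = P'.map (fun ω => (B' ω).1) := by
    have l1 := isProjectiveLimit_map (P := P) (X := fun s ω => (B ω).1 s) hv.aemeasurable
    have l2 := isProjectiveLimit_map (P := P') (X := fun s ω => (B' ω).1 s) hv'.aemeasurable
    have e : (fun I : Finset ℝ≥0 => P.map fun ω => I.restrict fun s => (B ω).1 s)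
        = fun I => P'.map fun ω => I.restrict fun s => (B' ω).1 s := by
      funext I
      rw [(hB.hasLaw I).map_eq, (hB'.hasLaw I).map_eq]
    have hfin : ∀ I : Finset ℝ≥0, IsFiniteMeasure (P'.map fun ω => I.restrict fun s => (B' ω).1 s) :=
      fun I => inferInstance
    rw [e] at l1
    exact l1.unique l2
  -- The σ-algebra on `Path` is the trace of the product σ-algebra, so its sets are preimages under
  -- the inclusion.
  ext s hs
  obtain ⟨s', hs', rfl⟩ := hs
  have h1 : P.map B (Subtype.val ⁻¹' s') = P.map (fun ω => (B ω).1) s' := by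
    rw [Measure.map_apply hBm (measurable_subtype_coe hs'), Measure.map_apply hv hs']
    rfl
  have h2 : P'.map B' (Subtype.val ⁻¹' s') = P'.map (fun ω => (B' ω).1) s' := by
    rw [Measure.map_apply hBm' (measurable_subtype_coe hs'), Measure.map_apply hv' hs']
    rfl
  rw [h1, h2, h]

/-- Path evaluation is jointly measurable. -/
theorem measurable_path_eval : Measurable fun p : Path × ℝ≥0 => p.1.1 p.2 := by
  have h : Measurable (Function.uncurry fun (s : ℝ≥0) (b : Path) => b.1 s) :=
    measurable_uncurry_of_continuous_of_measurable (fun b => b.2)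
      fun s => (measurable_pi_apply s).comp measurable_subtype_coe
  exact h.comp measurable_swap

end Gaussian


/-! ### Combinatorics of a single schedule. -/

namespace Model.Schedule

variable {nG nL nc : ℕ} {M : Model nG nL nc} {S : M.Schedule}

theorem reqOf_eq_some {k : Fin nG} {j : ℕ} {e : M.allowed k} :
    S.reqOf k j = some e ↔ S.req j = some ⟨k, e⟩ := by
  unfold reqOf
  cases h : S.req j with
  | none => simp
  | some b =>
    obtain ⟨k', e'⟩ := b
    by_cases hk : k' = k
    · subst hk
      simp
    · simp only [Option.bind_some, hk, dif_neg, not_false_eq_true, Option.some.injEq]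
      constructor
      · intro h; simp at h
      · intro h; exact absurd (congrArg Sigma.fst h) hk

theorem isSome_reqOf {k : Fin nG} {j : ℕ} :
    (S.reqOf k j).isSome ↔ ∃ e, S.req j = some ⟨k, e⟩ := by
  simp only [Option.isSome_iff_exists, reqOf_eq_some]

theorem finite_requests (hfin : {j | S.time j ≠ ⊤}.Finite) (k : Fin nG) (s : ℝ) :
    {j | S.time j ≤ s ∧ (S.reqOf k j).isSome}.Finite :=
  hfin.subset fun _ hj => ne_top_of_le_ne_top WithTop.coe_ne_top hj.1

/-- Finiteness makes the `sSup` in `lastReq` an attained maximum; for an unbounded set of indices it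
would be the default value `0`. -/
theorem lastReq_eq_none (k : Fin nG) (s : ℝ) (hfin : {j | S.time j ≠ ⊤}.Finite) :
    S.lastReq k s = none ↔ ∀ j, S.time j ≤ s → ¬ (S.reqOf k j).isSome := by
  unfold lastReq
  split_ifs with h
  · have hm := Nat.sSup_mem h (finite_requests hfin k s).bddAbove
    simp only [Option.map_eq_none_iff]
    constructor
    · intro h1
      have h2 := hm.2
      rw [h1] at h2
      simp at h2
    · intro h1
      exact absurd hm.2 (h1 _ hm.1)
  · simp only [true_iff]
    intro j h1 h2
    exact h ⟨j, h1, h2⟩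

theorem lastReq_eq_some (k : Fin nG) (s : ℝ) (hfin : {j | S.time j ≠ ⊤}.Finite) (j : ℕ)
    (e : M.allowed k) :
    S.lastReq k s = some (j, e) ↔ S.time j ≤ s ∧ S.req j = some ⟨k, e⟩ ∧
      ∀ i, S.time i ≤ s → (S.reqOf k i).isSome → i ≤ j := by
  have hb := (finite_requests hfin k s).bddAbove
  unfold lastReq
  split_ifs with h
  · have hm := Nat.sSup_mem h hb
    simp only [Option.map_eq_some_iff, Prod.mk.injEq]
    constructor
    · rintro ⟨e', he', rfl, rfl⟩
      exact ⟨hm.1, reqOf_eq_some.1 he', fun i h1 h2 => le_csSup hb ⟨h1, h2⟩⟩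
    · rintro ⟨h1, h2, h3⟩
      have hj : sSup {j | S.time j ≤ s ∧ (S.reqOf k j).isSome} = j :=
        le_antisymm (h3 _ hm.1 hm.2) (le_csSup hb ⟨h1, isSome_reqOf.2 ⟨e, h2⟩⟩)
      exact ⟨e, by rw [hj]; exact reqOf_eq_some.2 h2, hj, rfl⟩
  · simp only [false_iff]
    rintro ⟨h1, h2, -⟩
    exact h ⟨j, h1, isSome_reqOf.2 ⟨e, h2⟩⟩

open Classical in
theorem mode_of_none {k : Fin nG} {s : ℝ} (h : S.lastReq k s = none) (a : M.Mode) :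
    S.mode a s k = if (s : WithTop ℝ) < S.initDone k then a k else Sum.inl (M.target (a k)) := by
  simp only [mode, h]

open Classical in
theorem mode_of_some {k : Fin nG} {s : ℝ} {j : ℕ} {e : M.allowed k}
    (h : S.lastReq k s = some (j, e)) (a : M.Mode) :
    S.mode a s k = if (s : WithTop ℝ) < S.done j then Sum.inr e else Sum.inl e.1.2 := by
  simp only [mode, h]

theorem eventually_le_iff (x : WithTop ℝ) (s : ℝ) :
    ∀ᶠ u : ℝ in 𝓝[>] s, (x ≤ (u : WithTop ℝ) ↔ x ≤ s) := by
  induction x with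
  | top => simp
  | coe y =>
    simp only [WithTop.coe_le_coe]
    rcases le_or_gt y s with h | h
    · filter_upwards [self_mem_nhdsWithin] with u hu
      exact ⟨fun _ => h, fun _ => h.trans (le_of_lt hu)⟩
    · filter_upwards [nhdsWithin_le_nhds (eventually_lt_nhds h)] with u hu
      exact ⟨fun h1 => absurd hu h1.not_gt, fun h1 => absurd h h1.not_gt⟩

theorem eventually_lt_iff (x : WithTop ℝ) (s : ℝ) :
    ∀ᶠ u : ℝ in 𝓝[>] s, ((u : WithTop ℝ) < x ↔ (s : WithTop ℝ) < x) :=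
  (eventually_le_iff x s).mono fun _ h => by rw [← not_le, ← not_le, h]

theorem eventually_time_le_iff (hfin : {j | S.time j ≠ ⊤}.Finite) (s : ℝ) :
    ∀ᶠ u : ℝ in 𝓝[>] s, ∀ j, (S.time j ≤ u ↔ S.time j ≤ s) := by
  have h := (hfin.eventually_all (l := 𝓝[>] s) (p := fun j u => (S.time j ≤ (u : ℝ) ↔ S.time j ≤ s))).2
    fun j _ => eventually_le_iff _ s
  filter_upwards [h] with u hu j
  by_cases hj : S.time j = ⊤
  · simp [hj]
  · exact hu j hj

/-- The mode process is right-continuous. -/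
theorem eventually_mode_eq (hfin : {j | S.time j ≠ ⊤}.Finite) (a : M.Mode) (s : ℝ) :
    ∀ᶠ u : ℝ in 𝓝[>] s, S.mode a u = S.mode a s := by
  have hk : ∀ k, ∀ᶠ u : ℝ in 𝓝[>] s, S.mode a u k = S.mode a s k := by
    intro k
    rcases h : S.lastReq k s with _ | ⟨j, e⟩
    · filter_upwards [eventually_time_le_iff hfin s, eventually_lt_iff (S.initDone k) s]
        with u hu hd
      have hu' : S.lastReq k u = none := by
        rw [lastReq_eq_none k _ hfin] at h ⊢
        exact fun j hj => h j ((hu j).1 hj)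
      rw [mode_of_none h, mode_of_none hu']
      simp only [hd]
    · filter_upwards [eventually_time_le_iff hfin s, eventually_lt_iff (S.done j) s] with u hu hd
      have hu' : S.lastReq k u = some (j, e) := by
        rw [lastReq_eq_some k _ hfin] at h ⊢
        exact ⟨(hu j).2 h.1, h.2.1, fun i hi => h.2.2 i ((hu i).1 hi)⟩
      rw [mode_of_some h, mode_of_some hu']
      simp only [hd]
  filter_upwards [eventually_all.2 hk] with u hu
  exact funext hu

section Admissible

variable {t : ℝ} {a : M.Mode} (hS : S.Admissible t a)

include hS

theorem Admissible.exists_time {k : Fin nG} {j : ℕ} (hj : (S.reqOf k j).isSome) :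
    ∃ τ : ℝ, S.time j = τ ∧ t ≤ τ ∧ τ ≤ M.T := by
  obtain ⟨e, he⟩ := isSome_reqOf.1 hj
  rcases hS.time_mem j with h | ⟨h1, h2⟩
  · rw [(hS.time_top j).1 h] at he
    simp at he
  · obtain ⟨τ, hτ⟩ := WithTop.ne_top_iff_exists.1 (ne_top_of_le_ne_top WithTop.coe_ne_top h2)
    rw [← hτ, WithTop.coe_le_coe] at h1 h2
    exact ⟨τ, hτ.symm, h1, h2⟩

/-- A generator is in no transition when a new transition is requested. -/
theorem Admissible.exists_stationary {k : Fin nG} {j : ℕ} (hj : (S.reqOf k j).isSome) :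
    ∃ u : ℝ, (u : WithTop ℝ) < S.time j ∧ (∃ l, S.mode a u k = Sum.inl l) ∧
      ∀ i, (S.reqOf k i).isSome → (S.time i ≤ u ↔ i < j) := by
  obtain ⟨τ, hτ, -, -⟩ := hS.exists_time hj
  obtain ⟨e, he⟩ := isSome_reqOf.1 hj
  have h1 := hS.mode_before j k e he
  rw [hτ, WithTop.untopD_coe] at h1
  -- Close enough to `τ`, all earlier requests for the generator have already been made, since their
  -- times are strictly smaller than `τ`.
  have h2 : ∀ᶠ u : ℝ in 𝓝[<] τ, ∀ i ∈ Finset.range j, (S.reqOf k i).isSome → S.time i ≤ u := by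
    rw [Finset.eventually_all]
    intro i hi
    by_cases hi' : (S.reqOf k i).isSome
    · obtain ⟨τ', hτ', -, -⟩ := hS.exists_time hi'
      have h3 := hS.time_strict k i j (Finset.mem_range.1 hi) hi' hj
      rw [hτ, hτ', WithTop.coe_lt_coe] at h3
      filter_upwards [nhdsWithin_le_nhds (eventually_gt_nhds h3)] with u hu _
      rw [hτ', WithTop.coe_le_coe]
      exact le_of_lt hu
    · exact Eventually.of_forall fun u h => absurd h hi'
  obtain ⟨u, ⟨hu1, hu2⟩, hu3⟩ := ((h1.and h2).and self_mem_nhdsWithin).exists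
  have hu3' : (u : WithTop ℝ) < S.time j := by
    rw [hτ, WithTop.coe_lt_coe]
    exact hu3
  refine ⟨u, hu3', ⟨_, hu1⟩, fun i hi => ⟨fun h => ?_, fun h => hu2 i (Finset.mem_range.2 h) hi⟩⟩
  by_contra hij
  exact absurd (h.trans_lt hu3') ((hS.time_mono (not_lt.1 hij)).not_gt)

/-- Shortly before request `j` the generator is stationary, so its latest request up to then is
completed; older ones were completed before that request, by strong induction. -/
theorem Admissible.done_lt_time {k : Fin nG} {i j : ℕ} (hi : (S.reqOf k i).isSome)
    (hj : (S.reqOf k j).isSome) (hij : i < j) : S.done i < S.time j := by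
  classical
  induction j using Nat.strong_induction_on with
  | _ j ih =>
    obtain ⟨u, hu, ⟨l, hl⟩, hlt⟩ := hS.exists_stationary hj
    rcases h : S.lastReq k u with _ | ⟨i', e'⟩
    · exact absurd hi ((lastReq_eq_none k u hS.finite).1 h i ((hlt i hi).2 hij))
    · obtain ⟨h1, h2, h3⟩ := (lastReq_eq_some k u hS.finite i' e').1 h
      have hi' : (S.reqOf k i').isSome := isSome_reqOf.2 ⟨e', h2⟩
      have hi'j : i' < j := (hlt i' hi').1 h1
      rw [mode_of_some h] at hl
      have hd : ¬ (u : WithTop ℝ) < S.done i' := by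
        intro hd
        rw [if_pos hd] at hl
        simp at hl
      rcases (h3 i ((hlt i hi).2 hij) hi).eq_or_lt with rfl | hlt'
      · exact (not_lt.1 hd).trans_lt hu
      · exact (ih i' hi'j hi' hlt').trans_le (hS.time_mono hi'j.le)

/-- The first request of the generator is admissible only in a stationary mode, and before it only
the initial transition can occupy the generator. -/
theorem Admissible.initDone_lt_time {k : Fin nG} {j : ℕ} (hj : (S.reqOf k j).isSome)
    {e : M.allowed k} (ha : a k = Sum.inr e) : S.initDone k < S.time j := by
  classical
  have hex : ∃ j, (S.reqOf k j).isSome := ⟨j, hj⟩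
  obtain ⟨u, hu, ⟨l, hl⟩, hlt⟩ := hS.exists_stationary (Nat.find_spec hex)
  have h : S.lastReq k u = none := by
    rw [lastReq_eq_none k u hS.finite]
    intro i hi hi'
    exact Nat.find_min hex ((hlt i hi').1 hi) hi'
  rw [mode_of_none h] at hl
  have hd : ¬ (u : WithTop ℝ) < S.initDone k := by
    intro hd
    rw [if_pos hd, ha] at hl
    simp at hl
  exact ((not_lt.1 hd).trans_lt hu).trans_le (hS.time_mono (Nat.find_min' hex hj))

open Classical in
/-- A quantity that is zero in stationary modes splits into the contributions of the transitions,
since at most one transition of a generator is going on at a time. -/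
theorem Admissible.transition_split (k : Fin nG) (s : ℝ) (φ : ℝ) (ψ : ℕ → ℝ) (J : Finset ℕ)
    (hJ : ∀ j, (S.reqOf k j).isSome → j ∈ J) :
    (S.lastReq k s).elim
      (Sum.elim (fun _ => 0) (fun _ => if (s : WithTop ℝ) < S.initDone k then φ else 0) (a k))
      (fun p => if (s : WithTop ℝ) < S.done p.1 then ψ p.1 else 0)
    = Sum.elim (fun _ => 0) (fun _ => if (s : WithTop ℝ) < S.initDone k then φ else 0) (a k)
      + ∑ j ∈ J, if (S.reqOf k j).isSome then
          (if S.time j ≤ s ∧ (s : WithTop ℝ) < S.done j then ψ j else 0) else 0 := by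
  rcases h : S.lastReq k s with _ | ⟨j, e⟩
  · rw [Finset.sum_eq_zero, add_zero, Option.elim_none]
    intro j _
    split_ifs with h1 h2
    · exact absurd h1 ((lastReq_eq_none k s hS.finite).1 h j h2.1)
    · rfl
    · rfl
  · obtain ⟨h1, h2, h3⟩ := (lastReq_eq_some k s hS.finite j e).1 h
    have hj : (S.reqOf k j).isSome := isSome_reqOf.2 ⟨e, h2⟩
    rw [Finset.sum_eq_single_of_mem j (hJ j hj)]
    · have h0 : Sum.elim (fun _ => 0)
          (fun _ => if (s : WithTop ℝ) < S.initDone k then φ else 0) (a k) = 0 := by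
        rcases ha : a k with l | e'
        · rfl
        · rw [Sum.elim_inr, if_neg]
          exact not_lt.2 ((hS.initDone_lt_time hj ha).le.trans h1)
      rw [h0, zero_add]
      simp [hj, h1]
    · intro i _ hij
      split_ifs with h4 h5
      · have hlt : i < j := lt_of_le_of_ne (h3 i h5.1 h4) hij
        exact absurd h5.2 (not_lt.2 ((hS.done_lt_time h4 hj hlt).le.trans h1))
      · rfl
      · rfl

end Admissible

end Model.Schedule


/-! ### Joint measurability, in scenario and time, of the processes built from a schedule. -/

theorem measurable_of_countable_label {X ι Y : Type*} [MeasurableSpace X] [MeasurableSpace Y]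
    [Countable ι] {f : X → ι} (hf : ∀ i, MeasurableSet {x | f x = i}) {g : ι → X → Y}
    (hg : ∀ i, Measurable (g i)) : Measurable fun x => g (f x) x := by
  intro s hs
  have e : (fun x => g (f x) x) ⁻¹' s = ⋃ i, {x | f x = i} ∩ g i ⁻¹' s := by
    ext x
    simp
  rw [e]
  exact MeasurableSet.iUnion fun i => (hf i).inter (hg i hs)

theorem measurableSet_of_countable_label {X ι : Type*} [MeasurableSpace X]
    [Countable ι] {f : X → ι} (hf : ∀ i, MeasurableSet {x | f x = i}) {p : ι → X → Prop}
    (hp : ∀ i, MeasurableSet {x | p i x}) : MeasurableSet {x | p (f x) x} := by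
  have e : {x | p (f x) x} = ⋃ i, {x | f x = i} ∩ {x | p i x} := by
    ext x
    simp
  rw [e]
  exact MeasurableSet.iUnion fun i => (hf i).inter (hp i)

theorem measurable_intervalIntegral {X : Type*} [MeasurableSpace X] {h : X → ℝ → ℝ}
    (hh : Measurable (Function.uncurry h)) (t : ℝ) :
    Measurable fun p : X × ℝ => ∫ u in t..p.2, h p.1 u := by
  have key : ∀ A : Set ((X × ℝ) × ℝ), MeasurableSet A →
      Measurable fun p : X × ℝ => ∫ u, A.indicator (fun q => h q.1.1 q.2) (p, u) := by
    intro A hA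
    have h1 : Measurable fun q : (X × ℝ) × ℝ => h q.1.1 q.2 :=
      hh.comp ((measurable_fst.comp measurable_fst).prodMk measurable_snd)
    exact ((h1.indicator hA).stronglyMeasurable.integral_prod_right' (ν := volume)).measurable
  have hA1 : MeasurableSet {q : (X × ℝ) × ℝ | t < q.2 ∧ q.2 ≤ q.1.2} :=
    (measurableSet_lt measurable_const measurable_snd).inter
      (measurableSet_le measurable_snd (measurable_snd.comp measurable_fst))
  have hA2 : MeasurableSet {q : (X × ℝ) × ℝ | q.1.2 < q.2 ∧ q.2 ≤ t} :=
    (measurableSet_lt (measurable_snd.comp measurable_fst) measurable_snd).inter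
      (measurableSet_le measurable_snd measurable_const)
  -- The variable endpoint is moved into indicators, one for each orientation of the interval, so
  -- that Fubini measurability applies to integrals over the whole line.
  convert! (key _ hA1).sub (key _ hA2) using 2 with p
  rw [intervalIntegral, ← integral_indicator measurableSet_Ioc,
    ← integral_indicator measurableSet_Ioc]
  rfl

variable {nG nL nc : ℕ} {M : Model nG nL nc}

/-- A measurable family of schedules. -/
structure MeasurableSchedule {X : Type*} [MeasurableSpace X] (S : X → M.Schedule) : Prop where
  time : ∀ j, Measurable fun x => (S x).time j
  req : ∀ j b, MeasurableSet {x | (S x).req j = some b}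
  initDone : ∀ k, Measurable fun x => (S x).initDone k
  done : ∀ j, Measurable fun x => (S x).done j

namespace MeasurableSchedule

variable {X : Type*} [MeasurableSpace X] {S : X → M.Schedule} (hS : MeasurableSchedule S)

include hS

theorem comp {Y : Type*} [MeasurableSpace Y] {φ : Y → X} (hφ : Measurable φ) :
    MeasurableSchedule fun y => S (φ y) where
  time j := (hS.time j).comp hφ
  req j b := hφ (hS.req j b)
  initDone k := (hS.initDone k).comp hφ
  done j := (hS.done j).comp hφ

theorem req_eq (j : ℕ) (o : Option M.Request) : MeasurableSet {x | (S x).req j = o} := by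
  cases o with
  | some b => exact hS.req j b
  | none =>
    have e : {x | (S x).req j = none} = (⋃ b, {x | (S x).req j = some b})ᶜ := by
      ext x
      simp only [mem_ofPred_eq, mem_compl_iff, mem_iUnion, not_exists]
      cases (S x).req j <;> simp
    rw [e]
    exact (MeasurableSet.iUnion fun b => hS.req j b).compl

theorem reqDelay (j : ℕ) : Measurable fun x => (S x).reqDelay j :=
  measurable_of_countable_label (f := fun x => (S x).req j)
    (g := fun o _ => o.elim 0 fun b => M.delay b.1 b.2) (hS.req_eq j) fun _ => measurable_const

theorem reqCost (j : ℕ) : Measurable fun x => (S x).reqCost j :=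
  measurable_of_countable_label (f := fun x => (S x).req j)
    (g := fun o _ => o.elim 0 fun b => M.swCost b.1 b.2) (hS.req_eq j) fun _ => measurable_const

theorem isSome_reqOf (k : Fin nG) (j : ℕ) : MeasurableSet {x | ((S x).reqOf k j).isSome} := by
  simp only [Model.Schedule.isSome_reqOf, ofPred_exists]
  exact MeasurableSet.iUnion fun e => hS.req j _

omit hS in
theorem measurableSet_le_coe {f : X → WithTop ℝ} (hf : Measurable f) :
    MeasurableSet {p : X × ℝ | f p.1 ≤ (p.2 : WithTop ℝ)} :=
  measurableSet_le (hf.comp measurable_fst) measurable_snd.withTop_coe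

omit hS in
theorem measurableSet_coe_lt {f : X → WithTop ℝ} (hf : Measurable f) :
    MeasurableSet {p : X × ℝ | (p.2 : WithTop ℝ) < f p.1} :=
  measurableSet_lt measurable_snd.withTop_coe (hf.comp measurable_fst)

variable (hfin : ∀ x, {j | (S x).time j ≠ ⊤}.Finite)

include hfin

theorem lastReq_eq (k : Fin nG) (o : Option (ℕ × M.allowed k)) :
    MeasurableSet {p : X × ℝ | (S p.1).lastReq k p.2 = o} := by
  have hreq : ∀ j, MeasurableSet {p : X × ℝ | ((S p.1).reqOf k j).isSome} := fun j =>
    measurable_fst (hS.isSome_reqOf k j)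
  rcases o with _ | ⟨j, e⟩
  · have e1 : {p : X × ℝ | (S p.1).lastReq k p.2 = none}
        = ⋂ j, ({p : X × ℝ | (S p.1).time j ≤ (p.2 : WithTop ℝ)}
          ∩ {p : X × ℝ | ((S p.1).reqOf k j).isSome})ᶜ := by
      ext p
      simp only [mem_ofPred_eq, Model.Schedule.lastReq_eq_none k p.2 (hfin p.1), mem_iInter,
        mem_compl_iff, mem_inter_iff, not_and]
    rw [e1]
    exact MeasurableSet.iInter fun j => ((measurableSet_le_coe (hS.time j)).inter (hreq j)).compl
  · have e1 : {p : X × ℝ | (S p.1).lastReq k p.2 = some (j, e)}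
        = {p : X × ℝ | (S p.1).time j ≤ (p.2 : WithTop ℝ)} ∩
          ({p : X × ℝ | (S p.1).req j = some ⟨k, e⟩} ∩
          ⋂ i : {i // ¬ i ≤ j}, ({p : X × ℝ | (S p.1).time i ≤ (p.2 : WithTop ℝ)}
          ∩ {p : X × ℝ | ((S p.1).reqOf k i).isSome})ᶜ) := by
      ext p
      simp only [mem_ofPred_eq, Model.Schedule.lastReq_eq_some k p.2 (hfin p.1), mem_iInter,
        mem_compl_iff, mem_inter_iff, not_and, Subtype.forall]
      refine and_congr_right fun _ => and_congr_right fun _ => ?_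
      exact ⟨fun h i hi h1 h2 => hi (h i h1 h2), fun h i h1 h2 => by
        by_contra hi
        exact h i hi h1 h2⟩
    rw [e1]
    exact (measurableSet_le_coe (hS.time j)).inter ((measurable_fst (hS.req j _)).inter
      (MeasurableSet.iInter fun i =>
        ((measurableSet_le_coe (hS.time i)).inter (hreq i)).compl))

theorem mode_apply_eq (a : M.Mode) (k : Fin nG) (c : M.GenMode k) :
    MeasurableSet {p : X × ℝ | (S p.1).mode a p.2 k = c} := by
  classical
  refine measurableSet_of_countable_label (f := fun p : X × ℝ => (S p.1).lastReq k p.2)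
    (p := fun o p => (match o with
      | some (j, e) => if (p.2 : WithTop ℝ) < (S p.1).done j then Sum.inr e else Sum.inl e.1.2
      | none => if (p.2 : WithTop ℝ) < (S p.1).initDone k then a k
          else Sum.inl (M.target (a k)) : M.GenMode k) = c)
    (hS.lastReq_eq hfin k) fun o => ?_
  have key : ∀ (f : X → WithTop ℝ), Measurable f → ∀ c₁ c₂ : M.GenMode k,
      MeasurableSet {p : X × ℝ | (if (p.2 : WithTop ℝ) < f p.1 then c₁ else c₂) = c} := by
    intro f hf c₁ c₂
    have e1 : {p : X × ℝ | (if (p.2 : WithTop ℝ) < f p.1 then c₁ else c₂) = c}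
        = ({p : X × ℝ | (p.2 : WithTop ℝ) < f p.1} ∩ {_p | c₁ = c})
          ∪ ({p : X × ℝ | (p.2 : WithTop ℝ) < f p.1}ᶜ ∩ {_p | c₂ = c}) := by
      ext p
      by_cases h : (p.2 : WithTop ℝ) < f p.1 <;> simp [h]
    rw [e1]
    exact ((measurableSet_coe_lt hf).inter (.const _)).union
      ((measurableSet_coe_lt hf).compl.inter (.const _))
  rcases o with _ | ⟨j, e⟩
  · exact key _ (hS.initDone k) _ _
  · exact key _ (hS.done j) _ _

theorem mode_eq (a : M.Mode) (α : M.Mode) :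
    MeasurableSet {p : X × ℝ | (S p.1).mode a p.2 = α} := by
  simp only [funext_iff, ofPred_forall]
  exact MeasurableSet.iInter fun k => hS.mode_apply_eq hfin a k (α k)

/-- There are finitely many modes, so measurability of a mode-dependent quantity can be checked with
the mode held fixed. -/
theorem mode_comp (a : M.Mode) {Y : Type*} [MeasurableSpace Y] {g : M.Mode → X × ℝ → Y}
    (hg : ∀ α, Measurable (g α)) :
    Measurable fun p : X × ℝ => g ((S p.1).mode a p.2) p :=
  measurable_of_countable_label (f := fun p : X × ℝ => (S p.1).mode a p.2)
    (hS.mode_eq hfin a) hg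

theorem prog (t : ℝ) (a : M.Mode) (r : Fin nG → ℝ) :
    Measurable fun p : X × ℝ => (S p.1).prog t a r p.2 := by
  classical
  rw [measurable_pi_iff]
  intro k
  refine measurable_of_countable_label (f := fun p : X × ℝ => (S p.1).lastReq k p.2)
    (g := fun o p => match o with
      | some (j, _) => if (p.2 : WithTop ℝ) < (S p.1).done j
          then p.2 - ((S p.1).time j).untopD 0 else 0
      | none => match a k with
        | Sum.inl _ => 0
        | Sum.inr _ => if (p.2 : WithTop ℝ) < (S p.1).initDone k then p.2 - (t - r k) else 0)
    (hS.lastReq_eq hfin k) fun o => ?_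
  rcases o with _ | ⟨j, e⟩
  · simp only
    rcases a k with l | e
    · exact measurable_const
    · exact Measurable.ite (measurableSet_coe_lt (hS.initDone k))
        (measurable_snd.sub measurable_const) measurable_const
  · exact Measurable.ite (measurableSet_coe_lt (hS.done j))
      (measurable_snd.sub (((hS.time j).comp measurable_fst).untopD 0)) measurable_const

theorem numTrans (a : M.Mode) :
    Measurable fun p : X × ℝ => M.numTrans ((S p.1).mode a p.2) :=
  hS.mode_comp hfin a (g := fun α _ => M.numTrans α) fun _ => measurable_const

end MeasurableSchedule

/-- The sum is computed in `ENNReal`. Where the series diverges, the default value `0` of the real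
sum agrees with `toReal ⊤`. -/
theorem measurable_tsum_of_nonneg {X : Type*} [MeasurableSpace X] {f : ℕ → X → ℝ}
    (hf : ∀ j, Measurable (f j)) (h0 : ∀ j x, 0 ≤ f j x) : Measurable fun x => ∑' j, f j x := by
  have e : (fun x => ∑' j, f j x)
      = fun x => (∑' j, ENNReal.ofReal (f j x)).toReal := by
    funext x
    by_cases hs : Summable fun j => f j x
    · rw [← ENNReal.ofReal_tsum_of_nonneg (fun j => h0 j x) hs,
        ENNReal.toReal_ofReal (tsum_nonneg fun j => h0 j x)]
    · rw [tsum_eq_zero_of_not_summable hs]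
      by_contra h
      have h1 : ∑' j, ENNReal.ofReal (f j x) ≠ ⊤ := fun h2 => h (by rw [h2]; rfl)
      refine hs ?_
      have := ENNReal.summable_toReal h1
      simpa only [ENNReal.toReal_ofReal (h0 _ x)] using this
  rw [e]
  exact (Measurable.tsum fun j => (hf j).ennreal_ofReal).ennreal_toReal

namespace MeasurableSchedule

variable {X : Type*} [MeasurableSpace X] {S : X → M.Schedule} (hS : MeasurableSchedule S)
  (hfin : ∀ x, {j | (S x).time j ≠ ⊤}.Finite)

include hS hfin

theorem totProg (hM : M.Valid) (t : ℝ) (a : M.Mode) (w : ℝ) :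
    Measurable fun p : X × ℝ => (S p.1).totProg t a w p.2 := by
  classical
  unfold Model.Schedule.totProg
  have h1 : Measurable fun p : X × ℝ => ∫ u in t..p.2, M.numTrans ((S p.1).mode a u) :=
    measurable_intervalIntegral (h := fun x u => M.numTrans ((S x).mode a u))
      (hS.numTrans hfin a) t
  have hset : ∀ f : X → WithTop ℝ, Measurable f →
      MeasurableSet {p : X × ℝ | (t : WithTop ℝ) ≤ f p.1 ∧ f p.1 ≤ (p.2 : WithTop ℝ)} :=
    fun f hf => (measurableSet_le measurable_const (hf.comp measurable_fst)).inter
      (measurableSet_le_coe hf)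
  refine ((measurable_const.add h1).sub (Finset.measurable_fun_sum _ fun k _ => ?_)).sub ?_
  · exact Measurable.ite (hset _ (hS.initDone k)) measurable_const measurable_const
  · refine measurable_tsum_of_nonneg (f := fun j (p : X × ℝ) =>
      if t ≤ (S p.1).done j ∧ (S p.1).done j ≤ p.2 then (S p.1).reqDelay j else 0)
      (fun j => ?_) fun j p => ?_
    · exact Measurable.ite (hset _ (hS.done j)) ((hS.reqDelay j).comp measurable_fst)
        measurable_const
    · split_ifs
      · unfold Model.Schedule.reqDelay
        cases (S p.1).req j with
        | none => exact le_rfl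
        | some b => exact (hM.delay_pos _ _).le
      · exact le_rfl

end MeasurableSchedule


/-! ### Total progression when transitions take exactly their prescribed time. -/

open Classical in
theorem integral_indicator_Ico (t s τ d : ℝ) (hts : t ≤ s) :
    ∫ u in t..s, (if τ ≤ u ∧ u < d then (1 : ℝ) else 0) = max (min s d - max t τ) 0 := by
  rw [intervalIntegral.integral_of_le hts]
  have h1 : (fun u : ℝ => if τ ≤ u ∧ u < d then (1 : ℝ) else 0) = (Ico τ d).indicator 1 := by
    funext u
    simp [indicator_apply]
  rw [h1, integral_indicator_one measurableSet_Ico, measureReal_def,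
    Measure.restrict_apply measurableSet_Ico]
  have h2 : (Ico τ d ∩ Ioc t s : Set ℝ) =ᵐ[volume] (Ioc τ d ∩ Ioc t s : Set ℝ) :=
    (Ico_ae_eq_Ioc).inter (EventuallyEq.refl _ _)
  rw [measure_congr h2, Ioc_inter_Ioc, Real.volume_Ioc, ENNReal.toReal_ofReal', max_comm t τ,
    min_comm s d]

theorem intervalIntegrable_ite {p : ℝ → Prop} [DecidablePred p] (hp : MeasurableSet {u | p u}) (c t s : ℝ) :
    IntervalIntegrable (fun u => if p u then c else 0) volume t s := by
  rw [intervalIntegrable_iff]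
  refine Measure.integrableOn_of_bounded (M := |c|) measure_Ioc_lt_top.ne
    (Measurable.ite hp measurable_const measurable_const).aestronglyMeasurable
    (Eventually.of_forall fun u => ?_)
  split_ifs <;> simp

namespace Model.Schedule

variable {nG nL nc : ℕ} {M : Model nG nL nc} {S : M.Schedule}

theorem isSome_reqOf_iff {j : ℕ} {b : M.Request} (hb : S.req j = some b) (k : Fin nG) :
    (S.reqOf k j).isSome ↔ k = b.1 := by
  rw [isSome_reqOf, hb]
  constructor
  · rintro ⟨e, he⟩
    rw [Option.some.injEq] at he
    rw [he]
  · rintro rfl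
    exact ⟨b.2, rfl⟩

theorem reqDelay_nonneg (hM : M.Valid) (j : ℕ) : 0 ≤ S.reqDelay j := by
  unfold reqDelay
  cases S.req j with
  | none => exact le_rfl
  | some b => exact (hM.delay_pos _ _).le

theorem reqCost_nonneg (hM : M.Valid) (j : ℕ) : 0 ≤ S.reqCost j := by
  unfold reqCost
  cases S.req j with
  | none => exact le_rfl
  | some b => exact hM.swCost_nonneg _ _

/-- A sum over all requests is a sum over the generators and their requests. -/
theorem sum_requests (J : Finset ℕ) (x : ℕ → ℝ) (hx : ∀ j, S.req j = none → x j = 0) :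
    ∑ j ∈ J, x j = ∑ k, ∑ j ∈ J, if (S.reqOf k j).isSome then x j else 0 := by
  rw [Finset.sum_comm]
  refine Finset.sum_congr rfl fun j _ => ?_
  cases hb : S.req j with
  | none =>
    rw [hx j hb]
    simp
  | some b =>
    simp only [isSome_reqOf_iff hb]
    simp

theorem reqDelay_of_none {j : ℕ} (h : S.req j = none) : S.reqDelay j = 0 := by
  simp [reqDelay, h]

theorem reqCost_of_none {j : ℕ} (h : S.req j = none) : S.reqCost j = 0 := by
  simp [reqCost, h]

variable {t : ℝ} {a : M.Mode}

/-- The finite set of the requests of an admissible schedule. -/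
noncomputable def Admissible.requests (hS : S.Admissible t a) : Finset ℕ := hS.finite.toFinset

theorem Admissible.mem_requests (hS : S.Admissible t a) {j : ℕ} :
    j ∈ hS.requests ↔ S.req j ≠ none := by
  rw [Admissible.requests, Set.Finite.mem_toFinset, mem_ofPred_eq, ne_eq, hS.time_top]

theorem Admissible.tsum_eq (hS : S.Admissible t a) {x : ℕ → ℝ}
    (hx : ∀ j, S.req j = none → x j = 0) : ∑' j, x j = ∑ j ∈ hS.requests, x j :=
  tsum_eq_sum fun j hj => hx j (by simpa [hS.mem_requests] using hj)

theorem Admissible.reqOf_mem (hS : S.Admissible t a) {k : Fin nG} (j : ℕ)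
    (hj : (S.reqOf k j).isSome) : j ∈ hS.requests := by
  obtain ⟨e, he⟩ := isSome_reqOf.1 hj
  rw [hS.mem_requests, he]
  simp

-- This form allows the time integral of the number of transitions to be taken one transition at a
-- time.
open Classical in
theorem Admissible.numTrans_eq (hS : S.Admissible t a) (u : ℝ) :
    M.numTrans (S.mode a u) = ∑ k, (Sum.elim (fun _ => 0)
        (fun _ => if (u : WithTop ℝ) < S.initDone k then (1 : ℝ) else 0) (a k)
      + ∑ j ∈ hS.requests, if (S.reqOf k j).isSome then
          (if S.time j ≤ u ∧ (u : WithTop ℝ) < S.done j then 1 else 0) else 0) := by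
  unfold numTrans
  refine Finset.sum_congr rfl fun k _ => ?_
  rw [← hS.transition_split k u 1 (fun _ => 1) hS.requests hS.reqOf_mem]
  rcases h : S.lastReq k u with _ | ⟨j, e⟩
  · rw [mode_of_none h]
    split_ifs with h1
    · rcases a k <;> simp
    · rcases a k <;> simp
  · rw [mode_of_some h]
    by_cases h1 : (u : WithTop ℝ) < S.done j <;> simp [h1]

theorem numTrans_le (α : M.Mode) : M.numTrans α ≤ nG := by
  calc M.numTrans α ≤ ∑ _k : Fin nG, (1 : ℝ) := Finset.sum_le_sum fun k _ => by
        rcases α k <;> simp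
    _ = nG := by simp

theorem numTrans_nonneg (α : M.Mode) : 0 ≤ M.numTrans α :=
  Finset.sum_nonneg fun k _ => by rcases α k <;> simp

/-- A schedule in which each transition takes exactly its prescribed duration. -/
structure IsExact (S : M.Schedule) (t : ℝ) (a : M.Mode) (r : Fin nG → ℝ) : Prop where
  done_eq : ∀ j, S.done j = S.time j + ((S.reqDelay j : ℝ) : WithTop ℝ)
  initDone_eq : ∀ k, S.initDone k = ((t - r k + Model.genDelay (a k) : ℝ) : WithTop ℝ)

theorem IsExact.time_le_done (hM : M.Valid) {r : Fin nG → ℝ} (h : S.IsExact t a r) (j : ℕ) :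
    S.time j ≤ S.done j := by
  rw [h.done_eq j]
  cases S.time j with
  | top => simp
  | coe τ =>
    rw [← WithTop.coe_add, WithTop.coe_le_coe]
    linarith [S.reqDelay_nonneg hM j]

theorem progSet_le {r : Fin nG → ℝ} (hr : r ∈ M.progSet a) (k : Fin nG) :
    0 ≤ r k ∧ r k ≤ Model.genDelay (a k) := by
  have h := hr k
  rcases ha : a k with l | e
  · rw [ha] at h
    simp only at h
    simp [h, genDelay]
  · rw [ha] at h
    exact ⟨h.1, h.2.le⟩

theorem IsExact.le_initDone {r : Fin nG → ℝ} (h : S.IsExact t a r) (hr : r ∈ M.progSet a)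
    (k : Fin nG) : (t : WithTop ℝ) ≤ S.initDone k := by
  rw [h.initDone_eq k, WithTop.coe_le_coe]
  linarith [(progSet_le hr k).2]

/-- Transitions occupy half-open time intervals, which is exactly the strict upper bound in
`progSet`. -/
theorem Admissible.prog_mem (hS : S.Admissible t a) {r : Fin nG → ℝ}
    (h : S.IsExact t a r) (hr : r ∈ M.progSet a) {s : ℝ} (hs : t ≤ s) :
    S.prog t a r s ∈ M.progSet (S.mode a s) := by
  intro k
  have hk := hr k
  rcases hl : S.lastReq k s with _ | ⟨j, e⟩
  · rw [mode_of_none hl]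
    simp only [prog, hl]
    rcases ha : a k with l | e
    · split_ifs <;> rfl
    · rw [ha] at hk
      split_ifs with h1
      · rw [h.initDone_eq k, ha, WithTop.coe_lt_coe] at h1
        simp only [genDelay] at h1
        exact ⟨by linarith [hk.1], by linarith⟩
      · rfl
  · obtain ⟨h1, h2, -⟩ := (lastReq_eq_some k s hS.finite j e).1 hl
    obtain ⟨τ, hτ, -, -⟩ := hS.exists_time (isSome_reqOf.2 ⟨e, h2⟩)
    rw [mode_of_some hl]
    simp only [prog, hl]
    split_ifs with h3
    · rw [h.done_eq j, hτ, ← WithTop.coe_add, WithTop.coe_lt_coe] at h3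
      rw [hτ, WithTop.coe_le_coe] at h1
      have : S.reqDelay j = M.delay k e := by simp [reqDelay, h2]
      rw [hτ, WithTop.untopD_coe]
      exact ⟨by linarith, by linarith⟩
    · rfl

theorem Admissible.intervalIntegrable_numTrans (hS : S.Admissible t a) (s s' : ℝ) :
    IntervalIntegrable (fun u => M.numTrans (S.mode a u)) volume s s' := by
  have hm : Measurable fun u => M.numTrans (S.mode a u) := by
    have h : MeasurableSchedule fun _ : Unit => S :=
      ⟨fun _ => measurable_const, fun _ _ => .const _, fun _ => measurable_const,
        fun _ => measurable_const⟩
    exact (h.numTrans (fun _ => hS.finite) a).comp (measurable_const (a := ()) |>.prodMk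
      measurable_id)
  rw [intervalIntegrable_iff]
  refine Measure.integrableOn_of_bounded (M := nG) measure_Ioc_lt_top.ne
    hm.aestronglyMeasurable (Eventually.of_forall fun u => ?_)
  rw [Real.norm_of_nonneg (numTrans_nonneg _)]
  exact numTrans_le _

-- Each transition contributes the length of the part of its time interval that lies in `[t, s]`;
-- the outer `max` with `0` covers requests made after `s`.
open Classical in
theorem Admissible.integral_numTrans (hS : S.Admissible t a) {r : Fin nG → ℝ}
    (h : S.IsExact t a r) (hr : r ∈ M.progSet a) {s : ℝ} (hs : t ≤ s) :
    ∫ u in t..s, M.numTrans (S.mode a u) = ∑ k, (Sum.elim (fun _ => 0)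
        (fun _ => min s (t - r k + Model.genDelay (a k)) - t) (a k)
      + ∑ j ∈ hS.requests, if (S.reqOf k j).isSome then
          max (min s ((S.time j).untopD 0 + S.reqDelay j) - (S.time j).untopD 0) 0 else 0) := by
  have hm1 : ∀ x : WithTop ℝ, MeasurableSet {u : ℝ | (u : WithTop ℝ) < x} := fun x =>
    measurableSet_lt measurable_id.withTop_coe measurable_const
  have hm2 : ∀ x y : WithTop ℝ, MeasurableSet {u : ℝ | x ≤ (u : WithTop ℝ) ∧ (u : WithTop ℝ) < y} :=
    fun x y => (measurableSet_le measurable_const measurable_id.withTop_coe).inter (hm1 y)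
  have hi1 : ∀ k, IntervalIntegrable (fun u : ℝ => Sum.elim (fun _ => 0)
        (fun _ => if (u : WithTop ℝ) < S.initDone k then (1 : ℝ) else 0) (a k)) volume t s := by
    intro k
    rcases a k with l | e
    · exact intervalIntegrable_const
    · exact intervalIntegrable_ite (hm1 _) 1 t s
  have hi2 : ∀ k j, IntervalIntegrable (fun u : ℝ => if (S.reqOf k j).isSome then
          (if S.time j ≤ u ∧ (u : WithTop ℝ) < S.done j then (1 : ℝ) else 0) else 0)
          volume t s := by
    intro k j
    split_ifs
    · exact intervalIntegrable_ite (hm2 _ _) 1 t s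
    · exact intervalIntegrable_const
  have hi3 : ∀ k, IntervalIntegrable (fun u : ℝ => ∑ j ∈ hS.requests,
        if (S.reqOf k j).isSome then
          (if S.time j ≤ u ∧ (u : WithTop ℝ) < S.done j then (1 : ℝ) else 0) else 0)
          volume t s := by
    intro k
    convert! IntervalIntegrable.sum hS.requests fun j _ => hi2 k j using 1
    funext u
    rw [Finset.sum_apply]
  simp only [hS.numTrans_eq]
  rw [intervalIntegral.integral_finsetSum fun k _ => (hi1 k).add
    (hi3 k)]
  refine Finset.sum_congr rfl fun k _ => ?_
  rw [intervalIntegral.integral_add (hi1 k)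
    (hi3 k),
    intervalIntegral.integral_finsetSum fun j _ => hi2 k j]
  congr 1
  · rcases ha : a k with l | e
    · simp
    · simp only [Sum.elim_inr]
      have hk := progSet_le hr k
      rw [ha] at hk
      rw [h.initDone_eq k, ha]
      have e1 : ∀ u ∈ uIcc t s, (if ((u : ℝ) : WithTop ℝ)
          < ((t - r k + Model.genDelay (Sum.inr e : M.GenMode k) : ℝ) : WithTop ℝ)
            then (1 : ℝ) else 0)
          = if t ≤ u ∧ u < t - r k + Model.genDelay (Sum.inr e : M.GenMode k) then 1 else 0 := by
        intro u hu
        rw [uIcc_of_le hs] at hu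
        simp only [WithTop.coe_lt_coe, hu.1, true_and]
      rw [intervalIntegral.integral_congr e1, integral_indicator_Ico _ _ _ _ hs, max_self,
        max_eq_left]
      have : t ≤ min s (t - r k + genDelay (Sum.inr e : M.GenMode k)) :=
        le_min hs (by linarith [hk.2])
      linarith
  · refine Finset.sum_congr rfl fun j _ => ?_
    split_ifs with hj
    · obtain ⟨τ, hτ, h1, -⟩ := hS.exists_time hj
      rw [h.done_eq j, hτ, ← WithTop.coe_add]
      simp only [WithTop.coe_le_coe, WithTop.coe_lt_coe, WithTop.untopD_coe]
      rw [integral_indicator_Ico _ _ _ _ hs, max_eq_right h1]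
    · simp

open Classical in
theorem prog_eq (r : Fin nG → ℝ) (s : ℝ) (k : Fin nG) : S.prog t a r s k =
    (S.lastReq k s).elim (Sum.elim (fun _ => 0)
        (fun _ => if (s : WithTop ℝ) < S.initDone k then s - (t - r k) else 0) (a k))
      (fun p => if (s : WithTop ℝ) < S.done p.1 then s - (S.time p.1).untopD 0 else 0) := by
  unfold prog
  rcases S.lastReq k s with _ | ⟨j, e⟩
  · rcases a k <;> rfl
  · rfl

/-- The total transition progression is the sum of the progressions of the generators. -/
theorem Admissible.sum_prog (hM : M.Valid) (hS : S.Admissible t a) {r : Fin nG → ℝ}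
    (h : S.IsExact t a r) (hr : r ∈ M.progSet a) {s : ℝ} (hs : t ≤ s) :
    ∑ k, S.prog t a r s k = S.totProg t a (∑ k, r k) s := by
  classical
  have e1 : ∀ k, S.prog t a r s k = _ := fun k => (prog_eq r s k).trans <|
    hS.transition_split k s (s - (t - r k)) (fun j => s - (S.time j).untopD 0)
      hS.requests hS.reqOf_mem
  unfold totProg
  rw [hS.integral_numTrans h hr hs, hS.tsum_eq
    (fun j hj => by rw [reqDelay_of_none hj]; simp), sum_requests hS.requests _
    (fun j hj => by rw [reqDelay_of_none hj]; simp), ← Finset.sum_add_distrib,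
    ← Finset.sum_sub_distrib, ← Finset.sum_sub_distrib]
  refine Finset.sum_congr rfl fun k _ => ?_
  rw [e1 k]
  -- Accounting for one transition: progression equals the initial progression plus the time in
  -- transition since `t`, minus the full duration once completed. The two cancel on completion
  -- because `r k` plus the remaining time is the duration.
  have hinit : Sum.elim (fun _ => 0)
        (fun _ => if (s : WithTop ℝ) < S.initDone k then s - (t - r k) else 0) (a k)
      = r k + Sum.elim (fun _ => 0)
        (fun _ => min s (t - r k + Model.genDelay (a k)) - t) (a k)
        - if t ≤ S.initDone k ∧ S.initDone k ≤ s then genDelay (a k) else 0 := by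
    have hk := progSet_le hr k
    rcases ha : a k with l | e
    · rw [ha] at hk
      simp only [genDelay] at hk ⊢
      have : r k = 0 := le_antisymm hk.2 hk.1
      simp [this]
    · rw [ha] at hk
      have h1 := h.le_initDone hr k
      simp only [h1, true_and]
      rw [h.initDone_eq k, ha] at h1 ⊢
      simp only [WithTop.coe_le_coe, WithTop.coe_lt_coe, Sum.elim_inr] at h1 ⊢
      split_ifs with h2 h3 h3
      · linarith
      · rw [min_eq_left h2.le]
        ring
      · rw [min_eq_right h3]
        ring
      · linarith
  -- The same accounting for a requested transition, which starts from progression `0`; the cases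
  -- are in progress, completed, and not yet requested.
  have hreq : ∀ j, (if (S.reqOf k j).isSome then
        (if S.time j ≤ s ∧ (s : WithTop ℝ) < S.done j then s - (S.time j).untopD 0 else 0) else 0)
      = (if (S.reqOf k j).isSome then
          max (min s ((S.time j).untopD 0 + S.reqDelay j) - (S.time j).untopD 0) 0 else 0)
        - if (S.reqOf k j).isSome then
          (if t ≤ S.done j ∧ S.done j ≤ s then S.reqDelay j else 0) else 0 := by
    intro j
    by_cases hj : (S.reqOf k j).isSome
    · simp only [hj, if_true]
      obtain ⟨τ, hτ, h1, -⟩ := hS.exists_time hj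
      have hd := S.reqDelay_nonneg hM j
      have h4 : t ≤ τ + S.reqDelay j := by linarith
      rw [h.done_eq j, hτ, ← WithTop.coe_add]
      simp only [WithTop.coe_le_coe, WithTop.coe_lt_coe, WithTop.untopD_coe, h4, true_and]
      rcases le_or_gt τ s with h5 | h5
      · simp only [h5, true_and]
        split_ifs with h6 h7 h7
        · linarith
        · rw [min_eq_left h6.le, max_eq_left (by linarith)]
          ring
        · rw [min_eq_right h7, max_eq_left (by linarith)]
          ring
        · linarith
      · have h6 : ¬ τ ≤ s := not_le.2 h5
        have h7 : ¬ τ + S.reqDelay j ≤ s := by linarith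
        simp only [h6, h7, false_and, if_false]
        rw [min_eq_left (by linarith), max_eq_right (by linarith)]
        ring
    · simp [hj]
  rw [hinit, Finset.sum_congr rfl fun j _ => hreq j, Finset.sum_sub_distrib]
  ring

theorem Admissible.totProg_mem (hM : M.Valid) (hS : S.Admissible t a) {r : Fin nG → ℝ}
    (h : S.IsExact t a r) (hr : r ∈ M.progSet a) {s : ℝ} (hs : t ≤ s) :
    0 ≤ S.totProg t a (∑ k, r k) s ∧
      S.totProg t a (∑ k, r k) s ≤ M.totDelay (S.mode a s) := by
  rw [← hS.sum_prog hM h hr hs]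
  have hm := hS.prog_mem h hr hs
  exact ⟨Finset.sum_nonneg fun k _ => (progSet_le hm k).1,
    Finset.sum_le_sum fun k _ => (progSet_le hm k).2⟩

end Model.Schedule


/-! ### Bounded switching costs, and measurability of the pathwise constraints. -/

theorem frequently_rat_nhdsGT {s T : ℝ} (h : s < T) {p : ℝ → Prop}
    (hp : ∀ q : ℚ, s < q → (q : ℝ) < T → p q) : ∃ᶠ u in 𝓝[>] s, p u := by
  intro hn
  obtain ⟨v, hv, hsub⟩ := mem_nhdsGT_iff_exists_Ioo_subset.1 hn
  obtain ⟨q, h1, h2⟩ := exists_rat_btwn (lt_min hv h)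
  exact hsub ⟨h1, h2.trans_le (min_le_left _ _)⟩ (hp q h1 (h2.trans_le (min_le_right _ _)))

namespace Model.Schedule

variable {nG nL nc : ℕ} {M : Model nG nL nc} {S : M.Schedule} {t : ℝ} {a : M.Mode}

/-- The total switching cost is bounded, since all but the last transition of each generator are
completed in the planning period, and the total progression is nonnegative. -/
theorem Admissible.sum_reqCost_le (hM : M.Valid) (hS : S.Admissible t a)
    (hd : ∀ j, S.time j ≤ S.done j) (ht : t ≤ M.T) {w : ℝ} (h0 : 0 ≤ S.totProg t a w M.T)
    {κ K : ℝ} (hκ0 : 0 ≤ κ) (hK0 : 0 ≤ K)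
    (hκ : ∀ b : M.Request, M.swCost b.1 b.2 ≤ κ * M.delay b.1 b.2)
    (hK : ∀ b : M.Request, M.swCost b.1 b.2 ≤ K) :
    ∑ j ∈ hS.requests, S.reqCost j ≤ κ * (w + nG * (M.T - t)) + nG * K := by
  classical
  have hκ' : ∀ j, S.reqCost j ≤ κ * S.reqDelay j := by
    intro j
    unfold reqCost reqDelay
    cases S.req j with
    | none => simp
    | some b => exact hκ b
  have hK' : ∀ j, S.reqCost j ≤ K := by
    intro j
    unfold reqCost
    cases S.req j with
    | none => simpa using hK0
    | some b => exact hK b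
  have htime : ∀ j ∈ hS.requests, (t : WithTop ℝ) ≤ S.time j ∧ S.time j ≤ M.T := by
    intro j hj
    rcases hS.time_mem j with h | h
    · exact absurd ((hS.time_top j).1 h) (hS.mem_requests.1 hj)
    · exact h
  set D : ℝ := ∑ j ∈ hS.requests, if (t : WithTop ℝ) ≤ S.done j ∧ S.done j ≤ M.T
    then S.reqDelay j else 0 with hD
  -- Progression accrues at rate at most `nG`, and each completion subtracts a duration;
  -- nonnegativity at the final time bounds what has been subtracted.
  have hDle : D ≤ w + nG * (M.T - t) := by
    unfold totProg at h0
    rw [hS.tsum_eq (fun j hj => by rw [reqDelay_of_none hj]; simp)] at h0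
    have h1 : ∫ u in t..M.T, M.numTrans (S.mode a u) ≤ nG * (M.T - t) := by
      calc ∫ u in t..M.T, M.numTrans (S.mode a u) ≤ ∫ _u in t..M.T, (nG : ℝ) :=
            intervalIntegral.integral_mono_on ht (hS.intervalIntegrable_numTrans _ _)
              intervalIntegrable_const fun u _ => numTrans_le _
        _ = nG * (M.T - t) := by
            rw [intervalIntegral.integral_const, smul_eq_mul, mul_comm]
    have h2 : 0 ≤ ∑ k, if (t : WithTop ℝ) ≤ S.initDone k ∧ S.initDone k ≤ M.T
        then genDelay (a k) else 0 := by
      refine Finset.sum_nonneg fun k _ => ?_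
      split_ifs
      · rcases a k with l | e
        · exact le_rfl
        · exact (hM.delay_pos k e).le
      · exact le_rfl
    simp only [hD]
    linarith
  -- A completed transition is charged to its duration at rate `κ`; an uncompleted one costs at most
  -- `K`.
  have hsplit : ∀ j ∈ hS.requests, S.reqCost j
      ≤ κ * (if (t : WithTop ℝ) ≤ S.done j ∧ S.done j ≤ M.T then S.reqDelay j else 0)
        + if S.done j ≤ M.T then 0 else K := by
    intro j hj
    by_cases h : S.done j ≤ M.T
    · have h1 : (t : WithTop ℝ) ≤ S.done j := (htime j hj).1.trans (hd j)
      simp only [h, h1, and_self, if_true, add_zero]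
      exact hκ' j
    · simp only [h, and_false, if_false, mul_zero, zero_add]
      exact hK' j
  have hcard : ((hS.requests.filter fun j => ¬ S.done j ≤ M.T).card : ℝ) ≤ nG := by
    rcases isEmpty_or_nonempty (Fin nG) with hemp | hnonempty
    · have h1 : hS.requests = ∅ := by
        refine Finset.eq_empty_of_forall_notMem fun j hj => ?_
        obtain ⟨b, -⟩ := Option.ne_none_iff_exists'.1 (hS.mem_requests.1 hj)
        exact hemp.elim b.1
      simp [h1]
    have hne : ∀ j ∈ hS.requests, ∃ k, (S.reqOf k j).isSome := by
      intro j hj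
      obtain ⟨b, hb⟩ := Option.ne_none_iff_exists'.1 (hS.mem_requests.1 hj)
      exact ⟨b.1, (isSome_reqOf_iff hb _).2 rfl⟩
    choose! f hf using hne
    have h1 : (hS.requests.filter fun j => ¬ S.done j ≤ M.T).card
        ≤ (Finset.univ : Finset (Fin nG)).card := by
      refine Finset.card_le_card_of_injOn f (fun _ _ => Finset.mem_univ _) ?_
      have key : ∀ i ∈ hS.requests, ∀ j ∈ hS.requests, ¬ S.done i ≤ M.T → f i = f j → ¬ i < j := by
        intro i hi j hj hdi hij hlt
        have h2 := hf j hj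
        rw [← hij] at h2
        exact hdi ((hS.done_lt_time (hf i hi) h2 hlt).le.trans (htime j hj).2)
      intro i hi j hj hij
      simp only [Finset.coe_filter, mem_ofPred_eq] at hi hj
      rcases lt_trichotomy i j with h | h | h
      · exact absurd h (key i hi.1 j hj.1 hi.2 hij)
      · exact h
      · exact absurd h (key j hj.1 i hi.1 hj.2 hij.symm)
    rw [Finset.card_univ, Fintype.card_fin] at h1
    exact_mod_cast h1
  calc ∑ j ∈ hS.requests, S.reqCost j ≤ _ := Finset.sum_le_sum hsplit
    _ = κ * D + (hS.requests.filter fun j => ¬ S.done j ≤ M.T).card * K := by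
        rw [Finset.sum_add_distrib, ← Finset.mul_sum, ← hD]
        congr 1
        rw [← nsmul_eq_mul, ← Finset.sum_const, Finset.sum_filter]
        exact Finset.sum_congr rfl fun j _ => by split_ifs <;> rfl
    _ ≤ κ * (w + nG * (M.T - t)) + nG * K := by gcongr

/-- The integral is continuous, and a completion already counts at the instant it happens, so the
finitely many jumps are right-continuous. -/
theorem Admissible.tendsto_totProg (hS : S.Admissible t a) (w s : ℝ) :
    Tendsto (S.totProg t a w) (𝓝[>] s) (𝓝 (S.totProg t a w s)) := by
  classical
  have h1 : Continuous fun u => ∫ v in t..u, M.numTrans (S.mode a v) :=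
    intervalIntegral.continuous_primitive (fun _ _ => hS.intervalIntegrable_numTrans _ _) t
  have h2 : Tendsto (fun u => w + (∫ v in t..u, M.numTrans (S.mode a v))
      - (∑ k, if t ≤ S.initDone k ∧ S.initDone k ≤ s then genDelay (a k) else 0)
      - ∑' j, if t ≤ S.done j ∧ S.done j ≤ s then S.reqDelay j else 0) (𝓝[>] s)
      (𝓝 (S.totProg t a w s)) := by
    refine Tendsto.mono_left ?_ nhdsWithin_le_nhds
    exact ((h1.const_add w).sub continuous_const |>.sub continuous_const).tendsto s
  refine h2.congr' ?_
  have h3 : ∀ᶠ u : ℝ in 𝓝[>] s, ∀ k, (S.initDone k ≤ u ↔ S.initDone k ≤ s) :=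
    eventually_all.2 fun k => eventually_le_iff _ s
  have h4 : ∀ᶠ u : ℝ in 𝓝[>] s, ∀ j ∈ hS.requests, (S.done j ≤ (u : ℝ) ↔ S.done j ≤ s) :=
    (Finset.eventually_all _).2 fun j _ => eventually_le_iff _ s
  filter_upwards [h3, h4] with u hu1 hu2
  unfold totProg
  rw [hS.tsum_eq (fun j hj => by rw [reqDelay_of_none hj]; simp),
    hS.tsum_eq (fun j hj => by rw [reqDelay_of_none hj]; simp)]
  congr 1
  · congr 1
    exact Finset.sum_congr rfl fun k _ => by simp only [hu1 k]
  · exact Finset.sum_congr rfl fun j hj => by simp only [hu2 j hj]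

/-- The pathwise conditions on the schedules of the lower bound problem. -/
structure Feasible (S : M.Schedule) (t : ℝ) (a : M.Mode) (w : ℝ) : Prop where
  adm : S.Admissible t a
  le_initDone : ∀ k, t ≤ S.initDone k
  time_le_done : ∀ j, S.time j ≤ S.done j
  totProg_mem : ∀ s ∈ Icc t M.T, 0 ≤ S.totProg t a w s ∧
    S.totProg t a w s ≤ M.totDelay (S.mode a s)

/-- Right-continuity of progression and mode reduces the constraint to countably many times, which
makes it a measurable condition. The endpoint `M.T` is listed separately because no time of the
period lies to its right. -/
theorem Admissible.forall_totProg_iff (hS : S.Admissible t a) (ht : t ≤ M.T) (w : ℝ) :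
    (∀ s ∈ Icc t M.T, 0 ≤ S.totProg t a w s ∧ S.totProg t a w s ≤ M.totDelay (S.mode a s)) ↔
    (0 ≤ S.totProg t a w M.T ∧ S.totProg t a w M.T ≤ M.totDelay (S.mode a M.T)) ∧
    ∀ q : ℚ, t ≤ q → (q : ℝ) ≤ M.T →
      0 ≤ S.totProg t a w q ∧ S.totProg t a w q ≤ M.totDelay (S.mode a q) := by
  refine ⟨fun h => ⟨h _ ⟨ht, le_rfl⟩, fun q h1 h2 => h q ⟨h1, h2⟩⟩, fun ⟨hT, hq⟩ s hs => ?_⟩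
  rcases hs.2.eq_or_lt with rfl | hlt
  · exact hT
  have hfr := frequently_rat_nhdsGT hlt (p := fun u => 0 ≤ S.totProg t a w u ∧
    S.totProg t a w u ≤ M.totDelay (S.mode a u))
    fun q h1 h2 => hq q (hs.1.trans h1.le) h2.le
  have hlim := hS.tendsto_totProg w s
  refine ⟨ge_of_tendsto_of_frequently hlim (hfr.mono fun u hu => hu.1),
    le_of_tendsto_of_frequently hlim ?_⟩
  refine (hfr.and_eventually (eventually_mode_eq hS.finite a s)).mono fun u hu => ?_
  rw [← hu.2]
  exact hu.1.2

/-- A countable form of the condition on the mode just before a request: by right-continuity, the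
values at rationals in an open interval determine the mode on that interval. -/
theorem eventually_mode_eq_left_iff (hfin : {j | S.time j ≠ ⊤}.Finite) (a : M.Mode) (k : Fin nG)
    (c : M.GenMode k) (τ : ℝ) :
    (∀ᶠ u in 𝓝[<] τ, S.mode a u k = c) ↔
    ∃ n : ℕ, ∀ q : ℚ, τ - 1 / (n + 1) < q → (q : ℝ) < τ → S.mode a q k = c := by
  constructor
  · intro h
    obtain ⟨l, hl, hsub⟩ := mem_nhdsLT_iff_exists_Ioo_subset.1 h
    obtain ⟨n, hn⟩ := exists_nat_one_div_lt (sub_pos.2 (mem_Iio.1 hl))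
    exact ⟨n, fun q h1 h2 => hsub ⟨by linarith, h2⟩⟩
  · rintro ⟨n, hn⟩
    have hlt : τ - 1 / ((n : ℝ) + 1) < τ := by
      have : 0 < 1 / ((n : ℝ) + 1) := by positivity
      linarith
    filter_upwards [Ioo_mem_nhdsLT hlt] with u hu
    have hfr := frequently_rat_nhdsGT hu.2 (p := fun u => S.mode a u k = c)
      fun q h1 h2 => hn q (hu.1.trans h1) h2
    obtain ⟨v, hv1, hv2⟩ := (hfr.and_eventually (eventually_mode_eq hfin a u)).exists
    rw [← hv2, hv1]

end Model.Schedule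

variable {nG nL nc : ℕ} {M : Model nG nL nc} {X : Type*} [MeasurableSpace X] {S : X → M.Schedule}

theorem MeasurableSchedule.measurableSet_finite (hS : MeasurableSchedule S) :
    MeasurableSet {x | {j | (S x).time j ≠ ⊤}.Finite} := by
  have e : {x | {j | (S x).time j ≠ ⊤}.Finite} = ⋃ n : ℕ, ⋂ j : {j // n ≤ j},
      {x | (S x).time j = ⊤} := by
    ext x
    simp only [mem_ofPred_eq, mem_iUnion, mem_iInter, Subtype.forall]
    constructor
    · intro h
      obtain ⟨n, hn⟩ := h.bddAbove
      refine ⟨n + 1, fun j hj => ?_⟩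
      by_contra hj'
      exact absurd (hn hj') (by omega)
    · rintro ⟨n, hn⟩
      refine (finite_Iio n).subset fun j hj => ?_
      by_contra hj'
      exact hj (hn j (not_lt.1 hj'))
  rw [e]
  exact MeasurableSet.iUnion fun n => MeasurableSet.iInter fun j =>
    hS.time j (measurableSet_singleton ⊤)

theorem MeasurableSchedule.measurableSet_admissible (hS : MeasurableSchedule S)
    (hfin : ∀ x, {j | (S x).time j ≠ ⊤}.Finite) (t : ℝ) (a : M.Mode) :
    MeasurableSet {x | (S x).Admissible t a} := by
  have e : {x | (S x).Admissible t a}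
      = {x | ∀ j, (S x).time j = ⊤ ∨ (t ≤ (S x).time j ∧ (S x).time j ≤ M.T)}
      ∩ {x | ∀ i j, i ≤ j → (S x).time i ≤ (S x).time j}
      ∩ {x | ∀ j, (S x).time j = ⊤ ↔ (S x).req j = none}
      ∩ {x | ∀ k i j, i < j → ((S x).reqOf k i).isSome → ((S x).reqOf k j).isSome →
          (S x).time i < (S x).time j}
      ∩ {x | ∀ j k e, (S x).req j = some ⟨k, e⟩ → ∃ n : ℕ, ∀ q : ℚ,
          ((S x).time j).untopD 0 - 1 / (n + 1) < q → (q : ℝ) < ((S x).time j).untopD 0 →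
          (S x).mode a q k = Sum.inl e.1.1} := by
    ext x
    simp only [mem_inter_iff, mem_ofPred_eq]
    constructor
    · intro h
      refine ⟨⟨⟨⟨h.time_mem, fun i j hij => h.time_mono hij⟩, h.time_top⟩, h.time_strict⟩, ?_⟩
      intro j k e hj
      exact (Model.Schedule.eventually_mode_eq_left_iff (hfin x) a k _ _).1
        (h.mode_before j k e hj)
    · rintro ⟨⟨⟨⟨h1, h2⟩, h3⟩, h4⟩, h5⟩
      exact ⟨h1, fun i j hij => h2 i j hij, h3, hfin x, h4, fun j k e hj =>
        (Model.Schedule.eventually_mode_eq_left_iff (hfin x) a k _ _).2 (h5 j k e hj)⟩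
  rw [e]
  have htop : ∀ j, MeasurableSet {x | (S x).time j = ⊤} := fun j =>
    hS.time j (measurableSet_singleton ⊤)
  have himp : ∀ {A B : Set X}, MeasurableSet A → MeasurableSet B →
      MeasurableSet {x | x ∈ A → x ∈ B} := by
    intro A B hA hB
    convert! hA.compl.union hB using 1
    ext x
    simp [imp_iff_not_or]
  refine ((((?_ : MeasurableSet _).inter ?_).inter ?_).inter ?_).inter ?_
  · simp only [ofPred_forall]
    exact MeasurableSet.iInter fun j => (htop j).union
      ((measurableSet_le measurable_const (hS.time j)).inter
        (measurableSet_le (hS.time j) measurable_const))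
  · simp only [ofPred_forall]
    exact MeasurableSet.iInter fun i => MeasurableSet.iInter fun j => MeasurableSet.iInter fun _ =>
      measurableSet_le (hS.time i) (hS.time j)
  · simp only [ofPred_forall]
    refine MeasurableSet.iInter fun j => ?_
    simp only [iff_def]
    exact (himp (htop j) (hS.req_eq j none)).inter (himp (hS.req_eq j none) (htop j))
  · simp only [ofPred_forall]
    exact MeasurableSet.iInter fun k => MeasurableSet.iInter fun i => MeasurableSet.iInter fun j =>
      MeasurableSet.iInter fun _ => himp (hS.isSome_reqOf k i) (himp (hS.isSome_reqOf k j)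
        (measurableSet_lt (hS.time i) (hS.time j)))
  · simp only [ofPred_forall]
    refine MeasurableSet.iInter fun j => MeasurableSet.iInter fun k => MeasurableSet.iInter fun e =>
      himp (hS.req j _) (B := {x | ∃ n : ℕ, ∀ q : ℚ,
          ((S x).time j).untopD 0 - 1 / (n + 1) < q → (q : ℝ) < ((S x).time j).untopD 0 →
          (S x).mode a q k = Sum.inl e.1.1}) ?_
    simp only [ofPred_exists]
    refine MeasurableSet.iUnion fun n => ?_
    simp only [ofPred_forall]
    refine MeasurableSet.iInter fun q => ?_
    have hτ : Measurable fun x => ((S x).time j).untopD 0 := (hS.time j).untopD 0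
    refine himp (measurableSet_lt (hτ.sub measurable_const) measurable_const)
      (himp (measurableSet_lt measurable_const hτ) (B := {x | (S x).mode a q k = Sum.inl e.1.1}) ?_)
    exact (measurable_id.prodMk measurable_const)
      (hS.mode_apply_eq hfin a k (Sum.inl e.1.1))

theorem MeasurableSchedule.measurableSet_feasible (hM : M.Valid) (hS : MeasurableSchedule S)
    (hfin : ∀ x, {j | (S x).time j ≠ ⊤}.Finite) {t : ℝ} (ht : t ≤ M.T) (a : M.Mode) (w : ℝ) :
    MeasurableSet {x | (S x).Feasible t a w} := by
  have e : {x | (S x).Feasible t a w} = {x | (S x).Admissible t a}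
      ∩ (⋂ k, {x | (t : WithTop ℝ) ≤ (S x).initDone k})
      ∩ (⋂ j, {x | (S x).time j ≤ (S x).done j})
      ∩ ({x | 0 ≤ (S x).totProg t a w M.T ∧
            (S x).totProg t a w M.T ≤ M.totDelay ((S x).mode a M.T)}
        ∩ ⋂ q : {q : ℚ // t ≤ q ∧ (q : ℝ) ≤ M.T}, {x | 0 ≤ (S x).totProg t a w (q : ℚ) ∧
            (S x).totProg t a w (q : ℚ) ≤ M.totDelay ((S x).mode a (q : ℚ))}) := by
    ext x
    simp only [mem_inter_iff, mem_iInter, mem_ofPred_eq, Subtype.forall, and_imp]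
    constructor
    · rintro ⟨h1, h2, h3, h4⟩
      exact ⟨⟨⟨h1, h2⟩, h3⟩, (h1.forall_totProg_iff ht w).1 h4⟩
    · rintro ⟨⟨⟨h1, h2⟩, h3⟩, h4⟩
      exact ⟨h1, h2, h3, (h1.forall_totProg_iff ht w).2 h4⟩
  have hpt : ∀ s : ℝ, MeasurableSet {x | 0 ≤ (S x).totProg t a w s ∧
      (S x).totProg t a w s ≤ M.totDelay ((S x).mode a s)} := by
    intro s
    have hφ : Measurable fun x : X => (x, s) := measurable_id.prodMk measurable_const
    have h1 := (hS.totProg hfin hM t a w).comp hφ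
    simp only [Function.comp_def] at h1
    have h0 : Measurable fun p : X × ℝ => M.totDelay ((S p.1).mode a p.2) :=
      hS.mode_comp hfin a (g := fun α _ => M.totDelay α) fun _ => measurable_const
    have h2 := h0.comp hφ
    simp only [Function.comp_def] at h2
    exact (measurableSet_le measurable_const h1).inter (measurableSet_le h1 h2)
  rw [e]
  exact (((hS.measurableSet_admissible hfin t a).inter
    (MeasurableSet.iInter fun k => measurableSet_le measurable_const (hS.initDone k))).inter
    (MeasurableSet.iInter fun j => measurableSet_le (hS.time j) (hS.done j))).inter
    ((hpt _).inter (MeasurableSet.iInter fun q => hpt _))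


/-! ### Infima and suprema depending on a parameter -/

theorem abs_sInf_sub_sInf_le {α : Type*} {R : Set α} {f g : α → ℝ} {ε : ℝ} (hε : 0 ≤ ε)
    (hf : BddBelow (f '' R)) (hg : BddBelow (g '' R)) (h : ∀ r ∈ R, |f r - g r| ≤ ε) :
    |sInf (f '' R) - sInf (g '' R)| ≤ ε := by
  rcases R.eq_empty_or_nonempty with rfl | hR
  · simpa using hε
  have key : ∀ {f g : α → ℝ}, BddBelow (f '' R) → (∀ r ∈ R, |f r - g r| ≤ ε) →
      sInf (f '' R) - sInf (g '' R) ≤ ε := by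
    intro f g hf h
    have : sInf (f '' R) - ε ≤ sInf (g '' R) := by
      refine le_csInf (hR.image g) ?_
      rintro _ ⟨r, hr, rfl⟩
      have h1 := csInf_le hf (mem_image_of_mem f hr)
      have h2 := (abs_le.1 (h r hr)).2
      linarith
    linarith
  refine abs_le.2 ⟨?_, key hf h⟩
  have := key hg fun r hr => by rw [abs_sub_comm]; exact h r hr
  linarith

theorem abs_sSup_sub_sSup_le {α : Type*} {R : Set α} {f g : α → ℝ} {ε : ℝ} (hε : 0 ≤ ε)
    (hf : BddAbove (f '' R)) (hg : BddAbove (g '' R)) (h : ∀ r ∈ R, |f r - g r| ≤ ε) :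
    |sSup (f '' R) - sSup (g '' R)| ≤ ε := by
  rcases R.eq_empty_or_nonempty with rfl | hR
  · simpa using hε
  have key : ∀ {f g : α → ℝ}, BddAbove (g '' R) → (∀ r ∈ R, |f r - g r| ≤ ε) →
      sSup (f '' R) - sSup (g '' R) ≤ ε := by
    intro f g hg h
    have : sSup (f '' R) ≤ sSup (g '' R) + ε := by
      refine csSup_le (hR.image f) ?_
      rintro _ ⟨r, hr, rfl⟩
      have h1 := le_csSup hg (mem_image_of_mem g hr)
      have h2 := (abs_le.1 (h r hr)).2
      linarith
    linarith
  refine abs_le.2 ⟨?_, key hg h⟩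
  have := key hf fun r hr => by rw [abs_sub_comm]; exact h r hr
  linarith

theorem abs_ciSup_sub_ciSup_le {ι : Type*} [Finite ι] [Nonempty ι] {f g : ι → ℝ} {ε : ℝ}
    (h : ∀ i, |f i - g i| ≤ ε) : |(⨆ i, f i) - ⨆ i, g i| ≤ ε := by
  have key : ∀ {f g : ι → ℝ}, (∀ i, |f i - g i| ≤ ε) → (⨆ i, f i) - ⨆ i, g i ≤ ε := by
    intro f g h
    have : ⨆ i, f i ≤ (⨆ i, g i) + ε := ciSup_le fun i => by
      have h1 := le_ciSup (finite_range g).bddAbove i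
      have h2 := (abs_le.1 (h i)).2
      linarith
    linarith
  refine abs_le.2 ⟨?_, key h⟩
  have := key fun i => by rw [abs_sub_comm]; exact h i
  linarith

theorem isSigmaCompact_measurableSet {X : Type*} [TopologicalSpace X] [T2Space X]
    [MeasurableSpace X] [OpensMeasurableSpace X] {A : Set X} (hA : IsSigmaCompact A) :
    MeasurableSet A := by
  obtain ⟨K, hK, rfl⟩ := hA
  exact MeasurableSet.iUnion fun n => (hK n).measurableSet

/-- An infimum over the fibers of a set is measurable if the sublevel sets are σ-compact. -/
theorem measurable_sInf_fiber {X R : Type*} [TopologicalSpace X] [T2Space X]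
    [MeasurableSpace X] [OpensMeasurableSpace X] [TopologicalSpace R] {A : Set (X × R)}
    {φ : X × R → ℝ} (hA : ∀ c, IsSigmaCompact {p | p ∈ A ∧ φ p ≤ c})
    (hb : ∀ x, BddBelow ((fun r => φ (x, r)) '' {r | (x, r) ∈ A})) :
    Measurable fun x => sInf ((fun r => φ (x, r)) '' {r | (x, r) ∈ A}) := by
  have hproj : ∀ c, MeasurableSet {x | ∃ r, (x, r) ∈ A ∧ φ (x, r) ≤ c} := by
    intro c
    convert! isSigmaCompact_measurableSet ((hA c).image continuous_fst) using 1
    ext x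
    simp only [mem_ofPred_eq, mem_image, Prod.exists, exists_and_right, exists_eq_right]
  have hne : MeasurableSet {x | ∃ r, (x, r) ∈ A} := by
    convert! MeasurableSet.iUnion fun n : ℕ => hproj n using 1
    ext x
    simp only [mem_ofPred_eq, mem_iUnion]
    constructor
    · rintro ⟨r, hr⟩
      obtain ⟨n, hn⟩ := exists_nat_ge (φ (x, r))
      exact ⟨n, r, hr, hn⟩
    · rintro ⟨n, r, hr, -⟩
      exact ⟨r, hr⟩
  refine measurable_of_Iio fun c => ?_
  -- Only closed sublevel conditions project to σ-compact sets, hence the margins `1 / (n + 1)`. The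
  -- last set accounts for empty fibers, where the infimum is `0`.
  have e : (fun x => sInf ((fun r => φ (x, r)) '' {r | (x, r) ∈ A})) ⁻¹' Iio c
      = (⋃ n : ℕ, {x | ∃ r, (x, r) ∈ A ∧ φ (x, r) ≤ c - 1 / (n + 1)})
        ∪ ({x | ∃ r, (x, r) ∈ A}ᶜ ∩ {_x | 0 < c}) := by
    ext x
    simp only [mem_preimage, mem_Iio, mem_union, mem_iUnion, mem_ofPred_eq, mem_inter_iff,
      mem_compl_iff]
    by_cases hx : ∃ r, (x, r) ∈ A
    · have hx' : ((fun r => φ (x, r)) '' {r | (x, r) ∈ A}).Nonempty := Set.Nonempty.image _ hx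
      rw [csInf_lt_iff (hb x) hx']
      constructor
      · rintro ⟨_, ⟨r, hr, rfl⟩, hlt⟩
        obtain ⟨n, hn⟩ := exists_nat_one_div_lt (sub_pos.2 hlt)
        exact Or.inl ⟨n, r, hr, by linarith⟩
      · rintro (⟨n, r, hr, hle⟩ | h)
        · refine ⟨_, ⟨r, hr, rfl⟩, hle.trans_lt ?_⟩
          have : 0 < 1 / ((n : ℝ) + 1) := by positivity
          linarith
        · exact absurd hx h.1
    · have hemp : {r | (x, r) ∈ A} = ∅ := by
        ext r
        simpa using fun h => hx ⟨r, h⟩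
      rw [hemp, image_empty, Real.sInf_empty]
      constructor
      · exact fun h => Or.inr ⟨hx, h⟩
      · rintro (⟨n, r, hr, -⟩ | h)
        · exact absurd ⟨r, hr⟩ hx
        · exact h.2
  rw [e]
  exact (MeasurableSet.iUnion fun n => hproj _).union (hne.compl.inter (.const _))

/-! ### Production -/

variable {nG nL nc : ℕ} {M : Model nG nL nc}

theorem Model.Valid.setpt_mem (hM : M.Valid) (k : Fin nG) (l : Fin (M.lvl k + 1)) :
    M.setpt k 0 ≤ M.setpt k l ∧ M.setpt k l ≤ M.setpt k (Fin.last (M.lvl k)) :=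
  ⟨(hM.setpt_mono k).monotone (Fin.zero_le l), (hM.setpt_mono k).monotone (Fin.le_last l)⟩

theorem Model.Valid.prod_mem (hM : M.Valid) {a : M.Mode} {r : Fin nG → ℝ}
    (hr : r ∈ M.progSet a) : M.prod a r ∈ M.prodBox := by
  intro k
  have hk := hr k
  rcases ha : a k with l | e
  · simp only [Model.prod, ha]
    exact hM.setpt_mem k l
  · simp only [Model.prod, ha]
    rw [ha] at hk
    have hd := hM.delay_pos k e
    have h0 : (0 : ℝ) ∈ Icc 0 (M.delay k e) := ⟨le_rfl, hd.le⟩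
    have h1 : M.delay k e ∈ Icc 0 (M.delay k e) := ⟨hd.le, le_rfl⟩
    have hr' : r k ∈ Icc 0 (M.delay k e) := ⟨hk.1, hk.2.le⟩
    have hs := hM.setpt_mem k e.1.1
    have ht := hM.setpt_mem k e.1.2
    rcases hM.ramp_mono k e with hm | hm
    · have h2 := hm h0 hr' hk.1
      have h3 := hm hr' h1 hk.2.le
      rw [hM.ramp_start] at h2
      rw [hM.ramp_end] at h3
      exact ⟨hs.1.trans h2, h3.trans ht.2⟩
    · have h2 := hm h0 hr' hk.1
      have h3 := hm hr' h1 hk.2.le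
      rw [hM.ramp_start] at h2
      rw [hM.ramp_end] at h3
      exact ⟨ht.1.trans h3, h2.trans hs.2⟩

theorem Model.Valid.continuousOn_prod (hM : M.Valid) (a : M.Mode) :
    ContinuousOn (M.prod a) (M.progSet a) := by
  rw [continuousOn_pi]
  intro k
  rcases ha : a k with l | e
  · simp only [Model.prod, ha]
    exact continuousOn_const
  · simp only [Model.prod, ha]
    obtain ⟨C, hC, h⟩ := hM.ramp_rate
    have hc : ContinuousOn (M.ramp k e) (Icc 0 (M.delay k e)) := by
      refine LipschitzOnWith.continuousOn (K := C.toNNReal) (LipschitzOnWith.of_dist_le_mul ?_)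
      intro s hs s' hs'
      rw [Real.dist_eq, Real.dist_eq, Real.coe_toNNReal _ hC.le]
      exact h k e s hs s' hs'
    refine hc.comp (continuous_apply k).continuousOn fun r hr => ?_
    have hk := hr k
    rw [ha] at hk
    exact ⟨hk.1, hk.2.le⟩

theorem Model.isCompact_prodBox : IsCompact M.prodBox := by
  have e : M.prodBox = Set.pi univ fun k =>
      Icc (M.setpt k 0) (M.setpt k (Fin.last (M.lvl k))) := by
    ext p
    simp only [Model.prodBox, mem_ofPred_eq, mem_univ_pi, mem_Icc]
  rw [e]
  exact isCompact_univ_pi fun k => isCompact_Icc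

theorem exists_bound_of_isCompact {X : Type*} [TopologicalSpace X] {K : Set X} (hK : IsCompact K)
    {f : X → ℝ} (hf : ContinuousOn f K) : ∃ C, 0 ≤ C ∧ ∀ x ∈ K, |f x| ≤ C := by
  obtain ⟨C, hC⟩ := hK.exists_bound_of_continuousOn hf
  exact ⟨max C 0, le_max_right _ _, fun x hx => (hC x hx).trans (le_max_left _ _)⟩

/-- Because of its half-open intervals `progSet` need not be closed, but it is the intersection of
an open set with a closed box and hence a countable union of closed sets. -/
theorem isSigmaCompact_progSet_inter {Y : Type*} [TopologicalSpace Y] [SigmaCompactSpace Y]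
    (a : M.Mode) {F : Set (Y × (Fin nG → ℝ))}
    (hF : ∀ K : Set (Fin nG → ℝ), IsClosed K → K ⊆ M.progSet a →
      IsClosed {p : Y × (Fin nG → ℝ) | p.2 ∈ K ∧ p ∈ F}) :
    IsSigmaCompact {p : Y × (Fin nG → ℝ) | p.2 ∈ M.progSet a ∧ p ∈ F} := by
  have hO : IsOpen {r : Fin nG → ℝ | ∀ k, ∀ e, a k = Sum.inr e → r k < M.delay k e} := by
    simp only [ofPred_forall]
    exact isOpen_iInter_of_finite fun k => isOpen_iInter_of_finite fun e =>
      isOpen_iInter_of_finite fun _ => isOpen_lt (continuous_apply k) continuous_const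
  obtain ⟨K, hK, -, hU, -⟩ := hO.exists_iUnion_isClosed
  have hB : IsClosed {r : Fin nG → ℝ | ∀ k, 0 ≤ r k ∧ r k ≤ Model.genDelay (a k)} := by
    simp only [ofPred_forall]
    exact isClosed_iInter fun k => (isClosed_le continuous_const (continuous_apply k)).inter
      (isClosed_le (continuous_apply k) continuous_const)
  have e0 : M.progSet a = ⋃ n, (K n ∩ {r | ∀ k, 0 ≤ r k ∧ r k ≤ Model.genDelay (a k)}) := by
    rw [← iUnion_inter, hU]
    ext r
    simp only [mem_inter_iff, mem_ofPred_eq]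
    constructor
    · intro hr
      refine ⟨fun k e he => ?_, Model.Schedule.progSet_le hr⟩
      have := hr k
      rw [he] at this
      exact this.2
    · rintro ⟨h1, h2⟩ k
      have h3 := h2 k
      rcases ha : a k with l | e
      · rw [ha] at h3
        exact le_antisymm h3.2 h3.1
      · exact ⟨h3.1, h1 k e ha⟩
  have e1 : {p : Y × (Fin nG → ℝ) | p.2 ∈ M.progSet a ∧ p ∈ F}
      = ⋃ n, {p : Y × (Fin nG → ℝ) |
        p.2 ∈ K n ∩ {r | ∀ k, 0 ≤ r k ∧ r k ≤ Model.genDelay (a k)} ∧ p ∈ F} := by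
    ext p
    rw [mem_ofPred_eq, e0]
    simp
  rw [e1]
  refine isSigmaCompact_iUnion _ fun n => isSigmaCompact_univ.of_isClosed_subset (hF _ ((hK n).inter hB) ?_) (subset_univ _)
  rw [e0]
  exact subset_iUnion (fun n => K n ∩ {r | ∀ k, 0 ≤ r k ∧ r k ≤ Model.genDelay (a k)}) n

theorem measurableSet_progSet (a : M.Mode) : MeasurableSet (M.progSet a) := by
  have e : M.progSet a = Set.pi univ fun k => match a k with
    | Sum.inl _ => {0}
    | Sum.inr e => Ico 0 (M.delay k e) := by
    ext r
    simp only [Model.progSet, mem_ofPred_eq, mem_univ_pi]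
    refine forall_congr' fun k => ?_
    rcases a k with l | e
    · simp
    · simp
  rw [e]
  refine MeasurableSet.univ_pi fun k => ?_
  rcases a k with l | e
  · exact measurableSet_singleton 0
  · exact measurableSet_Ico

/-! ### Costs of the original problem -/

theorem dotProduct_nonneg_of_nonneg' {n : ℕ} {c z : Fin n → ℝ} (hc : ∀ k, 0 < c k) (hz : 0 ≤ z) :
    0 ≤ c ⬝ᵥ z :=
  Finset.sum_nonneg fun k _ => mul_nonneg (hc k).le (hz k)

theorem Model.Valid.shedCost_eq (M : Model nG nL nc) (i : Fin (nc + 1)) (p : Fin nG → ℝ)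
    (d : Fin nL → ℝ) :
    M.shedCost i p d = sInf ((fun z => M.c ⬝ᵥ z) '' {z | 0 ≤ z ∧ (p, d - z) ∈ M.feas i}) := by
  unfold Model.shedCost
  congr 1
  ext v
  simp only [mem_ofPred_eq, mem_image, and_assoc, eq_comm]

theorem Model.Valid.bddBelow_shedCost (hM : M.Valid) (i : Fin (nc + 1)) (p : Fin nG → ℝ)
    (d : Fin nL → ℝ) :
    BddBelow ((fun z => M.c ⬝ᵥ z) '' {z | 0 ≤ z ∧ (p, d - z) ∈ M.feas i}) := by
  refine ⟨0, ?_⟩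
  rintro _ ⟨z, hz, rfl⟩
  exact dotProduct_nonneg_of_nonneg' hM.c_pos hz.1

theorem Model.Valid.measurable_shedCost (hM : M.Valid) (i : Fin (nc + 1)) :
    Measurable fun p : (Fin nG → ℝ) × (Fin nL → ℝ) => M.shedCost i p.1 p.2 := by
  simp only [Model.Valid.shedCost_eq]
  refine measurable_sInf_fiber (X := (Fin nG → ℝ) × (Fin nL → ℝ)) (R := Fin nL → ℝ)
    (A := {q | 0 ≤ q.2 ∧ (q.1.1, q.1.2 - q.2) ∈ M.feas i}) (φ := fun q => M.c ⬝ᵥ q.2)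
    (fun v => isSigmaCompact_univ.of_isClosed_subset ?_ (subset_univ _)) fun p => hM.bddBelow_shedCost i p.1 p.2
  have h1 : IsClosed {q : ((Fin nG → ℝ) × (Fin nL → ℝ)) × (Fin nL → ℝ) | 0 ≤ q.2} :=
    isClosed_le continuous_const continuous_snd
  have h2 : IsClosed {q : ((Fin nG → ℝ) × (Fin nL → ℝ)) × (Fin nL → ℝ) |
      (q.1.1, q.1.2 - q.2) ∈ M.feas i} := (hM.feas_compact i).isClosed.preimage (by fun_prop)
  have h3 : IsClosed {q : ((Fin nG → ℝ) × (Fin nL → ℝ)) × (Fin nL → ℝ) | M.c ⬝ᵥ q.2 ≤ v} := by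
    refine isClosed_le ?_ continuous_const
    simp only [dotProduct]
    fun_prop
  exact (h1.inter h2).inter h3

theorem Model.Valid.shedCost_nonneg (hM : M.Valid) (i : Fin (nc + 1)) (p : Fin nG → ℝ)
    (d : Fin nL → ℝ) : 0 ≤ M.shedCost i p d := by
  rw [Model.Valid.shedCost_eq]
  refine Real.sInf_nonneg ?_
  rintro _ ⟨z, hz, rfl⟩
  exact dotProduct_nonneg_of_nonneg' hM.c_pos hz.1

/-- Feasible demands are nonnegative, so the disconnection provided by `feas_rescue` never exceeds
the demand itself. -/
theorem Model.Valid.shedCost_le (hM : M.Valid) (i : Fin (nc + 1)) {p : Fin nG → ℝ}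
    (hp : p ∈ M.prodBox) {d : Fin nL → ℝ} (hd : 0 ≤ d) : M.shedCost i p d ≤ M.c ⬝ᵥ d := by
  obtain ⟨z, hz, hzf⟩ := hM.feas_rescue i p hp d hd
  rw [Model.Valid.shedCost_eq]
  refine (csInf_le (hM.bddBelow_shedCost i p d) ⟨z, ⟨hz, hzf⟩, rfl⟩).trans ?_
  have h1 : z ≤ d := sub_nonneg.1 (hM.feas_nonneg i _ hzf)
  exact Finset.sum_le_sum fun k _ => mul_le_mul_of_nonneg_left (h1 k) (hM.c_pos k).le

theorem Model.Valid.abs_runCost_le (hM : M.Valid) : ∃ C, 0 ≤ C ∧ ∀ x a, ∀ r ∈ M.progSet a,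
    |M.runCost x a r| ≤ C * (1 + ∑ k, |x k|) := by
  obtain ⟨C₀, hC₀, h₀⟩ := exists_bound_of_isCompact M.isCompact_prodBox hM.prodCost_cont
  set C₁ : ℝ := ∑ k, M.c k with hC₁
  have hC₁0 : 0 ≤ C₁ := Finset.sum_nonneg fun k _ => (hM.c_pos k).le
  set Q : ℝ := ∑ i, M.q i with hQ
  have hQ0 : 0 ≤ Q := Finset.sum_nonneg fun i _ => hM.q_nonneg i
  refine ⟨C₀ + Q * C₁, by positivity, fun x a r hr => ?_⟩
  have hp := hM.prod_mem hr
  set X : ℝ := ∑ k, |x k| with hX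
  have hX0 : 0 ≤ X := Finset.sum_nonneg fun k _ => abs_nonneg _
  have hpos : (0 : Fin nL → ℝ) ≤ x ⊔ 0 := le_sup_right
  have hs : M.c ⬝ᵥ (x ⊔ 0) ≤ C₁ * X := by
    rw [hC₁, Finset.sum_mul]
    refine Finset.sum_le_sum fun k _ => mul_le_mul_of_nonneg_left ?_ (hM.c_pos k).le
    have h1 : (x ⊔ 0) k ≤ |x k| := sup_le (le_abs_self _) (abs_nonneg _)
    exact h1.trans (Finset.single_le_sum (f := fun k => |x k|) (fun k _ => abs_nonneg _)
      (Finset.mem_univ k))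
  have h1 : ∑ i, M.q i * M.shedCost i (M.prod a r) (x ⊔ 0) ≤ Q * (C₁ * X) := by
    rw [hQ, Finset.sum_mul]
    exact Finset.sum_le_sum fun i _ => mul_le_mul_of_nonneg_left
      ((hM.shedCost_le i hp hpos).trans hs) (hM.q_nonneg i)
  have h2 : 0 ≤ ∑ i, M.q i * M.shedCost i (M.prod a r) (x ⊔ 0) :=
    Finset.sum_nonneg fun i _ => mul_nonneg (hM.q_nonneg i) (hM.shedCost_nonneg i _ _)
  have h3 := h₀ _ hp
  unfold Model.runCost
  refine (abs_add_le _ _).trans ?_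
  rw [abs_of_nonneg h2]
  have h4 : 0 ≤ C₀ * X := by positivity
  have h5 : 0 ≤ Q * C₁ := by positivity
  nlinarith

/-- Ramps and production costs are regular only on the admissible progressions, hence the cut-off by
an indicator. -/
theorem Model.Valid.measurable_runCost (hM : M.Valid) (a : M.Mode) :
    Measurable fun p : (Fin nL → ℝ) × (Fin nG → ℝ) =>
      (M.progSet a).indicator (fun r => M.runCost p.1 a r) p.2 := by
  classical
  have hA := measurableSet_progSet a
  have hprod : Measurable ((M.progSet a).indicator (M.prod a)) := by
    have := (hM.continuousOn_prod a).measurable_piecewise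
      (g := (0 : (Fin nG → ℝ) → Fin nG → ℝ)) continuousOn_const hA
    rwa [piecewise_eq_indicator] at this
  have hcost : Measurable ((M.progSet a).indicator fun r => M.prodCost (M.prod a r)) := by
    have := (hM.prodCost_cont.comp (hM.continuousOn_prod a)
      fun r hr => hM.prod_mem hr).measurable_piecewise (g := (0 : (Fin nG → ℝ) → ℝ))
        continuousOn_const hA
    rwa [piecewise_eq_indicator] at this
  have hshed : ∀ i, Measurable fun p : (Fin nL → ℝ) × (Fin nG → ℝ) =>
      M.shedCost i ((M.progSet a).indicator (M.prod a) p.2) (p.1 ⊔ 0) := fun i =>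
    (hM.measurable_shedCost i).comp ((hprod.comp measurable_snd).prodMk
      (measurable_pi_iff.2 fun k => ((measurable_pi_apply k).comp measurable_fst).sup_const 0))
  have e : (fun p : (Fin nL → ℝ) × (Fin nG → ℝ) =>
      (M.progSet a).indicator (fun r => M.runCost p.1 a r) p.2)
      = fun p => (M.progSet a).indicator (fun r => M.prodCost (M.prod a r)) p.2
        + {p : (Fin nL → ℝ) × (Fin nG → ℝ) | p.2 ∈ M.progSet a}.indicator (fun p => ∑ i, M.q i *
          M.shedCost i ((M.progSet a).indicator (M.prod a) p.2) (p.1 ⊔ 0)) p := by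
    funext p
    by_cases hp : p.2 ∈ M.progSet a
    · simp [hp, Model.runCost]
    · simp [hp]
  rw [e]
  exact (hcost.comp measurable_snd).add
    ((Finset.measurable_fun_sum _ fun i _ => (hshed i).const_mul _).indicator (measurable_snd hA))


variable {nG nL nc N : ℕ} {M : Model nG nL nc}

theorem abs_dotProduct_sub_le {n : ℕ} {u v z : Fin n → ℝ} {R : ℝ} (hz : ∀ k, |z k| ≤ R) :
    |u ⬝ᵥ z - v ⬝ᵥ z| ≤ (∑ k, |u k - v k|) * R := by
  rw [← sub_dotProduct, Finset.sum_mul]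
  refine (Finset.abs_sum_le_sum_abs _ _).trans (Finset.sum_le_sum fun k _ => ?_)
  rw [abs_mul]
  exact mul_le_mul_of_nonneg_left (hz k) (abs_nonneg _)

theorem abs_dotProduct_le {n : ℕ} {u z : Fin n → ℝ} {R : ℝ} (hz : ∀ k, |z k| ≤ R) :
    |u ⬝ᵥ z| ≤ (∑ k, |u k|) * R := by
  simpa using abs_dotProduct_sub_le (u := u) (v := 0) hz

/-! ### Disconnection costs of the lower bound problem -/

variable (M) in
/-- Lowest cost of the disconnection of one unit of weighted demand. -/
noncomputable def shedWeight [Nonempty (Fin nL)] (η : Fin nL → ℝ) : ℝ :=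
  Finset.univ.inf' Finset.univ_nonempty fun k => M.c k / η k

theorem shedWeight_nonneg [Nonempty (Fin nL)] (hM : M.Valid) {η : Fin nL → ℝ}
    (hη : ∀ k, 0 < η k) : 0 ≤ shedWeight M η :=
  Finset.le_inf' _ _ fun k _ => div_nonneg (hM.c_pos k).le (hη k).le

/-- This is a linear program with one constraint besides `z ≥ 0`: it is optimal to disconnect load
only at a node that minimises `c k / η k`. The explicit value gives continuity in all arguments. -/
theorem shedCostLB_eq [Nonempty (Fin nL)] (hM : M.Valid) {η : Fin nL → ℝ} (hη : ∀ k, 0 < η k)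
    (g : Fin nG → ℝ) (i : Fin (nc + 1)) (y x : ℝ) :
    shedCostLB M η g i y x = shedWeight M η * max 0 (y + x - supportVal M η g i) := by
  set u := y + x - supportVal M η g i with hu
  obtain ⟨k₀, -, hk₀⟩ := Finset.exists_mem_eq_inf' (s := Finset.univ) Finset.univ_nonempty
    fun k => M.c k / η k
  have hw : shedWeight M η = M.c k₀ / η k₀ := hk₀
  refine IsLeast.csInf_eq ⟨⟨Pi.single k₀ (max 0 u / η k₀), ?_, ?_, ?_⟩, ?_⟩
  · exact Pi.single_nonneg.2 (div_nonneg (le_max_left _ _) (hη k₀).le)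
  · rw [dotProduct_single, mul_div_cancel₀ _ (hη k₀).ne']
    have := le_max_right 0 u
    linarith
  · rw [dotProduct_single, hw]
    ring
  · rintro _ ⟨z, hz, hle, rfl⟩
    have h1 : max 0 u ≤ η ⬝ᵥ z :=
      max_le (dotProduct_nonneg_of_nonneg' hη hz) (by linarith)
    refine (mul_le_mul_of_nonneg_left h1 (shedWeight_nonneg hM hη)).trans ?_
    simp only [dotProduct, Finset.mul_sum]
    refine Finset.sum_le_sum fun k _ => ?_
    rw [← mul_assoc]
    refine mul_le_mul_of_nonneg_right ?_ (hz k)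
    rw [← le_div_iff₀ (hη k)]
    exact Finset.inf'_le _ (Finset.mem_univ k)

theorem shedCostLB_nonneg (hM : M.Valid) (η : Fin nL → ℝ) (g : Fin nG → ℝ) (i : Fin (nc + 1))
    (y x : ℝ) : 0 ≤ shedCostLB M η g i y x := by
  refine Real.sInf_nonneg ?_
  rintro _ ⟨z, hz, -, rfl⟩
  exact dotProduct_nonneg_of_nonneg' hM.c_pos hz

theorem exists_coord_bound {n : ℕ} {K : Set (Fin n → ℝ)} (hK : IsCompact K) :
    ∃ R, 0 ≤ R ∧ ∀ p ∈ K, ∀ k, |p k| ≤ R := by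
  obtain ⟨R, hR⟩ := hK.exists_bound_of_continuousOn continuousOn_id
  exact ⟨max R 0, le_max_right _ _, fun p hp k =>
    (norm_le_pi_norm p k).trans ((hR p hp).trans (le_max_left _ _))⟩

theorem Model.Valid.exists_coord_bound (hM : M.Valid) :
    ∃ R, 0 ≤ R ∧ (∀ p ∈ M.prodBox, ∀ k, |p k| ≤ R) ∧
      ∀ i, ∀ q ∈ M.feas i, ∀ k, |q.2 k| ≤ R := by
  obtain ⟨R₀, hR₀, h₀⟩ := GenPlan.exists_coord_bound M.isCompact_prodBox
  choose R hR h using fun i =>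
    GenPlan.exists_coord_bound ((hM.feas_compact i).image continuous_snd)
  refine ⟨R₀ + ∑ i, R i, add_nonneg hR₀ (Finset.sum_nonneg fun i _ => hR i),
    fun p hp k => ?_, fun i q hq k => ?_⟩
  · exact (h₀ p hp k).trans (le_add_of_nonneg_right (Finset.sum_nonneg fun i _ => hR i))
  · refine (h i _ ⟨q, hq, rfl⟩ k).trans ?_
    have := Finset.single_le_sum (f := R) (fun i _ => hR i) (Finset.mem_univ i)
    linarith

theorem supportVal_eq (η : Fin nL → ℝ) (g : Fin nG → ℝ) (i : Fin (nc + 1)) :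
    supportVal M η g i = sSup ((fun p : (Fin nG → ℝ) × (Fin nL → ℝ) => g ⬝ᵥ p.1 + η ⬝ᵥ p.2) ''
      {p | p ∈ M.feas i ∧ p.1 ∈ M.prodBox ∧ 0 ≤ p.2}) := by
  unfold supportVal
  congr 1
  ext v
  simp only [mem_ofPred_eq, mem_image, and_assoc, eq_comm]

theorem bddAbove_supportVal (hM : M.Valid) (η : Fin nL → ℝ) (g : Fin nG → ℝ)
    (i : Fin (nc + 1)) :
    BddAbove ((fun p : (Fin nG → ℝ) × (Fin nL → ℝ) => g ⬝ᵥ p.1 + η ⬝ᵥ p.2) ''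
      {p | p ∈ M.feas i ∧ p.1 ∈ M.prodBox ∧ 0 ≤ p.2}) := by
  have hc : Continuous fun p : (Fin nG → ℝ) × (Fin nL → ℝ) => g ⬝ᵥ p.1 + η ⬝ᵥ p.2 := by
    simp only [dotProduct]
    fun_prop
  exact ((hM.feas_compact i).image hc).bddAbove.mono (image_mono fun p hp => hp.1)

theorem abs_supportVal_sub_le {R : ℝ} (hM : M.Valid) (hR : 0 ≤ R)
    (hP : ∀ p ∈ M.prodBox, ∀ k, |p k| ≤ R) (hF : ∀ i, ∀ q ∈ M.feas i, ∀ k, |q.2 k| ≤ R)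
    (η η' : Fin nL → ℝ) (g g' : Fin nG → ℝ) (i : Fin (nc + 1)) :
    |supportVal M η g i - supportVal M η' g' i|
      ≤ ((∑ k, |g k - g' k|) + ∑ k, |η k - η' k|) * R := by
  rw [supportVal_eq, supportVal_eq]
  refine abs_sSup_sub_sSup_le (by positivity) (bddAbove_supportVal hM η g i)
    (bddAbove_supportVal hM η' g' i) fun p hp => ?_
  have h1 := abs_dotProduct_sub_le (u := g) (v := g') (hP _ hp.2.1)
  have h2 := abs_dotProduct_sub_le (u := η) (v := η') (hF i _ hp.1)
  have e : g ⬝ᵥ p.1 + η ⬝ᵥ p.2 - (g' ⬝ᵥ p.1 + η' ⬝ᵥ p.2)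
      = (g ⬝ᵥ p.1 - g' ⬝ᵥ p.1) + (η ⬝ᵥ p.2 - η' ⬝ᵥ p.2) := by ring
  rw [e, add_mul]
  exact (abs_add_le _ _).trans (add_le_add h1 h2)

/-! ### Running costs of the lower bound problem -/

/-- Any disconnection that is feasible for `feas i` satisfies the half-space constraint, by
definition of the support value and since `η ⬝ᵥ x ≤ η ⬝ᵥ (x ⊔ 0)`. -/
theorem shedCostLB_le_shedCost (hM : M.Valid) {η : Fin nL → ℝ} (hη : ∀ k, 0 < η k)
    (g : Fin nG → ℝ) (i : Fin (nc + 1)) {p : Fin nG → ℝ} (hp : p ∈ M.prodBox) (x : Fin nL → ℝ) :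
    shedCostLB M η g i (g ⬝ᵥ p) (η ⬝ᵥ x) ≤ M.shedCost i p (x ⊔ 0) := by
  -- Without a feasible disconnection the infimum on the right would take the default value `0`.
  obtain ⟨z₀, hz₀, hzf₀⟩ := hM.feas_rescue i p hp (x ⊔ 0) le_sup_right
  refine le_csInf ⟨_, z₀, hz₀, hzf₀, rfl⟩ ?_
  rintro _ ⟨z, hz, hzf, rfl⟩
  refine csInf_le ⟨0, ?_⟩ ⟨z, hz, ?_, rfl⟩
  · rintro _ ⟨z', hz', -, rfl⟩
    exact dotProduct_nonneg_of_nonneg' hM.c_pos hz'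
  · have h1 : g ⬝ᵥ p + η ⬝ᵥ (x ⊔ 0 - z) ≤ supportVal M η g i := by
      rw [supportVal_eq]
      exact le_csSup (bddAbove_supportVal hM η g i)
        ⟨(p, x ⊔ 0 - z), ⟨hzf, hp, hM.feas_nonneg i _ hzf⟩, rfl⟩
    rw [dotProduct_sub] at h1
    have h2 : η ⬝ᵥ x ≤ η ⬝ᵥ (x ⊔ 0) :=
      Finset.sum_le_sum fun k _ => mul_le_mul_of_nonneg_left le_sup_left (hη k).le
    linarith

theorem runCost₁_le_runCost (hM : M.Valid) {η : Fin nL → ℝ} (hη : ∀ k, 0 < η k)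
    (g : Fin N → Fin nG → ℝ) (x : Fin nL → ℝ) (a : M.Mode) {r : Fin nG → ℝ}
    (hr : r ∈ M.progSet a) : runCost₁ M η g (η ⬝ᵥ x) a r ≤ M.runCost x a r := by
  refine add_le_add_right (Real.iSup_le (fun j => ?_) ?_) _
  · exact Finset.sum_le_sum fun i _ => mul_le_mul_of_nonneg_left
      (shedCostLB_le_shedCost hM hη (g j) i (hM.prod_mem hr) x) (hM.q_nonneg i)
  · exact Finset.sum_nonneg fun i _ => mul_nonneg (hM.q_nonneg i) (hM.shedCost_nonneg i _ _)

theorem runCost₂_eq (η : Fin nL → ℝ) (g : Fin N → Fin nG → ℝ) (y : ℝ) (a : M.Mode) (w : ℝ) :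
    runCost₂ M η g y a w = sInf ((fun r => runCost₁ M η g y a r) ''
      {r | r ∈ M.progSet a ∧ ∑ k, r k = w}) := by
  unfold runCost₂
  congr 1
  ext v
  simp only [mem_ofPred_eq, mem_image, and_assoc, eq_comm]

theorem abs_runCost₁_le [Nonempty (Fin nL)] (hM : M.Valid) {η : Fin nL → ℝ} (hη : ∀ k, 0 < η k)
    (g : Fin N → Fin nG → ℝ) : ∃ C, 0 ≤ C ∧ ∀ y a, ∀ r ∈ M.progSet a,
      |runCost₁ M η g y a r| ≤ C * (1 + |y|) := by
  obtain ⟨C₀, hC₀, h₀⟩ := exists_bound_of_isCompact M.isCompact_prodBox hM.prodCost_cont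
  obtain ⟨R, hR, hP, -⟩ := hM.exists_coord_bound
  set κ := shedWeight M η with hκ
  have hκ0 : 0 ≤ κ := shedWeight_nonneg hM hη
  set Q : ℝ := ∑ i, M.q i with hQ
  have hQ0 : 0 ≤ Q := Finset.sum_nonneg fun i _ => hM.q_nonneg i
  set G : ℝ := ∑ j, (∑ k, |g j k|) * R with hG
  have hG0 : 0 ≤ G := by positivity
  set D : ℝ := ∑ j, ∑ i, |supportVal M η (g j) i| with hD
  have hD0 : 0 ≤ D := by positivity
  refine ⟨C₀ + Q * κ * (1 + G + D), by positivity, fun y a r hr => ?_⟩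
  have hp := hM.prod_mem hr
  have hy := abs_nonneg y
  have h1 : ∀ j, ∑ i, M.q i * shedCostLB M η (g j) i (g j ⬝ᵥ M.prod a r) y
      ≤ Q * (κ * (G + |y| + D)) := by
    intro j
    rw [hQ, Finset.sum_mul]
    refine Finset.sum_le_sum fun i _ => mul_le_mul_of_nonneg_left ?_ (hM.q_nonneg i)
    rw [shedCostLB_eq hM hη]
    refine mul_le_mul_of_nonneg_left (max_le (by positivity) ?_) hκ0
    have h2 := (le_abs_self _).trans (abs_dotProduct_le (u := g j) (hP _ hp))
    have h3 : (∑ k, |g j k|) * R ≤ G := Finset.single_le_sum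
      (f := fun j => (∑ k, |g j k|) * R) (fun j _ => by positivity) (Finset.mem_univ j)
    have h4 : |supportVal M η (g j) i| ≤ D :=
      (Finset.single_le_sum (f := fun i => |supportVal M η (g j) i|)
        (fun i _ => abs_nonneg _) (Finset.mem_univ i)).trans
      (Finset.single_le_sum (f := fun j => ∑ i, |supportVal M η (g j) i|)
        (fun j _ => by positivity) (Finset.mem_univ j))
    have h5 := neg_abs_le (supportVal M η (g j) i)
    have h6 := le_abs_self y
    linarith
  have h2 : (⨆ j, ∑ i, M.q i * shedCostLB M η (g j) i (g j ⬝ᵥ M.prod a r) y)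
      ≤ Q * (κ * (G + |y| + D)) := Real.iSup_le h1 (by positivity)
  have h3 : 0 ≤ ⨆ j, ∑ i, M.q i * shedCostLB M η (g j) i (g j ⬝ᵥ M.prod a r) y :=
    Real.iSup_nonneg fun j => Finset.sum_nonneg fun i _ =>
      mul_nonneg (hM.q_nonneg i) (shedCostLB_nonneg hM _ _ _ _ _)
  unfold runCost₁
  refine (abs_add_le _ _).trans ?_
  rw [abs_of_nonneg h3]
  have h4 := h₀ _ hp
  have h5 : 0 ≤ C₀ * |y| := by positivity
  have h6 : 0 ≤ Q * κ := by positivity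
  have h7 : 0 ≤ Q * κ * ((G + D) * |y|) := by positivity
  nlinarith

theorem bddBelow_runCost₁ [Nonempty (Fin nL)] (hM : M.Valid) {η : Fin nL → ℝ}
    (hη : ∀ k, 0 < η k) (g : Fin N → Fin nG → ℝ) (y : ℝ) (a : M.Mode) {A : Set (Fin nG → ℝ)}
    (hA : A ⊆ M.progSet a) : BddBelow ((fun r => runCost₁ M η g y a r) '' A) := by
  obtain ⟨C, -, h⟩ := abs_runCost₁_le hM hη g
  refine ⟨-(C * (1 + |y|)), ?_⟩
  rintro _ ⟨r, hr, rfl⟩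
  exact (abs_le.1 (h y a r (hA hr))).1

theorem abs_runCost₂_le [Nonempty (Fin nL)] (hM : M.Valid) {η : Fin nL → ℝ} (hη : ∀ k, 0 < η k)
    (g : Fin N → Fin nG → ℝ) : ∃ C, 0 ≤ C ∧ ∀ y a w,
      |runCost₂ M η g y a w| ≤ C * (1 + |y|) := by
  obtain ⟨C, hC, h⟩ := abs_runCost₁_le hM hη g
  refine ⟨C, hC, fun y a w => ?_⟩
  have hb : 0 ≤ C * (1 + |y|) := by positivity
  rw [runCost₂_eq]
  have := abs_sInf_sub_sInf_le (R := {r | r ∈ M.progSet a ∧ ∑ k, r k = w}) (g := fun _ => (0 : ℝ))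
    hb (bddBelow_runCost₁ hM hη g y a fun r hr => hr.1)
    (by refine ⟨0, ?_⟩; rintro _ ⟨r, -, rfl⟩; exact le_rfl)
    (fun r hr => by simpa using h y a r hr.1)
  rcases eq_empty_or_nonempty {r | r ∈ M.progSet a ∧ ∑ k, r k = w} with he | hne
  · rw [he]
    simpa using hb
  · rw [hne.image_const, csInf_singleton, sub_zero] at this
    exact this

theorem runCost₂_le_runCost [Nonempty (Fin nL)] (hM : M.Valid) {η : Fin nL → ℝ}
    (hη : ∀ k, 0 < η k) (g : Fin N → Fin nG → ℝ) (x : Fin nL → ℝ) (a : M.Mode)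
    {r : Fin nG → ℝ} (hr : r ∈ M.progSet a) :
    runCost₂ M η g (η ⬝ᵥ x) a (∑ k, r k) ≤ M.runCost x a r := by
  have hb := bddBelow_runCost₁ hM hη g (η ⬝ᵥ x) a
    (A := {r' | r' ∈ M.progSet a ∧ ∑ k, r' k = ∑ k, r k}) fun r hr => hr.1
  rw [runCost₂_eq]
  exact (csInf_le hb ⟨r, ⟨hr, rfl⟩, rfl⟩).trans (runCost₁_le_runCost hM hη g x a hr)

theorem continuousOn_runCost₁ [Nonempty (Fin nL)] (hM : M.Valid) {η : Fin nL → ℝ}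
    (hη : ∀ k, 0 < η k) (g : Fin N → Fin nG → ℝ) (a : M.Mode) :
    ContinuousOn (fun p : ℝ × (Fin nG → ℝ) => runCost₁ M η g p.1 a p.2)
      {p | p.2 ∈ M.progSet a} := by
  have hprod : ContinuousOn (fun p : ℝ × (Fin nG → ℝ) => M.prod a p.2)
      {p | p.2 ∈ M.progSet a} :=
    (hM.continuousOn_prod a).comp continuousOn_snd fun p hp => hp
  unfold runCost₁
  refine (hM.prodCost_cont.comp hprod fun p hp => hM.prod_mem hp).add ?_
  simp only [shedCostLB_eq hM hη]
  rcases isEmpty_or_nonempty (Fin N) with hN | hN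
  · simp only [Real.iSup_of_isEmpty]
    exact continuousOn_const
  · simp only [← Finset.sup'_univ_eq_ciSup]
    refine ContinuousOn.finset_sup'_apply _ fun j _ => ?_
    refine continuousOn_finsetSum _ fun i _ => ?_
    refine continuousOn_const.mul (continuousOn_const.mul (continuousOn_const.sup ?_))
    refine ContinuousOn.sub (ContinuousOn.add ?_ continuousOn_fst) continuousOn_const
    simp only [dotProduct]
    refine continuousOn_finsetSum _ fun k _ => continuousOn_const.mul ?_
    exact (continuous_apply k).comp_continuousOn hprod

/-- The infimum over the half-open set of progressions need not be attained, so measurability comes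
from σ-compactness of the sublevel sets. -/
theorem measurable_runCost₂ [Nonempty (Fin nL)] (hM : M.Valid) {η : Fin nL → ℝ}
    (hη : ∀ k, 0 < η k) (g : Fin N → Fin nG → ℝ) (a : M.Mode) :
    Measurable fun p : ℝ × ℝ => runCost₂ M η g p.1 a p.2 := by
  simp only [runCost₂_eq]
  refine measurable_sInf_fiber (X := ℝ × ℝ) (R := Fin nG → ℝ)
    (A := {q | q.2 ∈ M.progSet a ∧ ∑ k, q.2 k = q.1.2})
    (φ := fun q => runCost₁ M η g q.1.1 a q.2) (fun v => ?_)
    fun p => bddBelow_runCost₁ hM hη g p.1 a fun r hr => hr.1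
  have h := isSigmaCompact_progSet_inter (Y := ℝ × ℝ) a
    (F := {q | ∑ k, q.2 k = q.1.2 ∧ runCost₁ M η g q.1.1 a q.2 ≤ v}) ?_
  · convert! h using 1
    ext q
    simp only [mem_ofPred_eq, and_assoc]
  · intro K hK hKs
    have h1 : IsClosed {q : (ℝ × ℝ) × (Fin nG → ℝ) | q.2 ∈ K} := hK.preimage continuous_snd
    have h2 : ContinuousOn (fun q : (ℝ × ℝ) × (Fin nG → ℝ) => runCost₁ M η g q.1.1 a q.2)
        {q | q.2 ∈ K} :=
      (continuousOn_runCost₁ hM hη g a).comp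
        (f := fun q : (ℝ × ℝ) × (Fin nG → ℝ) => (q.1.1, q.2)) (by fun_prop)
        fun q hq => hKs hq
    have h3 := h2.preimage_isClosed_of_isClosed h1 (isClosed_Iic (a := v))
    have h4 : IsClosed {q : (ℝ × ℝ) × (Fin nG → ℝ) | ∑ k, q.2 k = q.1.2} :=
      isClosed_eq (by fun_prop) (by fun_prop)
    convert! h3.inter h4 using 1
    ext q
    simp only [mem_ofPred_eq, mem_inter_iff, mem_preimage, mem_Iic]
    tauto

/-! ### Dependence of the running costs on the weights -/

theorem abs_mul_max_sub_le {κ κ' p p' : ℝ} (hκ : 0 ≤ κ) :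
    |κ * max 0 p - κ' * max 0 p'| ≤ |κ - κ'| * |p'| + κ * |p - p'| := by
  have e : κ * max 0 p - κ' * max 0 p' = (κ - κ') * max 0 p' + κ * (max 0 p - max 0 p') := by ring
  rw [e]
  refine (abs_add_le _ _).trans (add_le_add ?_ ?_)
  · rw [abs_mul]
    refine mul_le_mul_of_nonneg_left ?_ (abs_nonneg _)
    rw [abs_of_nonneg (le_max_left _ _)]
    exact max_le (abs_nonneg _) (le_abs_self _)
  · rw [abs_mul, abs_of_nonneg hκ]
    refine mul_le_mul_of_nonneg_left ?_ hκ
    have := abs_max_sub_max_le_max 0 p 0 p'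
    simpa using this

theorem abs_affine_le {a b v d s A B V S : ℝ} (ha : |a| ≤ A) (hb : |b| ≤ B) (hv : |v| ≤ V)
    (hs : |s| ≤ S) : |a + (b + v * d) - s| ≤ (A + B + V + S) * (1 + |d|) := by
  have hd := abs_nonneg d
  have h1 : |a + (b + v * d) - s| ≤ |a| + (|b| + |v| * |d|) + |s| := by
    rw [← abs_mul]
    exact (abs_sub _ _).trans (add_le_add_left ((abs_add_le _ _).trans
      (add_le_add_right (abs_add_le _ _) _)) _)
  have h2 : |v| * |d| ≤ V * |d| := mul_le_mul_of_nonneg_right hv hd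
  have h3 : 0 ≤ (A + B + S) * |d| :=
    mul_nonneg (by linarith [abs_nonneg a, abs_nonneg b, abs_nonneg s]) hd
  have h4 := (abs_nonneg v).trans hv
  linarith

theorem continuousOn_shedWeight [Nonempty (Fin nL)] {U : Set (Fin nL → ℝ)}
    (hU : ∀ η ∈ U, ∀ k, 0 < η k) : ContinuousOn (shedWeight M) U :=
  ContinuousOn.finset_inf'_apply _ fun k _ =>
    continuousOn_const.div (continuous_apply k).continuousOn fun η hη => (hU η hη k).ne'

theorem continuous_volLB : Continuous (volLB M) := by
  unfold volLB
  refine continuous_norm.comp ((PiLp.continuous_toLp 2 _).comp ?_)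
  refine continuous_pi fun k => ?_
  simp only [Matrix.vecMul, dotProduct]
  fun_prop

/-- The two infima run over the same progressions, so a pointwise estimate suffices. With the demand
written as mean plus volatility times deviation `d`, every ingredient is continuous in `η` and at
most affine in `d`, uniformly in mode and progression. -/
theorem abs_runCost₂_sub_le [Nonempty (Fin nL)] (hM : M.Valid) {U : Set (Fin nL → ℝ)}
    (hU : ∀ η ∈ U, ∀ k, 0 < η k) (hN : 1 ≤ N) {g : (Fin nL → ℝ) → Fin N → Fin nG → ℝ}
    (hg : ContinuousOn g U) {η₀ : Fin nL → ℝ} (hη₀ : η₀ ∈ U) {RA : ℝ} {ε : ℝ}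
    (hε : 0 < ε) :
    ∀ᶠ η in 𝓝[U] η₀, ∀ A : Fin nL → ℝ, (∀ k, |A k| ≤ RA) → ∀ d a w,
      |runCost₂ M η (g η) (η ⬝ᵥ A + volLB M η * d) a w
        - runCost₂ M η₀ (g η₀) (η₀ ⬝ᵥ A + volLB M η₀ * d) a w| ≤ ε * (1 + |d|) := by
  have : Nonempty (Fin N) := ⟨⟨0, hN⟩⟩
  obtain ⟨R, hR, hP, hF⟩ := hM.exists_coord_bound
  set Q : ℝ := ∑ i, M.q i with hQ
  have hQ0 : 0 ≤ Q := Finset.sum_nonneg fun i _ => hM.q_nonneg i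
  -- `B (1 + |d|)` dominates the excess over the half-space bound at `η₀`; it multiplies the change
  -- of `shedWeight`.
  set B : ℝ := (∑ j, (∑ k, |g η₀ j k|) * R) + (∑ k, |η₀ k|) * RA + |volLB M η₀|
    + ∑ j, ∑ i, |supportVal M η₀ (g η₀ j) i| with hB
  set gd : (Fin nL → ℝ) → ℝ := fun η => ∑ j, ∑ k, |g η j k - g η₀ j k| with hgd
  set ed : (Fin nL → ℝ) → ℝ := fun η => ∑ k, |η k - η₀ k| with hed
  -- Modulus of continuity of the disconnection costs: it is continuous on `U` and vanishes at `η₀`.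
  set E : (Fin nL → ℝ) → ℝ := fun η => Q * (|shedWeight M η - shedWeight M η₀| * B
    + shedWeight M η * (gd η * R + ed η * RA + |volLB M η - volLB M η₀|
      + (gd η + ed η) * R)) with hE
  have hEc : ContinuousOn E U := by
    have h1 := continuousOn_shedWeight (M := M) hU
    have h2 := (continuous_volLB (M := M)).continuousOn (s := U)
    have h3 : ContinuousOn gd U := by
      refine continuousOn_finsetSum _ fun j _ => continuousOn_finsetSum _ fun k _ => ?_
      exact ((continuousOn_pi.1 (continuousOn_pi.1 hg j) k).sub continuousOn_const).abs
    have h4 : ContinuousOn ed U := by fun_prop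
    simp only [hE]
    fun_prop
  have hE0 : E η₀ = 0 := by simp [hE, hgd, hed]
  have hlt : ∀ᶠ η in 𝓝[U] η₀, E η < ε := by
    have := hEc η₀ hη₀
    rw [ContinuousWithinAt, hE0] at this
    exact this.eventually (gt_mem_nhds hε)
  filter_upwards [hlt, self_mem_nhdsWithin] with η hEη hη A hA d a w
  have hgd0 : 0 ≤ gd η := by positivity
  have hed0 : 0 ≤ ed η := by positivity
  have hκ0 := shedWeight_nonneg hM (hU η hη)
  have hd := abs_nonneg d
  have hεd : 0 ≤ ε * (1 + |d|) := by positivity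
  rw [runCost₂_eq, runCost₂_eq]
  refine abs_sInf_sub_sInf_le hεd (bddBelow_runCost₁ hM (hU η hη) _ _ a fun r hr => hr.1)
    (bddBelow_runCost₁ hM (hU η₀ hη₀) _ _ a fun r hr => hr.1) fun r hr => ?_
  have hp := hP _ (hM.prod_mem hr.1)
  simp only [runCost₁]
  rw [add_sub_add_left_eq_sub]
  refine abs_ciSup_sub_ciSup_le fun j => ?_
  rw [← Finset.sum_sub_distrib]
  refine (Finset.abs_sum_le_sum_abs _ _).trans ?_
  have key : ∀ i, |M.q i * shedCostLB M η (g η j) i (g η j ⬝ᵥ M.prod a r)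
        (η ⬝ᵥ A + volLB M η * d)
      - M.q i * shedCostLB M η₀ (g η₀ j) i (g η₀ j ⬝ᵥ M.prod a r)
        (η₀ ⬝ᵥ A + volLB M η₀ * d)|
      ≤ M.q i * ((|shedWeight M η - shedWeight M η₀| * B
    + shedWeight M η * (gd η * R + ed η * RA + |volLB M η - volLB M η₀|
      + (gd η + ed η) * R)) * (1 + |d|)) := by
    intro i
    rw [← mul_sub, abs_mul, abs_of_nonneg (hM.q_nonneg i), shedCostLB_eq hM (hU η hη),
      shedCostLB_eq hM (hU η₀ hη₀)]
    refine mul_le_mul_of_nonneg_left ((abs_mul_max_sub_le hκ0).trans ?_) (hM.q_nonneg i)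
    have hgj : ∑ k, |g η j k - g η₀ j k| ≤ gd η := Finset.single_le_sum
      (f := fun j => ∑ k, |g η j k - g η₀ j k|) (fun j _ => by positivity) (Finset.mem_univ j)
    have hgj₀ : (∑ k, |g η₀ j k|) * R ≤ ∑ j, (∑ k, |g η₀ j k|) * R := Finset.single_le_sum
      (f := fun j => (∑ k, |g η₀ j k|) * R) (fun j _ => by positivity) (Finset.mem_univ j)
    have hs₀ : |supportVal M η₀ (g η₀ j) i| ≤ ∑ j, ∑ i, |supportVal M η₀ (g η₀ j) i| :=
      (Finset.single_le_sum (f := fun i => |supportVal M η₀ (g η₀ j) i|)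
        (fun i _ => abs_nonneg _) (Finset.mem_univ i)).trans
      (Finset.single_le_sum (f := fun j => ∑ i, |supportVal M η₀ (g η₀ j) i|)
        (fun j _ => by positivity) (Finset.mem_univ j))
    have hB0 : |g η₀ j ⬝ᵥ M.prod a r + (η₀ ⬝ᵥ A + volLB M η₀ * d)
        - supportVal M η₀ (g η₀ j) i| ≤ B * (1 + |d|) :=
      abs_affine_le ((abs_dotProduct_le hp).trans hgj₀) (abs_dotProduct_le hA) le_rfl hs₀
    have hC0 : |g η j ⬝ᵥ M.prod a r + (η ⬝ᵥ A + volLB M η * d) - supportVal M η (g η j) i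
        - (g η₀ j ⬝ᵥ M.prod a r + (η₀ ⬝ᵥ A + volLB M η₀ * d) - supportVal M η₀ (g η₀ j) i)|
        ≤ (gd η * R + ed η * RA + |volLB M η - volLB M η₀| + (gd η + ed η) * R)
          * (1 + |d|) := by
      have := abs_affine_le (d := d)
        ((abs_dotProduct_sub_le (u := g η j) (v := g η₀ j) hp).trans
          (mul_le_mul_of_nonneg_right hgj hR))
        (abs_dotProduct_sub_le (u := η) (v := η₀) hA) (le_refl |volLB M η - volLB M η₀|)
        ((abs_supportVal_sub_le hM hR hP hF η η₀ (g η j) (g η₀ j) i).trans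
          (mul_le_mul_of_nonneg_right (add_le_add_left hgj _) hR))
      convert! this using 2
      ring
    calc _ ≤ |shedWeight M η - shedWeight M η₀| * (B * (1 + |d|))
          + shedWeight M η * ((gd η * R + ed η * RA + |volLB M η - volLB M η₀|
            + (gd η + ed η) * R) * (1 + |d|)) :=
          add_le_add (mul_le_mul_of_nonneg_left hB0 (abs_nonneg _))
            (mul_le_mul_of_nonneg_left hC0 hκ0)
      _ = _ := by ring
  refine (Finset.sum_le_sum fun i _ => key i).trans ?_
  rw [← Finset.sum_mul, ← mul_assoc]
  exact mul_le_mul_of_nonneg_right hEη.le (by positivity)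


/-! ### Sections of events that are known from a pair of processes -/

variable {Ω : Type*} [MeasurableSpace Ω] {P : Measure Ω} {n : ℕ}

theorem pastSpace_comp {Ω X E : Type*} [MeasurableSpace E] (T : ℝ) (Y : ℝ → X → E) (φ : Ω → X)
    (s : ℝ) : pastSpace T (fun u ω => Y u (φ ω)) s = (pastSpace T Y s).comap φ := by
  simp only [pastSpace, MeasurableSpace.comap_iSup, MeasurableSpace.comap_comp]
  rfl

/-- The process on the product of the path spaces whose components are the two coordinate
processes. -/
def pairAt (n : ℕ) (u : ℝ) (x : (Fin n × ℝ≥0 → ℝ) × Path) : (Fin n → ℝ) × ℝ :=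
  (fun i => x.1 (i, u.toNNReal), x.2.1 u.toNNReal)

variable {B B' : Ω → Path} {C : Ω → Fin n × ℝ≥0 → ℝ}

theorem measurable_pairAt_section {T s u : ℝ} (hu0 : 0 ≤ u) (hus : u ≤ s) (huT : u ≤ T)
    (c : Fin n × ℝ≥0 → ℝ) :
    Measurable[pastSpace T (fun u (b : Path) => b.1 u.toNNReal) s]
      fun b : Path => pairAt n u (c, b) := by
  have h := measurable_pastSpace (Y := fun u (b : Path) => b.1 u.toNNReal) hu0 hus huT
  generalize pastSpace T (fun u (b : Path) => b.1 u.toNNReal) s = m at h ⊢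
  exact (measurable_const (a := fun i => c (i, u.toNNReal))).prodMk h

theorem pastSpace_pairAt_le_comap (T s : ℝ) (c : Fin n × ℝ≥0 → ℝ) :
    (pastSpace T (pairAt n) s).comap (fun b : Path => (c, b))
      ≤ pastSpace T (fun u (b : Path) => b.1 u.toNNReal) s := by
  rw [← pastSpace_comp]
  exact pastSpace_le fun u h0 hs hT => measurable_pairAt_section h0 hs hT c

/-- Up to a null set the event comes from a past event `A'` of the pair of coordinate processes, and
sections of `A'` are past events of the second coordinate. By Fubini the sections of `A` and `A'`
agree modulo the law of `B`, which is the law of `B'`, for almost every `c`. -/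
theorem ae_section_measurableSet [IsProbabilityMeasure P] (hB : Measurable B)
    (hB' : Measurable B') (hC : Measurable C) (hind : IndepFun C B P)
    (hmap : P.map B = P.map B') {T s : ℝ} {A : Set ((Fin n × ℝ≥0 → ℝ) × Path)}
    (hA : MeasurableSet A)
    (h : MeasurableSet[eventuallyMeasurableSpace
      (pastSpace T (fun u ω => pairAt n u (C ω, B ω)) s) (ae P)] {ω | (C ω, B ω) ∈ A}) :
    ∀ᵐ c ∂P.map C, MeasurableSet[genFiltration P T (fun u ω => (B' ω).1 u.toNNReal) s]
      {ω | (c, B' ω) ∈ A} := by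
  obtain ⟨A₁, hA₁, hAA₁⟩ := h
  rw [pastSpace_comp (Y := pairAt n) (φ := fun ω => (C ω, B ω))] at hA₁
  obtain ⟨A', hA', rfl⟩ := hA₁
  have hpm : ∀ u, Measurable (pairAt n u) := fun u =>
    (measurable_pi_iff.2 fun i => (measurable_pi_apply (i, u.toNNReal)).comp measurable_fst).prodMk
      ((measurable_pi_apply u.toNNReal).comp (measurable_subtype_coe.comp measurable_snd))
  have hA'm : MeasurableSet A' := pastSpace_le (fun u _ _ _ => hpm u) A' hA'
  have hprod : P.map (fun ω => (C ω, B ω)) = (P.map C).prod (P.map B) :=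
    (indepFun_iff_map_prod_eq_prod_map_map hC.aemeasurable hB.aemeasurable).1 hind
  have hiff : ∀ᵐ x ∂(P.map C).prod (P.map B), x ∈ A ↔ x ∈ A' := by
    rw [← hprod, ae_map_iff (hC.prodMk hB).aemeasurable (by
      have : {x | x ∈ A ↔ x ∈ A'} = (A ∩ A') ∪ (Aᶜ ∩ A'ᶜ) := by
        ext x
        simp only [mem_ofPred_eq, mem_union, mem_inter_iff, mem_compl_iff]
        tauto
      rw [this]
      exact (hA.inter hA'm).union (hA.compl.inter hA'm.compl))]
    filter_upwards [hAA₁] with ω hω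
    exact hω.to_iff
  have := (Measure.isProbabilityMeasure_map (μ := P) hB.aemeasurable)
  have := (Measure.isProbabilityMeasure_map (μ := P) hC.aemeasurable)
  filter_upwards [Measure.ae_ae_of_ae_prod hiff] with c hc
  rw [measurableSet_genFiltration]
  refine ⟨?_, (measurable_const.prodMk hB') hA⟩
  rw [hmap] at hc
  have hc' := ae_of_ae_map hB'.aemeasurable hc
  refine ⟨{ω | (c, B' ω) ∈ A'}, ?_, ?_⟩
  · have h1 : MeasurableSet[pastSpace T (fun u (b : Path) => b.1 u.toNNReal) s]
        {b : Path | (c, b) ∈ A'} :=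
      pastSpace_pairAt_le_comap T s c _ ⟨A', hA', rfl⟩
    have h2 := pastSpace_comp T (fun u (b : Path) => b.1 u.toNNReal) B' s
    rw [h2]
    exact ⟨_, h1, rfl⟩
  · filter_upwards [hc'] with ω hω
    exact propext hω

/-- The exceptional set of `c` depends on the time, so only countably many times can be treated at
once; right-continuity of the Brownian filtration supplies the others. The predicate `p` lets the
same argument serve for the requests. -/
theorem ae_section_stopping [IsProbabilityMeasure P] (hB : Measurable B)
    (hB' : Measurable B') (hC : Measurable C) (hind : IndepFun C B P)
    (hmap : P.map B = P.map B') (hBM : IsPreBrownianReal (fun s ω => (B' ω).1 s) P)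
    {T : ℝ} {τ : (Fin n × ℝ≥0 → ℝ) × Path → WithTop ℝ} (hτ : Measurable τ)
    {p : (Fin n × ℝ≥0 → ℝ) × Path → Prop} (hp : MeasurableSet {x | p x})
    (h : ∀ q : ℝ, MeasurableSet[eventuallyMeasurableSpace
      (pastSpace T (fun u ω => pairAt n u (C ω, B ω)) q) (ae P)]
        {ω | p (C ω, B ω) ∧ τ (C ω, B ω) ≤ q}) :
    ∀ᵐ c ∂P.map C, ∀ s : ℝ, MeasurableSet[genFiltration P T (fun u ω => (B' ω).1 u.toNNReal) s]
      {ω | p (c, B' ω) ∧ τ (c, B' ω) ≤ s} := by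
  have h1 : ∀ᵐ c ∂P.map C, ∀ q : ℚ,
      MeasurableSet[genFiltration P T (fun u ω => (B' ω).1 u.toNNReal) q]
        {ω | p (c, B' ω) ∧ τ (c, B' ω) ≤ (q : ℝ)} :=
    ae_all_iff.2 fun q => ae_section_measurableSet hB hB' hC hind hmap
      (A := {x | p x ∧ τ x ≤ (q : ℝ)})
      (hp.inter (measurableSet_le hτ measurable_const)) (h q)
  filter_upwards [h1] with c hc s
  refine measurableSet_genFiltration_of_gt (B := fun s ω => (B' ω).1 s) hBM
    (fun s => (measurable_pi_apply s).comp (measurable_subtype_coe.comp hB'))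
    (fun ω => (B' ω).2) fun q hq => ?_
  have e : {ω | p (c, B' ω) ∧ τ (c, B' ω) ≤ s}
      = ⋂ q' : {q' : ℚ // s < q' ∧ (q' : ℝ) < q},
        {ω | p (c, B' ω) ∧ τ (c, B' ω) ≤ ((q' : ℚ) : ℝ)} := by
    ext ω
    simp only [mem_ofPred_eq, mem_iInter, Subtype.forall]
    constructor
    · rintro ⟨h1, h2⟩ q' hq'
      exact ⟨h1, h2.trans (WithTop.coe_le_coe.2 hq'.1.le)⟩
    · intro hall
      obtain ⟨q₀, hq₀⟩ := exists_rat_btwn hq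
      refine ⟨(hall q₀ hq₀).1, ?_⟩
      refine le_of_not_gt fun hlt => ?_
      obtain ⟨y, hy1, hy2⟩ : ∃ y : ℝ, s < y ∧ (y : WithTop ℝ) ≤ τ (c, B' ω) ∧ y ≤ q := by
        cases hτω : τ (c, B' ω) with
        | top => exact ⟨q, hq, le_top, le_rfl⟩
        | coe z =>
          rw [hτω] at hlt
          exact ⟨min z q, lt_min (WithTop.coe_lt_coe.1 hlt) hq,
            WithTop.coe_le_coe.2 (min_le_left _ _), min_le_right _ _⟩
      obtain ⟨q', hq1, hq2⟩ := exists_rat_btwn hy1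
      have h3 := (hall q' ⟨hq1, hq2.trans_le hy2.2⟩).2
      exact absurd (WithTop.coe_le_coe.1 (hy2.1.trans h3)) (not_le.2 hq2)
  rw [e]
  refine MeasurableSet.iInter fun q' => ?_
  exact (genFiltration P T _).mono q'.2.2.le _ (hc q')


variable {nG nL nc : ℕ} {M : Model nG nL nc}

/-! ### Transfer of controls from one driving process to another -/

/-- Schedules with infinitely many requests are replaced by the empty one, so that the measurability
results, which need finiteness everywhere, apply. -/
theorem MeasurableSchedule.exists_finite {X : Type*} [MeasurableSpace X] {S : X → M.Schedule}
    (hS : MeasurableSchedule S) : ∃ S' : X → M.Schedule, MeasurableSchedule S' ∧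
      (∀ x, {j | (S' x).time j ≠ ⊤}.Finite) ∧
      ∀ x, {j | (S x).time j ≠ ⊤}.Finite → S' x = S x := by
  classical
  have hm := hS.measurableSet_finite
  refine ⟨fun x => if {j | (S x).time j ≠ ⊤}.Finite then S x
    else ⟨fun _ => ⊤, fun _ => none, fun _ => ⊤, fun _ => ⊤⟩, ⟨fun j => ?_, fun j b => ?_,
      fun k => ?_, fun j => ?_⟩, fun x => ?_, fun x hx => if_pos hx⟩
  · simp only [apply_ite (fun S : M.Schedule => S.time j)]
    exact Measurable.ite hm (hS.time j) measurable_const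
  · convert! hm.inter (hS.req j b) using 1
    ext x
    by_cases h : {j | (S x).time j ≠ ⊤}.Finite <;> simp [h]
  · simp only [apply_ite (fun S : M.Schedule => S.initDone k)]
    exact Measurable.ite hm (hS.initDone k) measurable_const
  · simp only [apply_ite (fun S : M.Schedule => S.done j)]
    exact Measurable.ite hm (hS.done j) measurable_const
  · by_cases h : {j | (S x).time j ≠ ⊤}.Finite
    · simpa only [if_pos h] using h
    · simp [h]

variable {Ω : Type*} [mΩ : MeasurableSpace Ω] {P : Measure Ω} {n : ℕ}
  {B B' : Ω → Path} {C : Ω → Fin n × ℝ≥0 → ℝ} {T : ℝ} {F : Filtration ℝ mΩ}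

/-- A schedule has countably many components, each measurable modulo null sets with respect to the
pair `(C, B)`, so all of them factor through the pair outside one null set. -/
theorem exists_schedule_eq
    (hF : ∀ s, F s ≤ eventuallyMeasurableSpace
      (pastSpace T (fun u ω => pairAt n u (C ω, B ω)) s) (ae P))
    {v : RControl M Ω} (hv : v.NonAnticipating F)
    (hi : ∀ k, IsStoppingTime F (v.initDone k)) (hd : ∀ j, IsStoppingTime F (v.done j))
    (hfin : ∀ᵐ ω ∂P, {j | v.time j ω ≠ ⊤}.Finite) :
    ∃ S : (Fin n × ℝ≥0 → ℝ) × Path → M.Schedule, MeasurableSchedule S ∧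
      (∀ x, {j | (S x).time j ≠ ⊤}.Finite) ∧ ∀ᵐ ω ∂P, v.schedule ω = S (C ω, B ω) := by
  classical
  have hpm : ∀ u, Measurable (pairAt n u) := fun u =>
    (measurable_pi_iff.2 fun i => (measurable_pi_apply (i, u.toNNReal)).comp measurable_fst).prodMk
      ((measurable_pi_apply u.toNNReal).comp (measurable_subtype_coe.comp measurable_snd))
  have hle : ⨆ s, F s ≤ eventuallyMeasurableSpace
      (MeasurableSpace.comap (fun ω => (C ω, B ω)) inferInstance) (ae P) := by
    refine iSup_le fun s => (hF s).trans ?_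
    refine eventuallyMeasurableSpace_le_of_le (le_trans ?_ le_eventuallyMeasurableSpace)
    rw [pastSpace_comp (Y := pairAt n) (φ := fun ω => (C ω, B ω))]
    exact MeasurableSpace.comap_mono (pastSpace_le fun u _ _ _ => hpm u)
  have hrep : ∀ τ : Ω → WithTop ℝ, IsStoppingTime F τ →
      ∃ h : (Fin n × ℝ≥0 → ℝ) × Path → WithTop ℝ, Measurable h ∧
        τ =ᵐ[P] h ∘ fun ω => (C ω, B ω) := fun τ hτ =>
    exists_measurable_comp_ae_eq_withTop
      (hτ.measurable.mono (hτ.measurableSpace_le'.trans hle) le_rfl)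
  choose hs₁ hs using hv
  choose Tt hTt hTt' using fun j => hrep _ (hs₁ j)
  choose Ti hTi hTi' using fun k => hrep _ (hi k)
  choose Td hTd hTd' using fun j => hrep _ (hd j)
  let _ : MeasurableSpace (Option M.Request) := ⊤
  have : DiscreteMeasurableSpace (Option M.Request) := ⟨fun _ => trivial⟩
  have hreq : ∀ j, Measurable[eventuallyMeasurableSpace
      (MeasurableSpace.comap (fun ω => (C ω, B ω)) inferInstance) (ae P)] (v.req j) := by
    intro j
    have h1 : ∀ b, MeasurableSet[eventuallyMeasurableSpace
      (MeasurableSpace.comap (fun ω => (C ω, B ω)) inferInstance) (ae P)]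
        {ω | v.req j ω = some b} := fun b =>
      ((hs₁ j).measurableSpace_le'.trans hle) _ (hs j b)
    generalize eventuallyMeasurableSpace
      (MeasurableSpace.comap (fun ω => (C ω, B ω)) inferInstance) (ae P) = m at h1
    refine measurable_to_countable' fun o => ?_
    cases o with
    | some b => exact h1 b
    | none =>
      have e : v.req j ⁻¹' {none} = (⋃ b, {ω | v.req j ω = some b})ᶜ := by
        ext ω
        simp only [mem_preimage, mem_singleton_iff, mem_compl_iff, mem_iUnion, mem_ofPred_eq,
          not_exists]
        cases v.req j ω <;> simp
      rw [e]
      exact (MeasurableSet.iUnion fun b => h1 b).compl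
  choose Tr hTr hTr' using fun j => exists_measurable_comp_ae_eq (hreq j)
  obtain ⟨S, hS, hSf, hSe⟩ := MeasurableSchedule.exists_finite
    (S := fun x => (⟨fun j => Tt j x, fun j => Tr j x, fun k => Ti k x, fun j => Td j x⟩ :
      M.Schedule)) ⟨hTt, fun j b => hTr j (MeasurableSet.of_discrete (s := {some b})), hTi, hTd⟩
  refine ⟨S, hS, hSf, ?_⟩
  filter_upwards [hfin, ae_all_iff.2 hTt', ae_all_iff.2 hTr', ae_all_iff.2 hTi',
    ae_all_iff.2 hTd'] with ω h1 h2 h3 h4 h5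
  have e : v.schedule ω = ⟨fun j => Tt j (C ω, B ω), fun j => Tr j (C ω, B ω),
      fun k => Ti k (C ω, B ω), fun j => Td j (C ω, B ω)⟩ := by
    unfold RControl.schedule
    congr 1
    · exact funext h2
    · exact funext h3
    · exact funext h4
    · exact funext h5
  rw [e]
  refine (hSe _ ?_).symm
  convert! h1 using 3 with j
  rw [h2]
  rfl

/-- Conditions at finite times suffice: an actual request made at time `⊤` is a null event, and the
augmented filtration contains null events at every time. -/
theorem nonAnticipating_of_forall [IsProbabilityMeasure P] {E : Type*} [MeasurableSpace E]
    {Y : ℝ → Ω → E} {v : Control M Ω}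
    (hτ : ∀ j (s : ℝ), MeasurableSet[genFiltration P T Y s] {ω | v.time j ω ≤ s})
    (hr : ∀ j b (s : ℝ), MeasurableSet[genFiltration P T Y s]
      {ω | v.req j ω = some b ∧ v.time j ω ≤ s})
    (hm : ∀ j b, MeasurableSet {ω | v.req j ω = some b})
    (htop : ∀ᵐ ω ∂P, ∀ j, v.time j ω = ⊤ ↔ v.req j ω = none) :
    v.NonAnticipating (genFiltration P T Y) := by
  intro j
  have hst : IsStoppingTime (genFiltration P T Y) (v.time j) := hτ j
  refine ⟨hst, fun b => ⟨?_, fun s => hr j b s⟩⟩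
  have e : {ω | v.req j ω = some b} = (⋃ k : ℕ, {ω | v.req j ω = some b ∧
      v.time j ω ≤ ((k : ℝ) : WithTop ℝ)}) ∪ {ω | v.req j ω = some b ∧ v.time j ω = ⊤} := by
    ext ω
    simp only [mem_union, mem_iUnion, mem_ofPred_eq, exists_and_left, ← and_or_left,
      iff_self_and]
    intro _
    cases h : v.time j ω with
    | top => exact Or.inr rfl
    | coe x =>
      obtain ⟨k, hk⟩ := exists_nat_ge x
      exact Or.inl ⟨k, WithTop.coe_le_coe.2 hk⟩
  rw [e]
  refine MeasurableSet.union (MeasurableSet.iUnion fun k =>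
    (le_iSup (fun s => (genFiltration P T Y) s) (k : ℝ)) _ (hr j b k)) ?_
  refine (le_iSup (fun s => (genFiltration P T Y) s) (0 : ℝ)) _ ?_
  rw [measurableSet_genFiltration]
  constructor
  · refine EventuallyMeasurableSet.congr (t := ∅) ⟨∅, @MeasurableSet.empty _ (pastSpace T Y 0), EventuallyEq.rfl⟩ ?_
    filter_upwards [htop] with ω hω
    refine eq_false ?_
    rintro ⟨h1, h2⟩
    have h3 := (hω j).1 h2
    rw [h3] at h1
    exact absurd h1 (by simp)
  · refine (hm j b).inter ?_
    exact (hst.measurable.mono (hst.measurableSpace_le) le_rfl) (measurableSet_singleton ⊤)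

/-- A control that is adapted to a process `B` and an independent process `C` can be replaced by a
control that is adapted to a process `B'` with the same law as `B`, without increasing the
expected costs. -/
theorem exists_transfer [IsProbabilityMeasure P] (hM : M.Valid) (hB : Measurable B)
    (hB' : Measurable B') (hC : Measurable C) (hind : IndepFun C B P)
    (hmap : P.map B = P.map B') (hBM : IsPreBrownianReal (fun s ω => (B' ω).1 s) P)
    (hF : ∀ s, F s ≤ eventuallyMeasurableSpace
      (pastSpace T (fun u ω => pairAt n u (C ω, B ω)) s) (ae P))
    {v : RControl M Ω} (hv : v.NonAnticipating F)
    (hi : ∀ k, IsStoppingTime F (v.initDone k)) (hd : ∀ j, IsStoppingTime F (v.done j))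
    {t : ℝ} (ht : t ≤ M.T) {a : M.Mode} {w : ℝ} (hf : ∀ᵐ ω ∂P, (v.schedule ω).Feasible t a w)
    {Φ : M.Schedule → Path → ℝ}
    (hΦ : ∀ S : (Fin n × ℝ≥0 → ℝ) × Path → M.Schedule, MeasurableSchedule S →
      (∀ x, {j | (S x).time j ≠ ⊤}.Finite) → Measurable fun x => Φ (S x) x.2)
    {G : Path → ℝ} (hG : Integrable G (P.map B))
    (hΦG : ∀ S b, S.Feasible t a w → |Φ S b| ≤ G b) :
    ∃ v' : RControl M Ω,
      v'.NonAnticipating (genFiltration P T fun u ω => (B' ω).1 u.toNNReal) ∧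
      (∀ k, IsStoppingTime (genFiltration P T fun u ω => (B' ω).1 u.toNNReal) (v'.initDone k)) ∧
      (∀ j, IsStoppingTime (genFiltration P T fun u ω => (B' ω).1 u.toNNReal) (v'.done j)) ∧
      (∀ᵐ ω ∂P, (v'.schedule ω).Feasible t a w) ∧
      ∫ ω, Φ (v'.schedule ω) (B' ω) ∂P ≤ ∫ ω, Φ (v.schedule ω) (B ω) ∂P := by
  obtain ⟨S, hS, hSf, hSe⟩ := exists_schedule_eq hF hv hi hd (hf.mono fun ω h => h.adm.finite)
  have hprod : P.map (fun ω => (C ω, B ω)) = (P.map C).prod (P.map B) :=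
    (indepFun_iff_map_prod_eq_prod_map_map hC.aemeasurable hB.aemeasurable).1 hind
  have hCB : Measurable fun ω => (C ω, B ω) := hC.prodMk hB
  have hPB : IsProbabilityMeasure (P.map B) := Measure.isProbabilityMeasure_map hB.aemeasurable
  have hPC : IsProbabilityMeasure (P.map C) := Measure.isProbabilityMeasure_map hC.aemeasurable
  have hfeasm := hS.measurableSet_feasible hM hSf ht a w
  have hfeas : ∀ᵐ x ∂(P.map C).prod (P.map B), (S x).Feasible t a w := by
    rw [← hprod, ae_map_iff hCB.aemeasurable hfeasm]
    filter_upwards [hf, hSe] with ω h1 h2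
    rwa [← h2]
  have hΦm := hΦ S hS hSf
  have hΦi : Integrable (fun x => Φ (S x) x.2) ((P.map C).prod (P.map B)) := by
    refine (hG.comp_snd (P.map C)).mono' hΦm.aestronglyMeasurable ?_
    filter_upwards [hfeas] with x hx
    exact hΦG _ _ hx
  -- By independence the expected cost is the average over `c` of the expected cost with `C` frozen
  -- at `c`.
  have hcost : ∫ ω, Φ (v.schedule ω) (B ω) ∂P
      = ∫ c, ∫ b, Φ (S (c, b)) b ∂P.map B ∂P.map C := by
    rw [← integral_prod _ hΦi, ← hprod,
      integral_map hCB.aemeasurable hΦm.aestronglyMeasurable]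
    refine integral_congr_ae ?_
    filter_upwards [hSe] with ω hω
    rw [hω]
  have hsec : ∀ (τ : (Fin n × ℝ≥0 → ℝ) × Path → WithTop ℝ) (σ : Ω → WithTop ℝ),
      Measurable τ → IsStoppingTime F σ → (∀ᵐ ω ∂P, σ ω = τ (C ω, B ω)) →
      ∀ᵐ c ∂P.map C, ∀ s : ℝ,
        MeasurableSet[genFiltration P T (fun u ω => (B' ω).1 u.toNNReal) s]
          {ω | τ (c, B' ω) ≤ s} := by
    intro τ σ hτ hσ hστ
    have := ae_section_stopping hB hB' hC hind hmap hBM (T := T) hτ (p := fun _ => True)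
      MeasurableSet.univ fun q => ?_
    · simpa only [true_and] using this
    · refine EventuallyMeasurableSet.congr (hF q _ (hσ q)) ?_
      filter_upwards [hστ] with ω hω
      refine propext ?_
      change True ∧ _ ↔ σ ω ≤ q
      rw [hω, true_and]
  have ht1 : ∀ᵐ c ∂P.map C, ∀ j (s : ℝ),
      MeasurableSet[genFiltration P T (fun u ω => (B' ω).1 u.toNNReal) s]
        {ω | (S (c, B' ω)).time j ≤ s} :=
    ae_all_iff.2 fun j => hsec _ _ (hS.time j) (hv j).1 (hSe.mono fun ω hω => by rw [← hω]; rfl)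
  have ht2 : ∀ᵐ c ∂P.map C, ∀ k (s : ℝ),
      MeasurableSet[genFiltration P T (fun u ω => (B' ω).1 u.toNNReal) s]
        {ω | (S (c, B' ω)).initDone k ≤ s} :=
    ae_all_iff.2 fun k => hsec _ _ (hS.initDone k) (hi k) (hSe.mono fun ω hω => by rw [← hω]; rfl)
  have ht3 : ∀ᵐ c ∂P.map C, ∀ j (s : ℝ),
      MeasurableSet[genFiltration P T (fun u ω => (B' ω).1 u.toNNReal) s]
        {ω | (S (c, B' ω)).done j ≤ s} :=
    ae_all_iff.2 fun j => hsec _ _ (hS.done j) (hd j) (hSe.mono fun ω hω => by rw [← hω]; rfl)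
  have ht4 : ∀ᵐ c ∂P.map C, ∀ j b (s : ℝ),
      MeasurableSet[genFiltration P T (fun u ω => (B' ω).1 u.toNNReal) s]
        {ω | (S (c, B' ω)).req j = some b ∧ (S (c, B' ω)).time j ≤ s} := by
    refine ae_all_iff.2 fun j => ae_all_iff.2 fun b => ?_
    refine ae_section_stopping hB hB' hC hind hmap hBM (T := T) (hS.time j)
      (p := fun x => (S x).req j = some b) (hS.req j b) fun q => ?_
    obtain ⟨h1, h2⟩ := hv j
    refine EventuallyMeasurableSet.congr (hF q _ ((h2 b).2 q)) ?_
    filter_upwards [hSe] with ω hω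
    refine propext ?_
    change (S (C ω, B ω)).req j = some b ∧ (S (C ω, B ω)).time j ≤ q ↔ v.req j ω = some b ∧ v.time j ω ≤ q
    rw [← hω]
    rfl
  have hall := ht1.and (ht2.and (ht3.and (ht4.and (Measure.ae_ae_of_ae_prod hfeas))))
  -- Outside the null set of unsuitable `c`, some frozen control does no worse than the average; no
  -- measurable selection is needed.
  obtain ⟨c, hc, hle⟩ := exists_notMem_null_le_integral hΦi.integral_prod_left
    (ae_iff.1 hall)
  obtain ⟨hc1, hc2, hc3, hc4, hc5⟩ := not_not.1 hc
  rw [hmap] at hc5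
  have hfeas' := ae_of_ae_map hB'.aemeasurable hc5
  have hSc : MeasurableSchedule fun ω => S (c, B' ω) := hS.comp (measurable_const.prodMk hB')
  let v' : RControl M Ω :=
    { time := fun j ω => (S (c, B' ω)).time j
      req := fun j ω => (S (c, B' ω)).req j
      initDone := fun k ω => (S (c, B' ω)).initDone k
      done := fun j ω => (S (c, B' ω)).done j }
  refine ⟨v', nonAnticipating_of_forall hc1 hc4 hSc.req ?_, hc2, hc3, hfeas', ?_⟩
  · filter_upwards [hfeas'] with ω hω
    exact hω.adm.time_top
  · rw [hcost]
    have hm : Measurable fun b => Φ (S (c, b)) b := by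
      have := hΦm.comp (measurable_const.prodMk measurable_id : Measurable fun b : Path => (c, b))
      simpa only [Function.comp_def] using this
    refine le_trans (le_of_eq ?_) hle
    rw [hmap, integral_map hB'.aemeasurable hm.aestronglyMeasurable]
    rfl


/-! ### Ornstein–Uhlenbeck processes as functionals of the driving path -/

theorem continuous_ouPath {E : Type*} [NormedAddCommGroup E] [NormedSpace ℝ E]
    [CompleteSpace E] (γ t : ℝ) (z : E) {w : ℝ → E} (hw : Continuous w) :
    Continuous (ouPath γ t z w) := by
  -- Factoring the exponential out of the integral leaves `s` only in the upper limit.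
  have e : ouPath γ t z w = fun s => Real.exp (-γ * (s - t)) • z + (w s - w t)
      - γ • Real.exp (-γ * s) • ∫ u in t..s, Real.exp (γ * u) • (w u - w t) := by
    funext s
    have h1 : (∫ u in t..s, Real.exp (-γ * (s - u)) • (w u - w t))
        = Real.exp (-γ * s) • ∫ u in t..s, Real.exp (γ * u) • (w u - w t) := by
      rw [← intervalIntegral.integral_smul]
      refine intervalIntegral.integral_congr fun u _ => ?_
      simp only [smul_smul, ← Real.exp_add]
      congr 2
      ring
    rw [ouPath, h1]
  have hc : Continuous fun u => Real.exp (γ * u) • (w u - w t) := by fun_prop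
  have h : Continuous fun s => ∫ u in t..s, Real.exp (γ * u) • (w u - w t) :=
    intervalIntegral.continuous_primitive (fun _ _ => hc.intervalIntegrable _ _) t
  rw [e]
  fun_prop

theorem map_ouPath {E F : Type*} [NormedAddCommGroup E] [NormedSpace ℝ E] [CompleteSpace E]
    [NormedAddCommGroup F] [NormedSpace ℝ F] [CompleteSpace F] (L : E →L[ℝ] F) (γ t : ℝ) (z : E)
    {w : ℝ → E} (hw : Continuous w) (s : ℝ) :
    L (ouPath γ t z w s) = ouPath γ t (L z) (fun u => L (w u)) s := by
  unfold ouPath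
  rw [map_sub, map_add, map_smul, map_sub, map_smul, ← L.intervalIntegral_comp_comm
    (Continuous.intervalIntegrable (by fun_prop) _ _)]
  simp only [map_smul, map_sub]

/-- Deviation at time `s` of the mean reverting process that starts from zero at time `t` and is
driven by the path `b`. -/
noncomputable def pathDev (γ t : ℝ) (b : Path) (s : ℝ) : ℝ :=
  ouPath γ t 0 (fun u => b.1 u.toNNReal) s

theorem continuous_path_toNNReal (b : Path) : Continuous fun u : ℝ => b.1 u.toNNReal :=
  b.2.comp continuous_real_toNNReal

theorem continuous_pathDev (γ t : ℝ) (b : Path) : Continuous (pathDev γ t b) :=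
  continuous_ouPath γ t 0 (continuous_path_toNNReal b)

theorem ouPath_smul_path (γ t z v : ℝ) (b : Path) (s : ℝ) :
    ouPath γ t z (fun u => v * b.1 u.toNNReal) s
      = Real.exp (-γ * (s - t)) * z + v * pathDev γ t b s := by
  unfold pathDev ouPath
  simp only [smul_eq_mul, mul_zero, ← mul_sub, mul_left_comm _ v,
    intervalIntegral.integral_const_mul]
  ring

theorem measurable_path_toNNReal : Measurable fun p : Path × ℝ => p.1.1 p.2.toNNReal :=
  measurable_path_eval.comp (measurable_fst.prodMk (measurable_real_toNNReal.comp measurable_snd))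

theorem measurable_pathDev (γ t : ℝ) : Measurable fun p : Path × ℝ => pathDev γ t p.1 p.2 := by
  have e : (fun p : Path × ℝ => pathDev γ t p.1 p.2) = fun p =>
      (p.1.1 p.2.toNNReal - p.1.1 t.toNNReal) - γ * (Real.exp (-γ * p.2) *
        ∫ u in t..p.2, Real.exp (γ * u) * (p.1.1 u.toNNReal - p.1.1 t.toNNReal)) := by
    funext p
    have h1 : (∫ u in t..p.2, Real.exp (-γ * (p.2 - u)) * (p.1.1 u.toNNReal - p.1.1 t.toNNReal))
        = Real.exp (-γ * p.2) *
          ∫ u in t..p.2, Real.exp (γ * u) * (p.1.1 u.toNNReal - p.1.1 t.toNNReal) := by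
      rw [← intervalIntegral.integral_const_mul]
      refine intervalIntegral.integral_congr fun u _ => ?_
      simp only [← mul_assoc, ← Real.exp_add]
      congr 2
      ring
    simp only [pathDev, ouPath, smul_eq_mul, mul_zero, zero_add]
    rw [h1]
  have h1 : Measurable fun p : Path × ℝ => p.1.1 t.toNNReal :=
    measurable_path_toNNReal.comp (measurable_fst.prodMk measurable_const)
  have h2 : Measurable fun p : Path × ℝ =>
      ∫ u in t..p.2, Real.exp (γ * u) * (p.1.1 u.toNNReal - p.1.1 t.toNNReal) :=
    measurable_intervalIntegral
      (h := fun b u => Real.exp (γ * u) * (b.1 u.toNNReal - b.1 t.toNNReal))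
      ((by fun_prop : Measurable fun p : Path × ℝ => Real.exp (γ * p.2)).mul
        (measurable_path_toNNReal.sub h1)) t
  rw [e]
  have h3 : Measurable fun p : Path × ℝ => Real.exp (-γ * p.2) := by fun_prop
  exact (measurable_path_toNNReal.sub h1).sub ((h3.mul h2).const_mul γ)

theorem abs_pathDev_le {γ t s T : ℝ} (hγ : 0 ≤ γ) (hts : t ≤ s) (hsT : s ≤ T) (b : Path) :
    |pathDev γ t b s| ≤ |b.1 s.toNNReal| + |b.1 t.toNNReal|
      + γ * ∫ u in t..T, (|b.1 u.toNNReal| + |b.1 t.toNNReal|) := by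
  have hc : Continuous fun u : ℝ => |b.1 u.toNNReal| + |b.1 t.toNNReal| :=
    (continuous_path_toNNReal b).abs.add continuous_const
  have h1 : |∫ u in t..s, Real.exp (-γ * (s - u)) * (b.1 u.toNNReal - b.1 t.toNNReal)|
      ≤ ∫ u in t..s, (|b.1 u.toNNReal| + |b.1 t.toNNReal|) := by
    rw [← Real.norm_eq_abs]
    refine intervalIntegral.norm_integral_le_of_norm_le hts (Eventually.of_forall fun u hu => ?_)
      (hc.intervalIntegrable (μ := volume) _ _)
    rw [Real.norm_eq_abs, abs_mul, Real.abs_exp]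
    have h2 : Real.exp (-γ * (s - u)) ≤ 1 := by
      rw [Real.exp_le_one_iff]
      nlinarith [hu.2]
    calc _ ≤ 1 * |b.1 u.toNNReal - b.1 t.toNNReal| :=
          mul_le_mul_of_nonneg_right h2 (abs_nonneg _)
      _ ≤ _ := by rw [one_mul]; exact abs_sub _ _
  have h2 : ∫ u in t..s, (|b.1 u.toNNReal| + |b.1 t.toNNReal|)
      ≤ ∫ u in t..T, (|b.1 u.toNNReal| + |b.1 t.toNNReal|) :=
    intervalIntegral.integral_mono_interval le_rfl hts hsT
      (Eventually.of_forall fun u => by positivity)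
      (hc.intervalIntegrable _ _)
  unfold pathDev ouPath
  simp only [smul_eq_mul, mul_zero, zero_add]
  refine (abs_sub _ _).trans (add_le_add (abs_sub _ _) ?_)
  rw [abs_mul, abs_of_nonneg hγ]
  exact mul_le_mul_of_nonneg_left (h1.trans h2) hγ

variable {Ω : Type*} [mΩ : MeasurableSpace Ω] {P : Measure Ω}

theorem integrable_prod_path [IsProbabilityMeasure P] {β : Ω → Path} (hβ : Measurable β)
    (hBM : IsPreBrownianReal (fun s ω => (β ω).1 s) P) (t T : ℝ) :
    Integrable (fun p : Ω × ℝ => (β p.1).1 p.2.toNNReal)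
      (P.prod (volume.restrict (Ioc t T))) := by
  have hm : Measurable fun p : Ω × ℝ => (β p.1).1 p.2.toNNReal :=
    measurable_path_toNNReal.comp ((hβ.comp measurable_fst).prodMk measurable_snd)
  rw [integrable_prod_iff' hm.aestronglyMeasurable]
  refine ⟨Eventually.of_forall fun s => hBM.integrable_eval s.toNNReal, ?_⟩
  have hi : Integrable (fun s : ℝ => 1 + |s|) (volume.restrict (Ioc t T)) :=
    ((by fun_prop : Continuous fun s : ℝ => 1 + |s|).integrableOn_Icc (a := t) (b := T)).mono_set
      Ioc_subset_Icc_self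
  refine hi.mono' (hm.aestronglyMeasurable.norm.prod_swap.integral_prod_right') ?_
  refine Eventually.of_forall fun s => ?_
  rw [Real.norm_eq_abs, abs_of_nonneg (integral_nonneg fun _ => norm_nonneg _)]
  have hLp : MemLp (fun ω => (β ω).1 s.toNNReal) 2 P :=
    (hBM.isGaussianProcess.hasGaussianLaw_eval _).memLp_two
  have hsq : ∫ ω, (β ω).1 s.toNNReal ^ 2 ∂P = s.toNNReal := by
    rw [← variance_of_integral_eq_zero hLp.aemeasurable (hBM.integral_eval _),
      ← covariance_self hLp.aemeasurable, hBM.covariance_fun_eval, min_self]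
  -- The first moment is bounded through `|y| ≤ 1 + y ^ 2` and the variance `s`, which is integrable
  -- over the period.
  calc ∫ ω, ‖(β ω).1 s.toNNReal‖ ∂P ≤ ∫ ω, (1 + (β ω).1 s.toNNReal ^ 2) ∂P := by
        refine integral_mono (hBM.integrable_eval _).norm
          ((integrable_const _).add hLp.integrable_sq) fun ω => ?_
        simp only [Real.norm_eq_abs]
        rw [← sq_abs]
        nlinarith [sq_nonneg (|(β ω).1 s.toNNReal| - 1)]
    _ = 1 + (s.toNNReal : ℝ) := by
        rw [integral_add (integrable_const _) hLp.integrable_sq, hsq]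
        simp
    _ ≤ 1 + |s| := by
        rw [Real.coe_toNNReal']
        exact add_le_add_right (max_le (le_abs_self _) (abs_nonneg _)) _

theorem integrable_prod_pathDev [IsProbabilityMeasure P] {β : Ω → Path} (hβ : Measurable β)
    (hBM : IsPreBrownianReal (fun s ω => (β ω).1 s) P) {γ : ℝ} (hγ : 0 ≤ γ) {t T : ℝ}
    (htT : t ≤ T) :
    Integrable (fun p : Ω × ℝ => pathDev γ t (β p.1) p.2)
      (P.prod (volume.restrict (Ioc t T))) := by
  have h1 := (integrable_prod_path hβ hBM t T).norm
  have h2 : Integrable (fun p : Ω × ℝ => |(β p.1).1 t.toNNReal|)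
      (P.prod (volume.restrict (Ioc t T))) :=
    (hBM.integrable_eval t.toNNReal).norm.comp_fst _
  have h3 : Integrable (fun p : Ω × ℝ =>
      ∫ u in t..T, (|(β p.1).1 u.toNNReal| + |(β p.1).1 t.toNNReal|))
      (P.prod (volume.restrict (Ioc t T))) := by
    have := (h1.add h2).integral_prod_left.comp_fst (volume.restrict (Ioc t T))
    simpa only [intervalIntegral.integral_of_le htT, Pi.add_apply, Real.norm_eq_abs] using this
  refine ((h1.add h2).add (h3.const_mul γ)).mono' ((measurable_pathDev γ t).comp
    ((hβ.comp measurable_fst).prodMk measurable_snd)).aestronglyMeasurable ?_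
  have : ∀ᵐ p : Ω × ℝ ∂P.prod (volume.restrict (Ioc t T)), p.2 ∈ Ioc t T :=
    Measure.quasiMeasurePreserving_snd.ae (ae_restrict_mem measurableSet_Ioc)
  filter_upwards [this] with p hp
  exact abs_pathDev_le hγ hp.1.le hp.2 _

theorem integrable_integral_abs_pathDev [IsProbabilityMeasure P] {β : Ω → Path}
    (hβ : Measurable β) (hBM : IsPreBrownianReal (fun s ω => (β ω).1 s) P) {γ : ℝ} (hγ : 0 ≤ γ)
    {t T : ℝ} (htT : t ≤ T) :
    Integrable (fun ω => ∫ s in t..T, |pathDev γ t (β ω) s|) P := by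
  have := (integrable_prod_pathDev hβ hBM hγ htT).norm.integral_prod_left
  simpa only [intervalIntegral.integral_of_le htT, Pi.add_apply, Real.norm_eq_abs] using this

theorem measurable_integral_abs_pathDev (γ t T : ℝ) :
    Measurable fun b : Path => ∫ s in t..T, |pathDev γ t b s| := by
  have h := measurable_intervalIntegral (h := fun b s => |pathDev γ t b s|)
    ((measurable_pathDev γ t).abs) t
  exact h.comp (measurable_id.prodMk measurable_const)


variable {nG nL nc N : ℕ} {M : Model nG nL nc}

/-! ### Costs of the lower bound problem as functionals of the schedule and the driving path -/

variable (M) in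
/-- Running cost of a schedule at time `s`; the demand is the sum of `A` and a multiple of the mean
reverting process driven by the path `b`. -/
noncomputable def rateLB (η : Fin nL → ℝ) (g : Fin N → Fin nG → ℝ) (A : ℝ → Fin nL → ℝ) (t : ℝ)
    (a : M.Mode) (w : ℝ) (S : M.Schedule) (b : Path) (s : ℝ) : ℝ :=
  runCost₂ M η g (η ⬝ᵥ A s + volLB M η * pathDev M.γ t b s) (S.mode a s) (S.totProg t a w s)

open Classical in
variable (M) in
/-- Total cost of a schedule in the lower bound problem. -/
noncomputable def costLB (η : Fin nL → ℝ) (g : Fin N → Fin nG → ℝ) (A : ℝ → Fin nL → ℝ) (t : ℝ)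
    (a : M.Mode) (w : ℝ) (S : M.Schedule) (b : Path) : ℝ :=
  (∫ s in t..M.T, rateLB M η g A t a w S b s)
    + ∑' j, if t < S.time j ∧ S.time j ≤ M.T then S.reqCost j else 0

theorem continuous_dotProduct_comp {X : Type*} [TopologicalSpace X] {n : ℕ} (η : Fin n → ℝ)
    {A : X → Fin n → ℝ} (hA : Continuous A) : Continuous fun s => η ⬝ᵥ A s := by
  simp only [dotProduct]
  fun_prop

section Measurability

variable [Nonempty (Fin nL)] {X : Type*} [MeasurableSpace X] {S : X → M.Schedule}
  {β : X → Path} {η : Fin nL → ℝ} {A : ℝ → Fin nL → ℝ} {t : ℝ}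

theorem measurable_rateLB (hM : M.Valid) (hη : ∀ k, 0 < η k) (g : Fin N → Fin nG → ℝ)
    (hA : Continuous A) (hS : MeasurableSchedule S)
    (hfin : ∀ x, {j | (S x).time j ≠ ⊤}.Finite) (hβ : Measurable β) (a : M.Mode) (w : ℝ) :
    Measurable fun p : X × ℝ => rateLB M η g A t a w (S p.1) (β p.1) p.2 := by
  have h1 : Measurable fun p : X × ℝ =>
      η ⬝ᵥ A p.2 + volLB M η * pathDev M.γ t (β p.1) p.2 :=
    ((continuous_dotProduct_comp η hA).measurable.comp measurable_snd).add
      (((measurable_pathDev M.γ t).comp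
        ((hβ.comp measurable_fst).prodMk measurable_snd)).const_mul _)
  exact hS.mode_comp hfin a (g := fun α p => runCost₂ M η g
    (η ⬝ᵥ A p.2 + volLB M η * pathDev M.γ t (β p.1) p.2) α ((S p.1).totProg t a w p.2))
    fun α => (measurable_runCost₂ hM hη g α).comp (h1.prodMk (hS.totProg hfin hM t a w))

omit [Nonempty (Fin nL)] in
theorem MeasurableSchedule.measurable_tsum_reqCost (hM : M.Valid) (hS : MeasurableSchedule S)
    (p : WithTop ℝ → Prop) [DecidablePred p] (hp : MeasurableSet {τ | p τ}) :
    Measurable fun x => ∑' j, if p ((S x).time j) then (S x).reqCost j else 0 := by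
  refine measurable_tsum_of_nonneg (fun j => ?_) fun j x => ?_
  · exact Measurable.ite (hS.time j hp) (hS.reqCost j) measurable_const
  · split_ifs
    · exact Model.Schedule.reqCost_nonneg hM j
    · exact le_rfl

theorem measurable_costLB (hM : M.Valid) (hη : ∀ k, 0 < η k) (g : Fin N → Fin nG → ℝ)
    (hA : Continuous A) (hS : MeasurableSchedule S)
    (hfin : ∀ x, {j | (S x).time j ≠ ⊤}.Finite) (hβ : Measurable β) (a : M.Mode) (w : ℝ) :
    Measurable fun x => costLB M η g A t a w (S x) (β x) := by
  classical
  have h1 := measurable_intervalIntegral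
    (h := fun x s => rateLB M η g A t a w (S x) (β x) s)
    (measurable_rateLB hM hη g hA hS hfin hβ a w) t
  have h2 : Measurable fun x => ∫ s in t..M.T, rateLB M η g A t a w (S x) (β x) s :=
    h1.comp (measurable_id.prodMk measurable_const)
  refine h2.add ?_
  convert! hS.measurable_tsum_reqCost hM (fun τ => (t : WithTop ℝ) < τ ∧ τ ≤ M.T)
    (measurableSet_Ioc (a := (t : WithTop ℝ)) (b := (M.T : WithTop ℝ)))

end Measurability

section Bounds

variable {S : M.Schedule} {b : Path} {η : Fin nL → ℝ} {A : ℝ → Fin nL → ℝ}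
  {t : ℝ} {a : M.Mode} {w : ℝ}

/-- The bound is uniform over schedules. Sums over the finitely many switches serve as crude maxima
of cost and of cost per unit of duration. -/
theorem exists_sum_reqCost_le (hM : M.Valid) (ht : t ≤ M.T) (a : M.Mode) (w : ℝ) :
    ∃ K, 0 ≤ K ∧ ∀ S : M.Schedule, ∀ h : S.Feasible t a w,
      ∑ j ∈ h.adm.requests, S.reqCost j ≤ K := by
  classical
  have : ∀ k, Fintype (M.allowed k) := fun k => Fintype.ofFinite _
  set K : ℝ := ∑ b : M.Request, M.swCost b.1 b.2 with hK
  set κ : ℝ := ∑ b : M.Request, M.swCost b.1 b.2 / M.delay b.1 b.2 with hκ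
  have hc : ∀ b : M.Request, 0 ≤ M.swCost b.1 b.2 := fun b => hM.swCost_nonneg _ _
  have hq : ∀ b : M.Request, 0 ≤ M.swCost b.1 b.2 / M.delay b.1 b.2 := fun b =>
    div_nonneg (hc b) (hM.delay_pos _ _).le
  have hK0 : 0 ≤ K := Finset.sum_nonneg fun b _ => hc b
  have hκ0 : 0 ≤ κ := Finset.sum_nonneg fun b _ => hq b
  refine ⟨max 0 (κ * (w + nG * (M.T - t)) + nG * K), le_max_left _ _, fun S h => ?_⟩
  refine (h.adm.sum_reqCost_le hM h.time_le_done ht (h.totProg_mem _ ⟨ht, le_rfl⟩).1 hκ0 hK0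
    (fun b => ?_) fun b => ?_).trans (le_max_right _ _)
  · rw [← div_le_iff₀ (hM.delay_pos _ _)]
    exact Finset.single_le_sum (f := fun b : M.Request => M.swCost b.1 b.2 / M.delay b.1 b.2)
      (fun b _ => hq b) (Finset.mem_univ b)
  · exact Finset.single_le_sum (f := fun b : M.Request => M.swCost b.1 b.2)
      (fun b _ => hc b) (Finset.mem_univ b)

theorem tsum_ite_reqCost (hS : S.Admissible t a) (p : WithTop ℝ → Prop) [DecidablePred p] :
    ∑' j, (if p (S.time j) then S.reqCost j else 0)
      = ∑ j ∈ hS.requests, if p (S.time j) then S.reqCost j else 0 :=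
  hS.tsum_eq fun j hj => by rw [Model.Schedule.reqCost_of_none hj, ite_self]

theorem tsum_ite_reqCost_mem (hM : M.Valid) (hS : S.Admissible t a) (p : WithTop ℝ → Prop)
    [DecidablePred p] :
    0 ≤ ∑' j, (if p (S.time j) then S.reqCost j else 0) ∧
      ∑' j, (if p (S.time j) then S.reqCost j else 0) ≤ ∑ j ∈ hS.requests, S.reqCost j := by
  rw [tsum_ite_reqCost hS]
  have h0 : ∀ j, 0 ≤ S.reqCost j := Model.Schedule.reqCost_nonneg hM
  constructor
  · exact Finset.sum_nonneg fun j _ => by split_ifs; exacts [h0 j, le_rfl]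
  · exact Finset.sum_le_sum fun j _ => by split_ifs; exacts [le_rfl, h0 j]

variable [Nonempty (Fin nL)]

theorem measurable_rateLB_time (hM : M.Valid) (hη : ∀ k, 0 < η k) (g : Fin N → Fin nG → ℝ)
    (hA : Continuous A) (hfin : {j | S.time j ≠ ⊤}.Finite) (b : Path) (t : ℝ) (a : M.Mode)
    (w : ℝ) : Measurable (rateLB M η g A t a w S b) := by
  have hS : MeasurableSchedule fun _ : Unit => S :=
    ⟨fun _ => measurable_const, fun _ _ => .const _, fun _ => measurable_const,
      fun _ => measurable_const⟩
  have h0 : Measurable fun p : Unit × ℝ => rateLB M η g A t a w S b p.2 :=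
    measurable_rateLB hM hη g hA hS (fun _ => hfin) (β := fun _ => b) measurable_const a w
  have h1 : Measurable fun s : ℝ => ((), s) := measurable_prodMk_left
  simpa only [Function.comp_def] using h0.comp h1

theorem intervalIntegrable_rateLB (hM : M.Valid) (hη : ∀ k, 0 < η k) (g : Fin N → Fin nG → ℝ)
    (hA : Continuous A) (hfin : {j | S.time j ≠ ⊤}.Finite) (b : Path) (t : ℝ) (a : M.Mode)
    (w s s' : ℝ) : IntervalIntegrable (rateLB M η g A t a w S b) volume s s' := by
  obtain ⟨C, hC, h⟩ := abs_runCost₂_le hM hη g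
  have hc : Continuous fun s => C * (1 + |η ⬝ᵥ A s + volLB M η * pathDev M.γ t b s|) := by
    have h1 := continuous_dotProduct_comp η hA
    have h2 := continuous_pathDev M.γ t b
    fun_prop
  refine (hc.intervalIntegrable s s').mono_fun'
    (measurable_rateLB_time hM hη g hA hfin b t a w).aestronglyMeasurable ?_
  exact Eventually.of_forall fun u => h _ _ _

/-- The majorant depends on the driving path only, so it is integrable and serves all controls
simultaneously. -/
theorem exists_abs_costLB_le (hM : M.Valid) (hη : ∀ k, 0 < η k) (g : Fin N → Fin nG → ℝ)
    (hA : Continuous A) (ht : t ≤ M.T) (a : M.Mode) (w : ℝ) :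
    ∃ C₁ C₂, 0 ≤ C₁ ∧ 0 ≤ C₂ ∧ ∀ S b, S.Feasible t a w →
      |costLB M η g A t a w S b| ≤ C₁ + C₂ * ∫ s in t..M.T, |pathDev M.γ t b s| := by
  classical
  obtain ⟨C, hC, h⟩ := abs_runCost₂_le hM hη g
  obtain ⟨K, hK, hKS⟩ := exists_sum_reqCost_le hM ht a w
  have hc1 : Continuous fun s => C * (1 + |η ⬝ᵥ A s|) := by
    have h1 := continuous_dotProduct_comp η hA
    fun_prop
  refine ⟨(∫ s in t..M.T, C * (1 + |η ⬝ᵥ A s|)) + K, C * |volLB M η|, ?_, by positivity,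
    fun S b hS => ?_⟩
  · refine add_nonneg (intervalIntegral.integral_nonneg ht fun s _ => by positivity) hK
  · have hc2 : Continuous fun s => |pathDev M.γ t b s| := (continuous_pathDev M.γ t b).abs
    have h1 : |∫ s in t..M.T, rateLB M η g A t a w S b s|
        ≤ ∫ s in t..M.T, (C * (1 + |η ⬝ᵥ A s|) + C * |volLB M η| * |pathDev M.γ t b s|) := by
      rw [← Real.norm_eq_abs]
      refine intervalIntegral.norm_integral_le_of_norm_le ht (Eventually.of_forall fun s _ => ?_)
        ((hc1.add (hc2.const_mul _)).intervalIntegrable _ _)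
      refine (h _ _ _).trans ?_
      have h2 := abs_add_le (η ⬝ᵥ A s) (volLB M η * pathDev M.γ t b s)
      rw [abs_mul] at h2
      calc C * (1 + |η ⬝ᵥ A s + volLB M η * pathDev M.γ t b s|)
          ≤ C * (1 + (|η ⬝ᵥ A s| + |volLB M η| * |pathDev M.γ t b s|)) := by gcongr
        _ = _ := by ring
    rw [intervalIntegral.integral_add (hc1.intervalIntegrable _ _)
      ((hc2.const_mul _).intervalIntegrable _ _), intervalIntegral.integral_const_mul (C * |volLB M η|)] at h1
    have h2 := tsum_ite_reqCost_mem hM hS.adm fun τ => (t : WithTop ℝ) < τ ∧ τ ≤ M.T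
    have h3 := hKS S hS
    have h4 : |costLB M η g A t a w S b| ≤ |∫ s in t..M.T, rateLB M η g A t a w S b s|
        + |∑' j, (if (t : WithTop ℝ) < S.time j ∧ S.time j ≤ M.T then S.reqCost j else 0)| := by
      unfold costLB
      refine (abs_add_le _ _).trans_eq ?_
      congr!
    rw [abs_of_nonneg h2.1] at h4
    linarith [h2.2]

/-- The switching costs do not depend on the weights and cancel, leaving the difference of the
running costs along the same path. -/
theorem abs_costLB_sub_le (hM : M.Valid) {η' : Fin nL → ℝ} (hη : ∀ k, 0 < η k)
    (hη' : ∀ k, 0 < η' k) {g g' : Fin N → Fin nG → ℝ}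
    (hA : Continuous A) (ht : t ≤ M.T) {ε : ℝ}
    (h : ∀ s ∈ Icc t M.T, ∀ d a w, |runCost₂ M η g (η ⬝ᵥ A s + volLB M η * d) a w
      - runCost₂ M η' g' (η' ⬝ᵥ A s + volLB M η' * d) a w| ≤ ε * (1 + |d|))
    (hfin : {j | S.time j ≠ ⊤}.Finite) (b : Path) :
    |costLB M η g A t a w S b - costLB M η' g' A t a w S b|
      ≤ ε * ((M.T - t) + ∫ s in t..M.T, |pathDev M.γ t b s|) := by
  have hc2 : Continuous fun s => |pathDev M.γ t b s| := (continuous_pathDev M.γ t b).abs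
  unfold costLB
  rw [add_sub_add_right_eq_sub, ← intervalIntegral.integral_sub
    (intervalIntegrable_rateLB hM hη g hA hfin b t a w _ _)
    (intervalIntegrable_rateLB hM hη' g' hA hfin b t a w _ _), ← Real.norm_eq_abs]
  have h1 : ∫ s in t..M.T, ε * (1 + |pathDev M.γ t b s|)
      = ε * ((M.T - t) + ∫ s in t..M.T, |pathDev M.γ t b s|) := by
    rw [intervalIntegral.integral_const_mul, intervalIntegral.integral_add
      intervalIntegrable_const (hc2.intervalIntegrable _ _)]
    simp
  rw [← h1]
  refine intervalIntegral.norm_integral_le_of_norm_le ht (Eventually.of_forall fun s hs => ?_)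
    ((continuous_const.mul (continuous_const.add hc2)).intervalIntegrable _ _)
  exact h s ⟨hs.1.le, hs.2⟩ _ _ _

end Bounds


variable {nG nL nc N : ℕ} {M : Model nG nL nc} {Ω : Type*} [MeasurableSpace Ω] {P : Measure Ω}
  {W : ℝ≥0 → Ω → Fin nL → ℝ}

/-! ### The driving Brownian motion of the weighted demand -/

theorem volLB_pos (hM : M.Valid) {η : Fin nL → ℝ} (hη : η ≠ 0) : 0 < volLB M η := by
  refine norm_pos_iff.2 fun h => hη ?_
  have h1 : η ᵥ* M.σ = 0 := by simpa using h
  exact Matrix.eq_zero_of_vecMul_eq_zero hM.σ_nonsing.ne_zero h1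

variable (M) in
/-- Unit vector in the direction of the noise of the weighted demand. -/
noncomputable def noiseDir (η : Fin nL → ℝ) : Fin nL → ℝ := (volLB M η)⁻¹ • (η ᵥ* M.σ)

theorem noiseDir_dotProduct_self (hM : M.Valid) {η : Fin nL → ℝ} (hη : η ≠ 0) :
    noiseDir M η ⬝ᵥ noiseDir M η = 1 := by
  have h1 := volLB_pos hM hη
  have h2 : (η ᵥ* M.σ) ⬝ᵥ (η ᵥ* M.σ) = volLB M η ^ 2 := by
    rw [volLB, EuclideanSpace.norm_sq_eq]
    simp [dotProduct, sq]
  rw [noiseDir, smul_dotProduct, dotProduct_smul, h2, smul_eq_mul, smul_eq_mul]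
  field_simp

theorem noiseDir_dotProduct (η y : Fin nL → ℝ) :
    noiseDir M η ⬝ᵥ y = (volLB M η)⁻¹ * (η ⬝ᵥ (M.σ *ᵥ y)) := by
  rw [noiseDir, smul_dotProduct, smul_eq_mul, Matrix.dotProduct_mulVec]

variable (M) in
/-- Path of the Brownian motion that drives the weighted demand. -/
noncomputable def brownPath (hWc : ∀ ω, Continuous fun s => W s ω) (η : Fin nL → ℝ) (ω : Ω) : Path :=
  ⟨fun s => noiseDir M η ⬝ᵥ W s ω, continuous_dotProduct_comp _ (hWc ω)⟩

variable {hWc : ∀ ω, Continuous fun s => W s ω}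

omit [MeasurableSpace Ω] in
theorem brownLB_eq (hWc : ∀ ω, Continuous fun s => W s ω) (η : Fin nL → ℝ) :
    brownLB M η W = fun u ω => (brownPath M hWc η ω).1 u.toNNReal := by
  funext u ω
  exact (noiseDir_dotProduct η _).symm

theorem measurable_brownPath (hW : IsBrownianVec W P) (η : Fin nL → ℝ) :
    Measurable (brownPath M hWc η) :=
  Measurable.subtype_mk (measurable_pi_iff.2 fun s => hW.measurable_dotProduct _ s)

theorem isPreBrownianReal_brownPath [IsProbabilityMeasure P] (hM : M.Valid)
    (hW : IsBrownianVec W P) {η : Fin nL → ℝ} (hη : η ≠ 0) :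
    IsPreBrownianReal (fun s ω => (brownPath M hWc η ω).1 s) P :=
  hW.isPreBrownianReal_dotProduct (noiseDir_dotProduct_self hM hη)

variable (M) in
/-- Mean demand at time `s`, started from `x` at time `t`. -/
noncomputable def meanDemand (t : ℝ) (x : Fin nL → ℝ) (s : ℝ) : Fin nL → ℝ :=
  M.m (max 0 (min M.T s)) + Real.exp (-M.γ * (s - t)) • (x - M.m t)

theorem meanDemand_eq {t s : ℝ} (hs : s ∈ Icc 0 M.T) (x : Fin nL → ℝ) :
    meanDemand M t x s = M.m s + Real.exp (-M.γ * (s - t)) • (x - M.m t) := by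
  rw [meanDemand, min_eq_right hs.2, max_eq_right hs.1]

/-- The forecast is regular on `[0, T]` only; clamping the time to this interval gives continuity on
the whole line. -/
theorem continuous_meanDemand (hM : M.Valid) (hT : 0 ≤ M.T) (t : ℝ) (x : Fin nL → ℝ) :
    Continuous (meanDemand M t x) := by
  unfold meanDemand
  have h : Continuous fun s => M.m (max 0 (min M.T s)) :=
    hM.m_smooth.continuousOn.comp_continuous (by fun_prop)
      fun s => ⟨le_max_left _ _, max_le hT (min_le_left _ _)⟩
  fun_prop

omit [MeasurableSpace Ω] in
theorem demandLB_eq (hWc : ∀ ω, Continuous fun s => W s ω) {t s : ℝ}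
    (hs : s ∈ Icc 0 M.T) (η x : Fin nL → ℝ) (ω : Ω) :
    demandLB M η W t (η ⬝ᵥ x) s ω
      = η ⬝ᵥ meanDemand M t x s + volLB M η * pathDev M.γ t (brownPath M hWc η ω) s := by
  rw [demandLB, brownLB_eq hWc, ouPath_smul_path, meanDemand_eq hs, dotProduct_add,
    dotProduct_smul, dotProduct_sub, smul_eq_mul]
  ring

-- The variation of constants formula commutes with continuous linear functionals, and the
-- volatility cancels the normalisation in `brownLB`.
omit [MeasurableSpace Ω] in
theorem dotProduct_demand (hM : M.Valid) (hWc : ∀ ω, Continuous fun s => W s ω) (t s : ℝ)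
    {η : Fin nL → ℝ} (hη : η ≠ 0) (x : Fin nL → ℝ) (ω : Ω) :
    η ⬝ᵥ demand M W t x s ω = demandLB M η W t (η ⬝ᵥ x) s ω := by
  set L : (Fin nL → ℝ) →L[ℝ] ℝ := LinearMap.toContinuousLinearMap
    (Matrix.toLin' (Matrix.of fun (_ : Unit) k => η k)) |> fun f =>
      (ContinuousLinearMap.proj (R := ℝ) (φ := fun _ : Unit => ℝ) ()).comp f with hL
  have hLa : ∀ y, L y = η ⬝ᵥ y := fun y => by
    simp [hL, Matrix.mulVec, dotProduct]
  have hc : Continuous fun u => noise M W u ω := by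
    unfold noise
    exact (continuous_const.matrix_mulVec ((hWc ω).comp continuous_real_toNNReal))
  rw [demand, demandLB, dotProduct_add, ← hLa (ouPath _ _ _ _ _), map_ouPath L _ _ _ hc]
  simp only [hLa, dotProduct_sub]
  congr 3
  funext u
  rw [brownLB, ← mul_assoc, mul_inv_cancel₀ (volLB_pos hM hη).ne', one_mul]
  rfl

-- A coordinate of the demand is the weighted demand for a unit coordinate vector; the
-- representation needs `η ≠ 0` only, not positivity.
omit [MeasurableSpace Ω] in
theorem demand_apply (hM : M.Valid) (hWc : ∀ ω, Continuous fun s => W s ω) {t s : ℝ}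
    (hs : s ∈ Icc 0 M.T) (x : Fin nL → ℝ) (ω : Ω) (k : Fin nL) :
    demand M W t x s ω k = meanDemand M t x s k + volLB M (Pi.single k 1) *
      pathDev M.γ t (brownPath M hWc (Pi.single k 1) ω) s := by
  have h0 : (Pi.single k 1 : Fin nL → ℝ) ≠ 0 := by simp
  have h := (dotProduct_demand hM hWc t s h0 x ω).trans (demandLB_eq hWc hs _ x ω)
  simpa only [single_dotProduct, one_mul] using h

/-! ### Controls of the lower bound problem -/

theorem mem_controlsLB_iff {η : Fin nL → ℝ} {t : ℝ} {a : M.Mode} {w : ℝ} {v : RControl M Ω} :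
    v ∈ controlsLB M P η W t a w ↔
      v.NonAnticipating (genFiltration P M.T (brownLB M η W)) ∧
      (∀ k, IsStoppingTime (genFiltration P M.T (brownLB M η W)) (v.initDone k)) ∧
      (∀ j, IsStoppingTime (genFiltration P M.T (brownLB M η W)) (v.done j)) ∧
      ∀ᵐ ω ∂P, (v.schedule ω).Feasible t a w := by
  refine and_congr_right fun _ => and_congr_right fun _ => and_congr_right fun _ => ?_
  refine eventually_congr (Eventually.of_forall fun ω => ?_)
  exact ⟨fun h => ⟨h.1, h.2.1, h.2.2.1, h.2.2.2⟩, fun h => ⟨h.1, h.2, h.3, h.4⟩⟩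

theorem costToGoLB_eq (hWc : ∀ ω, Continuous fun s => W s ω) {t : ℝ}
    (ht : t ∈ Icc 0 M.T) (η x : Fin nL → ℝ) (g : Fin N → Fin nG → ℝ) (a : M.Mode) (w : ℝ)
    (v : RControl M Ω) :
    costToGoLB M P η g W t (η ⬝ᵥ x) a w v
      = ∫ ω, costLB M η g (meanDemand M t x) t a w (v.schedule ω) (brownPath M hWc η ω) ∂P := by
  unfold costToGoLB costLB
  refine integral_congr_ae (Eventually.of_forall fun ω => ?_)
  refine congrArg₂ (· + ·) (intervalIntegral.integral_congr fun s hs => ?_) rfl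
  rw [uIcc_of_le ht.2] at hs
  simp only [rateLB]
  rw [demandLB_eq hWc ⟨ht.1.trans hs.1, hs.2⟩]

/-- The schedule without requests. -/
theorem feasible_of_no_request (hM : M.Valid) {t : ℝ} {a : M.Mode} {r : Fin nG → ℝ}
    (hr : r ∈ M.progSet a) {S : M.Schedule} (ht : ∀ j, S.time j = ⊤) (hq : ∀ j, S.req j = none)
    (hS : S.IsExact t a r) : S.Feasible t a (∑ k, r k) := by
  have hadm : S.Admissible t a :=
    { time_mem := fun j => Or.inl (ht j)
      time_mono := fun i j _ => by rw [ht, ht]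
      time_top := fun j => by simp [ht, hq]
      finite := by simp [ht]
      time_strict := fun k i j _ h => by simp [Model.Schedule.reqOf, hq] at h
      mode_before := fun j k e h => by simp [hq] at h }
  exact ⟨hadm, hS.le_initDone hr, hS.time_le_done hM, fun s hs => hadm.totProg_mem hM hS hr hs.1⟩

theorem controlsLB_nonempty [IsProbabilityMeasure P] (hM : M.Valid) (η : Fin nL → ℝ) (t : ℝ)
    {a : M.Mode} {r : Fin nG → ℝ} (hr : r ∈ M.progSet a) :
    (controlsLB M P η W t a (∑ k, r k)).Nonempty := by
  refine ⟨⟨⟨fun _ _ => ⊤, fun _ _ => none⟩,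
    fun k _ => ((t - r k + Model.genDelay (a k) : ℝ) : WithTop ℝ), fun _ _ => ⊤⟩,
    mem_controlsLB_iff.2 ⟨?_, fun k => isStoppingTime_const _ _, fun j s => ?_,
      Eventually.of_forall fun ω => feasible_of_no_request hM hr (fun _ => rfl) (fun _ => rfl)
        ⟨fun j => rfl, fun k => rfl⟩⟩⟩
  · refine nonAnticipating_of_forall (fun j s => ?_) (fun j b s => ?_) (fun j b => ?_) ?_
    · simp
    · simp
    · simp
    · simp
  · simp


variable {nG nL nc N : ℕ} {M : Model nG nL nc} {Ω : Type*} [mΩ : MeasurableSpace Ω]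
  {P : Measure Ω} {W : ℝ≥0 → Ω → Fin nL → ℝ} {t : ℝ} {a : M.Mode} {w : ℝ}

/-! ### Expected costs of the lower bound problem -/

theorem integrable_costLB [IsProbabilityMeasure P] [Nonempty (Fin nL)] (hM : M.Valid)
    {η : Fin nL → ℝ} (hη : ∀ k, 0 < η k) (g : Fin N → Fin nG → ℝ) {A : ℝ → Fin nL → ℝ}
    (hA : Continuous A) (ht : t ≤ M.T) {S S' : Ω → M.Schedule} (hS' : MeasurableSchedule S')
    (hfin : ∀ ω, {j | (S' ω).time j ≠ ⊤}.Finite) (hSe : ∀ᵐ ω ∂P, S ω = S' ω)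
    (hf : ∀ᵐ ω ∂P, (S ω).Feasible t a w) {β : Ω → Path} (hβ : Measurable β)
    (hBM : IsPreBrownianReal (fun s ω => (β ω).1 s) P) :
    Integrable (fun ω => costLB M η g A t a w (S ω) (β ω)) P := by
  obtain ⟨C₁, C₂, -, -, h⟩ := exists_abs_costLB_le hM hη g hA ht a w
  have hm : Measurable fun ω => costLB M η g A t a w (S' ω) (β ω) :=
    measurable_costLB hM hη g hA hS' hfin hβ a w
  refine ((integrable_const C₁).add ((integrable_integral_abs_pathDev hβ hBM hM.γ_nonneg
    ht).const_mul C₂)).mono' (hm.aestronglyMeasurable.congr ?_) ?_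
  · filter_upwards [hSe] with ω hω
    rw [hω]
  · filter_upwards [hf] with ω hω
    exact h _ _ hω

theorem genFiltration_le_pairAt {n : ℕ} (B : Ω → Path) (C : Ω → Fin n × ℝ≥0 → ℝ) (T s : ℝ) :
    genFiltration P T (fun u ω => (B ω).1 u.toNNReal) s ≤ eventuallyMeasurableSpace
      (pastSpace T (fun u ω => pairAt n u (C ω, B ω)) s) (ae P) := by
  refine fun A hA => eventuallyMeasurableSpace_le_of_le (le_trans ?_
    le_eventuallyMeasurableSpace) _ (measurableSet_genFiltration.1 hA).1
  refine pastSpace_le fun u h0 hs hT => ?_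
  exact measurable_snd.comp
    (measurable_pastSpace (Y := fun u ω => pairAt n u (C ω, B ω)) h0 hs hT)

theorem indepFun_const_left [IsProbabilityMeasure P] {E F : Type*} [MeasurableSpace E]
    [MeasurableSpace F] (c : E) {X : Ω → F} : IndepFun (fun _ => c) X P := by
  rw [IndepFun_iff]
  rintro _ s ⟨A, -, rfl⟩ -
  by_cases hc : c ∈ A <;> simp [hc]

theorem ne_zero_of_pos [Nonempty (Fin nL)] {η : Fin nL → ℝ} (hη : ∀ k, 0 < η k) : η ≠ 0 := by
  rintro rfl
  exact lt_irrefl _ (hη (Classical.arbitrary _))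

/-- Needed because `sInf` bounds the costs from below only when they are bounded below. The path
majorant gives one bound for all controls. -/
theorem bddBelow_costToGoLB [IsProbabilityMeasure P] [Nonempty (Fin nL)] (hM : M.Valid)
    (hW : IsBrownianVec W P) (hWc : ∀ ω, Continuous fun s => W s ω) (ht : t ∈ Icc 0 M.T)
    {η : Fin nL → ℝ} (hη : ∀ k, 0 < η k) (g : Fin N → Fin nG → ℝ) (x : Fin nL → ℝ) :
    BddBelow (costToGoLB M P η g W t (η ⬝ᵥ x) a w '' controlsLB M P η W t a w) := by
  have hA := continuous_meanDemand hM (ht.1.trans ht.2) t x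
  obtain ⟨C₁, C₂, -, -, h⟩ := exists_abs_costLB_le hM hη g hA ht.2 a w
  have hi := (integrable_const C₁).add ((integrable_integral_abs_pathDev
    (measurable_brownPath (M := M) (hWc := hWc) hW η)
    (isPreBrownianReal_brownPath hM hW (ne_zero_of_pos hη)) hM.γ_nonneg ht.2).const_mul C₂)
  refine ⟨-∫ ω, (C₁ + C₂ * ∫ s in t..M.T, |pathDev M.γ t (brownPath M hWc η ω) s|) ∂P, ?_⟩
  rintro _ ⟨v, hv, rfl⟩
  rw [costToGoLB_eq hWc ht]
  refine neg_le_of_abs_le (Real.norm_eq_abs _ ▸ norm_integral_le_of_norm_le hi ?_)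
  filter_upwards [(mem_controlsLB_iff.1 hv).2.2.2] with ω hω
  exact h _ _ hω

/-- Controls of the lower bound problem can be transferred between different weights. -/
theorem exists_controlsLB_le [IsProbabilityMeasure P] [Nonempty (Fin nL)] (hM : M.Valid)
    (hW : IsBrownianVec W P) (hWc : ∀ ω, Continuous fun s => W s ω) (ht : t ∈ Icc 0 M.T)
    {η η₀ : Fin nL → ℝ} (hη : ∀ k, 0 < η k) (hη₀ : ∀ k, 0 < η₀ k) (g : Fin N → Fin nG → ℝ)
    (x : Fin nL → ℝ) {v : RControl M Ω} (hv : v ∈ controlsLB M P η W t a w) :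
    ∃ v' ∈ controlsLB M P η₀ W t a w, costToGoLB M P η₀ g W t (η₀ ⬝ᵥ x) a w v'
      ≤ ∫ ω, costLB M η₀ g (meanDemand M t x) t a w (v.schedule ω) (brownPath M hWc η ω) ∂P := by
  have hA := continuous_meanDemand hM (ht.1.trans ht.2) t x
  obtain ⟨C₁, C₂, -, -, h⟩ := exists_abs_costLB_le hM hη₀ g hA ht.2 a w
  have hβ := measurable_brownPath (M := M) (hWc := hWc) hW η
  have hβ₀ := measurable_brownPath (M := M) (hWc := hWc) hW η₀
  have hBM := isPreBrownianReal_brownPath (hWc := hWc) hM hW (ne_zero_of_pos hη)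
  have hBM₀ := isPreBrownianReal_brownPath (hWc := hWc) hM hW (ne_zero_of_pos hη₀)
  obtain ⟨h1, h2, h3, h4⟩ := mem_controlsLB_iff.1 hv
  rw [brownLB_eq hWc] at h1 h2 h3
  have hG : Integrable (fun b : Path => C₁ + C₂ * ∫ s in t..M.T, |pathDev M.γ t b s|)
      (P.map (brownPath M hWc η)) := by
    rw [integrable_map_measure (((measurable_integral_abs_pathDev _ _ _).const_mul
      _).const_add _).aestronglyMeasurable hβ.aemeasurable]
    exact (integrable_const C₁).add ((integrable_integral_abs_pathDev hβ hBM hM.γ_nonneg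
      ht.2).const_mul C₂)
  -- No additional information is present here, so the auxiliary process is trivial; only the
  -- equality of the two path laws is used.
  obtain ⟨v', h1', h2', h3', h4', hle⟩ := exists_transfer (C := fun _ => (0 : Fin 0 × ℝ≥0 → ℝ))
    (T := M.T) hM hβ hβ₀ measurable_const (indepFun_const_left _) (map_path_eq hβ hβ₀ hBM hBM₀)
    hBM₀ (genFiltration_le_pairAt _ _ _) h1 h2 h3 ht.2 h4
    (Φ := costLB M η₀ g (meanDemand M t x) t a w)
    (fun S hS hfin => measurable_costLB hM hη₀ g hA hS hfin measurable_snd a w) hG h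
  rw [← brownLB_eq hWc] at h1' h2' h3'
  refine ⟨v', mem_controlsLB_iff.2 ⟨h1', h2', h3', h4'⟩, ?_⟩
  rw [costToGoLB_eq hWc ht]
  exact hle

/-- Lower semicontinuity of the value function of the lower bound problem in the weights. -/
theorem eventually_valueLB_le [IsProbabilityMeasure P] [Nonempty (Fin nL)] (hM : M.Valid)
    (hW : IsBrownianVec W P) (hWc : ∀ ω, Continuous fun s => W s ω) (ht : t ∈ Icc 0 M.T)
    {U : Set (Fin nL → ℝ)} (hU : ∀ η ∈ U, ∀ k, 0 < η k) (hN : 1 ≤ N)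
    {g : (Fin nL → ℝ) → Fin N → Fin nG → ℝ} (hg : ContinuousOn g U) {η₀ : Fin nL → ℝ}
    (hη₀ : η₀ ∈ U) (x : Fin nL → ℝ) {r : Fin nG → ℝ} (hr : r ∈ M.progSet a) {ε : ℝ}
    (hε : 0 < ε) :
    ∀ᶠ η in 𝓝[U] η₀, valueLB M P η₀ (g η₀) W t (η₀ ⬝ᵥ x) a (∑ k, r k)
      ≤ valueLB M P η (g η) W t (η ⬝ᵥ x) a (∑ k, r k) + ε := by
  have hA := continuous_meanDemand hM (ht.1.trans ht.2) t x
  obtain ⟨RA, -, hRA⟩ := exists_coord_bound ((isCompact_Icc (a := t) (b := M.T)).image hA)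
  have hβ₀ := measurable_brownPath (M := M) (hWc := hWc) hW η₀
  have hBM₀ := isPreBrownianReal_brownPath (hWc := hWc) hM hW (ne_zero_of_pos (hU η₀ hη₀))
  set e : ℝ := ∫ b, (∫ s in t..M.T, |pathDev M.γ t b s|) ∂P.map (brownPath M hWc η₀) with he
  have he0 : 0 ≤ e := integral_nonneg fun b =>
    intervalIntegral.integral_nonneg ht.2 fun s _ => abs_nonneg _
  have hTt : 0 ≤ M.T - t := sub_nonneg.2 ht.2
  -- A difference of running costs of size `δ (1 + |d|)` costs at most `δ (T - t + e)` in
  -- expectation; the `1` keeps the denominator positive.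
  set δ : ℝ := ε / (M.T - t + e + 1) with hδ
  have hδ0 : 0 < δ := by positivity
  have hδe : δ * (M.T - t + e) ≤ ε := by
    rw [hδ, div_mul_eq_mul_div, div_le_iff₀ (by positivity)]
    nlinarith
  filter_upwards [abs_runCost₂_sub_le hM hU hN hg hη₀ (RA := RA) hδ0, self_mem_nhdsWithin]
    with η hclose hη
  have hβ := measurable_brownPath (M := M) (hWc := hWc) hW η
  have hBM := isPreBrownianReal_brownPath (hWc := hWc) hM hW (ne_zero_of_pos (hU η hη))
  rw [← sub_le_iff_le_add]
  refine le_csInf ((controlsLB_nonempty hM η t hr).image _) ?_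
  rintro _ ⟨v, hv, rfl⟩
  rw [sub_le_iff_le_add]
  obtain ⟨v', hv', hle⟩ := exists_controlsLB_le hM hW hWc ht (hU η hη) (hU η₀ hη₀) (g η₀) x hv
  refine (csInf_le (bddBelow_costToGoLB hM hW hWc ht (hU η₀ hη₀) (g η₀) x) ⟨v', hv', rfl⟩).trans
    (hle.trans ?_)
  obtain ⟨h1, h2, h3, h4⟩ := mem_controlsLB_iff.1 hv
  rw [brownLB_eq hWc] at h1 h2 h3
  have hCm : Measurable fun _ : Ω => (0 : Fin 0 × ℝ≥0 → ℝ) := measurable_const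
  obtain ⟨S, hS, hSf, hSe⟩ := exists_schedule_eq (C := fun _ => (0 : Fin 0 × ℝ≥0 → ℝ))
    (T := M.T) (genFiltration_le_pairAt (brownPath M hWc η) _ _) h1 h2 h3
    (h4.mono fun ω h => h.adm.finite)
  have hS' := hS.comp (hCm.prodMk hβ)
  have hi : ∀ {η' : Fin nL → ℝ} (_ : ∀ k, 0 < η' k) (g' : Fin N → Fin nG → ℝ), Integrable (fun ω => costLB M η' g' (meanDemand M t x) t
      a (∑ k, r k) (v.schedule ω) (brownPath M hWc η ω)) P := fun hη' g' =>
    integrable_costLB hM hη' g' hA ht.2 hS' (fun ω => hSf _) hSe h4 hβ hBM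
  have hD := integrable_integral_abs_pathDev hβ hBM hM.γ_nonneg ht.2
  have hD' : Integrable (fun ω => δ * ((M.T - t)
      + ∫ s in t..M.T, |pathDev M.γ t (brownPath M hWc η ω) s|)) P :=
    ((integrable_const _).add hD).const_mul δ
  -- All weights have the same path law, so `δ` can be fixed before `η` is known.
  have hDe : ∫ ω, (∫ s in t..M.T, |pathDev M.γ t (brownPath M hWc η ω) s|) ∂P = e := by
    rw [he, ← map_path_eq hβ hβ₀ hBM hBM₀, integral_map hβ.aemeasurable
      (measurable_integral_abs_pathDev _ _ _).aestronglyMeasurable]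
  rw [costToGoLB_eq hWc ht]
  calc _ ≤ ∫ ω, (costLB M η (g η) (meanDemand M t x) t a (∑ k, r k) (v.schedule ω)
          (brownPath M hWc η ω) + δ * ((M.T - t)
            + ∫ s in t..M.T, |pathDev M.γ t (brownPath M hWc η ω) s|)) ∂P := by
        refine integral_mono_ae (hi (hU η₀ hη₀) _) ((hi (hU η hη) _).add hD') ?_
        filter_upwards [h4] with ω hω
        have := abs_costLB_sub_le (a := a) (w := ∑ k, r k) hM (hU η hη) (hU η₀ hη₀)
          (g := g η) (g' := g η₀) hA ht.2 (fun s hs => hclose _ fun k => hRA _ ⟨s, hs, rfl⟩ k)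
          hω.adm.finite (brownPath M hWc η ω)
        have := (abs_le.1 this).1
        linarith
    _ = ∫ ω, costLB M η (g η) (meanDemand M t x) t a (∑ k, r k) (v.schedule ω)
          (brownPath M hWc η ω) ∂P + δ * (M.T - t + e) := by
        rw [integral_add (hi (hU η hη) _) hD',
          integral_const_mul, integral_add (integrable_const _) hD, hDe]
        simp
    _ ≤ _ := by gcongr


variable {nG nL nc N : ℕ} {M : Model nG nL nc} {Ω : Type*} [mΩ : MeasurableSpace Ω]
  {P : Measure Ω} {W : ℝ≥0 → Ω → Fin nL → ℝ} {t : ℝ} {a : M.Mode} {r : Fin nG → ℝ}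

/-! ### Costs of the original problem as functionals of the schedule and the demand path -/

open Classical in
variable (M) in
/-- Total cost of a schedule in the original problem. -/
noncomputable def costOrig (t : ℝ) (a : M.Mode) (r : Fin nG → ℝ) (S : M.Schedule)
    (X : ℝ → Fin nL → ℝ) : ℝ :=
  (∫ s in t..M.T, M.runCost (X s) (S.mode a s) (S.prog t a r s))
    + ∑' j, if S.time j ≤ M.T then S.reqCost j else 0

variable (M) in
/-- The demand on the operating period as a functional of the driving paths, extended to all
times. -/
noncomputable def demandPath (hWc : ∀ ω, Continuous fun s => W s ω) (t : ℝ) (x : Fin nL → ℝ)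
    (ω : Ω) (s : ℝ) : Fin nL → ℝ := fun k =>
  meanDemand M t x s k + volLB M (Pi.single k 1) *
    pathDev M.γ t (brownPath M hWc (Pi.single k 1) ω) s

omit mΩ in
theorem demandPath_eq (hM : M.Valid) (hWc : ∀ ω, Continuous fun s => W s ω) {s : ℝ}
    (hs : s ∈ Icc 0 M.T) (x : Fin nL → ℝ) (ω : Ω) :
    demandPath M hWc t x ω s = demand M W t x s ω :=
  funext fun k => (demand_apply hM hWc hs x ω k).symm

omit mΩ in
theorem continuous_demandPath (hM : M.Valid) (hWc : ∀ ω, Continuous fun s => W s ω)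
    (hT : 0 ≤ M.T) (t : ℝ) (x : Fin nL → ℝ) (ω : Ω) : Continuous (demandPath M hWc t x ω) :=
  continuous_pi fun _ => ((continuous_apply _).comp (continuous_meanDemand hM hT t x)).add
    (continuous_const.mul (continuous_pathDev _ _ _))

theorem measurable_demandPath (hM : M.Valid) (hW : IsBrownianVec W P)
    (hWc : ∀ ω, Continuous fun s => W s ω) (hT : 0 ≤ M.T) (t : ℝ) (x : Fin nL → ℝ) :
    Measurable fun p : Ω × ℝ => demandPath M hWc t x p.1 p.2 := by
  refine measurable_pi_iff.2 fun k => Measurable.add ?_ (Measurable.const_mul ?_ _)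
  · exact ((continuous_apply k).comp (continuous_meanDemand hM hT t x)).measurable.comp
      measurable_snd
  · exact (measurable_pathDev M.γ t).comp
      (((measurable_brownPath (hWc := hWc) hW _).comp measurable_fst).prodMk measurable_snd)

omit mΩ in
theorem dotProduct_demandPath (hM : M.Valid) (hWc : ∀ ω, Continuous fun s => W s ω) {s : ℝ}
    (hs : s ∈ Icc 0 M.T) {η : Fin nL → ℝ} (hη : η ≠ 0) (x : Fin nL → ℝ) (ω : Ω) :
    η ⬝ᵥ demandPath M hWc t x ω s
      = η ⬝ᵥ meanDemand M t x s + volLB M η * pathDev M.γ t (brownPath M hWc η ω) s := by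
  rw [demandPath_eq hM hWc hs, dotProduct_demand hM hWc t s hη, demandLB_eq hWc hs]

theorem costToGo_eq (hM : M.Valid) (hWc : ∀ ω, Continuous fun s => W s ω) (ht : t ∈ Icc 0 M.T)
    (x : Fin nL → ℝ) (v : Control M Ω) :
    costToGo M P W t x a r v
      = ∫ ω, costOrig M t a r (v.schedule t a r ω) (demandPath M hWc t x ω) ∂P := by
  unfold costToGo costOrig
  refine integral_congr_ae (Eventually.of_forall fun ω => ?_)
  refine congrArg₂ (· + ·) (intervalIntegral.integral_congr fun s hs => ?_) rfl
  rw [uIcc_of_le ht.2] at hs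
  rw [demandPath_eq hM hWc ⟨ht.1.trans hs.1, hs.2⟩]

theorem measurable_rate (hM : M.Valid) {Ω' : Type*} [MeasurableSpace Ω'] {S : Ω' → M.Schedule}
    (hS : MeasurableSchedule S) (hfin : ∀ ω, {j | (S ω).time j ≠ ⊤}.Finite)
    {X : Ω' → ℝ → Fin nL → ℝ} (hX : Measurable fun p : Ω' × ℝ => X p.1 p.2) (t : ℝ) (a : M.Mode)
    (r : Fin nG → ℝ) : Measurable fun p : Ω' × ℝ =>
      (M.progSet ((S p.1).mode a p.2)).indicator
        (fun r' => M.runCost (X p.1 p.2) ((S p.1).mode a p.2) r') ((S p.1).prog t a r p.2) :=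
  hS.mode_comp hfin a (g := fun α p => (M.progSet α).indicator
    (fun r' => M.runCost (X p.1 p.2) α r') ((S p.1).prog t a r p.2))
    fun α => (hM.measurable_runCost α).comp (hX.prodMk (hS.prog hfin t a r))

theorem intervalIntegrable_rate (hM : M.Valid) {S : M.Schedule} (hS : S.Admissible t a)
    (hex : S.IsExact t a r) (hr : r ∈ M.progSet a) (ht : t ≤ M.T) {X : ℝ → Fin nL → ℝ}
    (hX : Continuous X) :
    IntervalIntegrable (fun s => M.runCost (X s) (S.mode a s) (S.prog t a r s)) volume t M.T := by
  obtain ⟨C, hC, h⟩ := hM.abs_runCost_le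
  have hSm : MeasurableSchedule fun _ : Unit => S :=
    ⟨fun _ => measurable_const, fun _ _ => .const _, fun _ => measurable_const,
      fun _ => measurable_const⟩
  have h0 : Measurable fun p : Unit × ℝ => (M.progSet (S.mode a p.2)).indicator
      (fun r' => M.runCost (X p.2) (S.mode a p.2) r') (S.prog t a r p.2) :=
    measurable_rate hM hSm (fun _ => hS.finite) (X := fun _ => X)
      (hX.measurable.comp measurable_snd) t a r
  have h1 : Measurable fun s : ℝ => ((), s) := measurable_prodMk_left
  have h2 : Measurable fun s => (M.progSet (S.mode a s)).indicator
      (fun r' => M.runCost (X s) (S.mode a s) r') (S.prog t a r s) := by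
    simpa only [Function.comp_def] using h0.comp h1
  have hc : Continuous fun s => C * (1 + ∑ k, |X s k|) := by fun_prop
  have hmem : ∀ᵐ s ∂volume.restrict (uIoc t M.T), S.prog t a r s ∈ M.progSet (S.mode a s) := by
    filter_upwards [ae_restrict_mem measurableSet_uIoc] with s hs
    rw [uIoc_of_le ht] at hs
    exact hS.prog_mem hex hr hs.1.le
  refine (hc.intervalIntegrable t M.T).mono_fun' (h2.aestronglyMeasurable.congr ?_) ?_
  · filter_upwards [hmem] with s hs
    rw [indicator_of_mem hs]
  · filter_upwards [hmem] with s hs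
    exact h _ _ _ hs

-- Comparison on a single path. The running costs are compared at the actual progressions, whose sum
-- is `totProg`; requests at time `t` are free in the lower bound problem but charged in the
-- original one.
omit mΩ in
theorem costLB_le_costOrig [Nonempty (Fin nL)] (hM : M.Valid)
    (hWc : ∀ ω, Continuous fun s => W s ω) (ht : t ∈ Icc 0 M.T) {η : Fin nL → ℝ}
    (hη : ∀ k, 0 < η k) (g : Fin N → Fin nG → ℝ) (x : Fin nL → ℝ) {S : M.Schedule}
    (hS : S.Admissible t a) (hex : S.IsExact t a r) (hr : r ∈ M.progSet a) (ω : Ω) :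
    costLB M η g (meanDemand M t x) t a (∑ k, r k) S (brownPath M hWc η ω)
      ≤ costOrig M t a r S (demandPath M hWc t x ω) := by
  classical
  have hT := ht.1.trans ht.2
  refine add_le_add ?_ ?_
  · refine intervalIntegral.integral_mono_on ht.2
      (intervalIntegrable_rateLB hM hη g (continuous_meanDemand hM hT t x) hS.finite _ t a _ _ _)
      (intervalIntegrable_rate hM hS hex hr ht.2 (continuous_demandPath hM hWc hT t x ω))
      fun s hs => ?_
    rw [rateLB, ← dotProduct_demandPath hM hWc ⟨ht.1.trans hs.1, hs.2⟩ (ne_zero_of_pos hη),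
      ← hS.sum_prog hM hex hr hs.1]
    exact runCost₂_le_runCost hM hη g _ _ (hS.prog_mem hex hr hs.1)
  · have h1 := tsum_ite_reqCost hS fun τ => (t : WithTop ℝ) < τ ∧ τ ≤ M.T
    have h2 := tsum_ite_reqCost hS fun τ => τ ≤ (M.T : WithTop ℝ)
    have h3 : ∑ j ∈ hS.requests, (if (t : WithTop ℝ) < S.time j ∧ S.time j ≤ M.T
        then S.reqCost j else 0) ≤ ∑ j ∈ hS.requests, if S.time j ≤ (M.T : WithTop ℝ)
        then S.reqCost j else 0 := by
      refine Finset.sum_le_sum fun j _ => ?_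
      by_cases hj : S.time j ≤ (M.T : WithTop ℝ)
      · rw [if_pos hj]
        split_ifs
        exacts [le_rfl, Model.Schedule.reqCost_nonneg hM j]
      · rw [if_neg hj, if_neg fun h => hj h.2]
    rw [← h1, ← h2] at h3
    convert! h3

/-- Without integrability the expected cost would be the default value `0`, and the pathwise
comparison could not be integrated. -/
theorem integrable_costOrig [IsProbabilityMeasure P] (hM : M.Valid) (hW : IsBrownianVec W P)
    (hWc : ∀ ω, Continuous fun s => W s ω) (ht : t ∈ Icc 0 M.T) (x : Fin nL → ℝ)
    (hr : r ∈ M.progSet a) {S S' : Ω → M.Schedule} (hS' : MeasurableSchedule S')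
    (hfin : ∀ ω, {j | (S' ω).time j ≠ ⊤}.Finite) (hSe : ∀ᵐ ω ∂P, S ω = S' ω)
    (hf : ∀ᵐ ω ∂P, (S ω).Feasible t a (∑ k, r k)) (hex : ∀ ω, (S ω).IsExact t a r) :
    Integrable (fun ω => costOrig M t a r (S ω) (demandPath M hWc t x ω)) P := by
  classical
  have hT := ht.1.trans ht.2
  obtain ⟨C, hC, h⟩ := hM.abs_runCost_le
  obtain ⟨K, hK, hKS⟩ := exists_sum_reqCost_le hM ht.2 a (∑ k, r k)
  have hXm := measurable_demandPath hM hW hWc hT t x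
  have hrate := measurable_rate hM hS' hfin (X := demandPath M hWc t x) hXm t a r
  have hint := (measurable_intervalIntegral (h := fun ω s =>
    (M.progSet ((S' ω).mode a s)).indicator (fun r' =>
      M.runCost (demandPath M hWc t x ω s) ((S' ω).mode a s) r') ((S' ω).prog t a r s)) hrate
      t).comp (measurable_id.prodMk (measurable_const (a := M.T)))
  have htsum := hS'.measurable_tsum_reqCost hM (fun τ => τ ≤ (M.T : WithTop ℝ))
    measurableSet_Iic
  have hXi : Integrable (fun ω => ∫ s in t..M.T, ∑ k, |demandPath M hWc t x ω s k|) P := by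
    have h1 : ∀ k, Integrable (fun p : Ω × ℝ => |demandPath M hWc t x p.1 p.2 k|)
        (P.prod (volume.restrict (Ioc t M.T))) := by
      intro k
      refine Integrable.abs (Integrable.add ?_ (Integrable.const_mul ?_ _))
      · refine Integrable.comp_snd (f := fun s => meanDemand M t x s k) ?_ P
        exact (((continuous_apply k).comp
          (continuous_meanDemand hM hT t x)).integrableOn_Icc (a := t) (b := M.T)).mono_set
          Ioc_subset_Icc_self
      · exact integrable_prod_pathDev (measurable_brownPath hW _)
          (isPreBrownianReal_brownPath hM hW (by simp)) hM.γ_nonneg ht.2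
    have h2 := (integrable_finsetSum Finset.univ fun k _ => h1 k).integral_prod_left
    simpa only [intervalIntegral.integral_of_le ht.2] using h2
  refine ((integrable_const (C * (M.T - t) + K)).add (hXi.const_mul C)).mono'
    ((hint.add htsum).aestronglyMeasurable.congr ?_) ?_
  · filter_upwards [hSe, hf] with ω hω hfω
    have hadm := hω ▸ hfω.adm
    have hexω := hω ▸ hex ω
    rw [hω]
    change (_ : ℝ) + _ = (_ : ℝ) + _
    refine congrArg₂ (· + ·) (intervalIntegral.integral_congr fun s hs => ?_) ?_
    · rw [uIcc_of_le ht.2] at hs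
      simp only [id]
      rw [indicator_of_mem (hadm.prog_mem hexω hr hs.1)]
    · congr!
  · filter_upwards [hf] with ω hfω
    have hc : Continuous fun s => ∑ k, |demandPath M hWc t x ω s k| := by
      have := continuous_demandPath hM hWc hT t x ω
      fun_prop
    have h1 : |∫ s in t..M.T, M.runCost (demandPath M hWc t x ω s) ((S ω).mode a s)
        ((S ω).prog t a r s)| ≤ ∫ s in t..M.T, C * (1 + ∑ k, |demandPath M hWc t x ω s k|) := by
      rw [← Real.norm_eq_abs]
      refine intervalIntegral.norm_integral_le_of_norm_le ht.2
        (Eventually.of_forall fun s hs => ?_)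
        ((continuous_const.mul (continuous_const.add hc)).intervalIntegrable _ _)
      exact h _ _ _ (hfω.adm.prog_mem (hex ω) hr hs.1.le)
    rw [intervalIntegral.integral_const_mul, intervalIntegral.integral_add
      intervalIntegrable_const (hc.intervalIntegrable _ _)] at h1
    have h2 := tsum_ite_reqCost_mem hM hfω.adm fun τ => τ ≤ (M.T : WithTop ℝ)
    have h3 := hKS _ hfω
    have h4 : |costOrig M t a r (S ω) (demandPath M hWc t x ω)|
        ≤ |∫ s in t..M.T, M.runCost (demandPath M hWc t x ω s) ((S ω).mode a s)
          ((S ω).prog t a r s)|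
        + |∑' j, (if (S ω).time j ≤ (M.T : WithTop ℝ) then (S ω).reqCost j else 0)| := by
      unfold costOrig
      refine (abs_add_le _ _).trans_eq ?_
      congr!
    rw [abs_of_nonneg h2.1] at h4
    simp only [intervalIntegral.integral_const, smul_eq_mul, mul_one] at h1
    simp only [Real.norm_eq_abs, Pi.add_apply]
    linarith [h2.2]


variable {nG nL nc N : ℕ} {M : Model nG nL nc} {Ω : Type*} [mΩ : MeasurableSpace Ω]
  {P : Measure Ω} {W : ℝ≥0 → Ω → Fin nL → ℝ} {t : ℝ} {a : M.Mode} {r : Fin nG → ℝ}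

/-! ### Information in the demand -/

/-- The path stopped at time `u`. -/
def stopPath (u : ℝ≥0) (b : Path) : Path :=
  ⟨fun s => b.1 (min s u), b.2.comp (continuous_id.min continuous_const)⟩

/-- Makes visible that the deviation at time `u` uses the path up to `u` only, so that measurability
of `pathDev` turns into adaptedness. -/
theorem pathDev_stopPath {γ t u : ℝ} (htu : t ≤ u) (b : Path) :
    pathDev γ t (stopPath u.toNNReal b) u = pathDev γ t b u := by
  have h : ∀ v ≤ u, (stopPath u.toNNReal b).1 v.toNNReal = b.1 v.toNNReal := fun v hv => by
    simp only [stopPath, min_eq_left (Real.toNNReal_le_toNNReal hv)]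
  unfold pathDev ouPath
  beta_reduce
  rw [h u le_rfl, h t htu]
  congr 2
  refine intervalIntegral.integral_congr fun v hv => ?_
  rw [uIcc_of_le htu] at hv
  simp only [h v hv.2]

/-- The components of the driving Brownian motion that are independent of the driving motion of the
weighted demand. -/
noncomputable def residual (M : Model nG nL nc) (W : ℝ≥0 → Ω → Fin nL → ℝ) (η : Fin nL → ℝ)
    (ω : Ω) (p : Fin nL × ℝ≥0) : ℝ :=
  W p.2 ω p.1 - noiseDir M η p.1 * (noiseDir M η ⬝ᵥ W p.2 ω)

-- The Brownian motion `W` is recovered at each time from the residual and the scalar motion, so the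
-- pair carries at least the information in the demand.
omit mΩ in
theorem measurable_demand_past (hM : M.Valid) (hWc : ∀ ω, Continuous fun s => W s ω)
    (η x : Fin nL → ℝ) {s u : ℝ} (h0 : 0 ≤ u) (hs : u ≤ s) (hT : u ≤ M.T) :
    Measurable[pastSpace M.T
      (fun u ω => pairAt nL u (residual M W η ω, brownPath M hWc η ω)) s]
      (demand M W 0 x u) := by
  have hW : ∀ v : ℝ≥0, (v : ℝ) ≤ u → Measurable[pastSpace M.T
      (fun u ω => pairAt nL u (residual M W η ω, brownPath M hWc η ω)) s] (W v) := by
    intro v hv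
    have h1 := measurable_pastSpace
      (Y := fun u ω => pairAt nL u (residual M W η ω, brownPath M hWc η ω)) (T := M.T)
      v.coe_nonneg (hv.trans hs) (hv.trans hT)
    have e : W v = fun ω i => residual M W η ω (i, v)
        + noiseDir M η i * (brownPath M hWc η ω).1 v := by
      funext ω i
      simp [residual, brownPath]
    rw [e]
    generalize pastSpace M.T
      (fun u ω => pairAt nL u (residual M W η ω, brownPath M hWc η ω)) s = m at h1 ⊢
    simp only [pairAt, Real.toNNReal_coe] at h1
    refine measurable_pi_iff.2 fun i => ?_
    exact ((measurable_pi_apply i).comp (measurable_fst.comp h1)).add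
      ((measurable_snd.comp h1).const_mul _)
  generalize pastSpace M.T
      (fun u ω => pairAt nL u (residual M W η ω, brownPath M hWc η ω)) s = m at hW ⊢
  refine measurable_pi_iff.2 fun k => ?_
  have e : (fun ω => demand M W 0 x u ω k) = fun ω => meanDemand M 0 x u k
      + volLB M (Pi.single k 1) * pathDev M.γ 0
        (stopPath u.toNNReal (brownPath M hWc (Pi.single k 1) ω)) u := by
    funext ω
    rw [demand_apply hM hWc ⟨h0, hT⟩, pathDev_stopPath h0]
  rw [e]
  have hst : Measurable fun ω => stopPath u.toNNReal (brownPath M hWc (Pi.single k 1) ω) := by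
    refine Measurable.subtype_mk (measurable_pi_iff.2 fun v => ?_)
    have hle : ((min v u.toNNReal : ℝ≥0) : ℝ) ≤ u := by
      have : min v u.toNNReal ≤ u.toNNReal := min_le_right _ _
      calc ((min v u.toNNReal : ℝ≥0) : ℝ) ≤ (u.toNNReal : ℝ) := by exact_mod_cast this
        _ = u := Real.coe_toNNReal _ h0
    have := hW _ hle
    simp only [brownPath, dotProduct]
    exact Finset.measurable_fun_sum _ fun i _ =>
      ((measurable_pi_apply i).comp this).const_mul _
  exact (((measurable_pathDev M.γ 0).comp (hst.prodMk measurable_const)).const_mul _).const_add _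

/-! ### The lower bound -/

/-- A control of the original problem as a control with completion times. -/
noncomputable def Control.toRControl (v : Control M Ω) (t : ℝ) (a : M.Mode) (r : Fin nG → ℝ) :
    RControl M Ω where
  toControl := v
  initDone k _ := ((t - r k + Model.genDelay (a k) : ℝ) : WithTop ℝ)
  done j ω := v.time j ω + (((v.req j ω).elim 0 fun b => M.delay b.1 b.2 : ℝ) : WithTop ℝ)

theorem coe_add_le_iff (τ : WithTop ℝ) (d s : ℝ) :
    τ + (d : WithTop ℝ) ≤ s ↔ τ ≤ ((s - d : ℝ) : WithTop ℝ) := by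
  cases τ with
  | top => simp
  | coe x => rw [← WithTop.coe_add, WithTop.coe_le_coe, WithTop.coe_le_coe, le_sub_iff_add_le]

theorem Control.isStoppingTime_done (hM : M.Valid) {F : Filtration ℝ mΩ} {v : Control M Ω}
    (hv : v.NonAnticipating F) (t : ℝ) (a : M.Mode) (r : Fin nG → ℝ) (j : ℕ) :
    IsStoppingTime F ((v.toRControl t a r).done j) := by
  intro s
  obtain ⟨hτ, hreq⟩ := hv j
  have hb : ∀ b (q : ℝ), MeasurableSet[F q] {ω | v.req j ω = some b ∧ v.time j ω ≤ q} :=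
    fun b q => (hreq b).2 q
  -- For each possible request, completion by time `s` means that it was made by `s` minus its
  -- duration, and this is known by then. In the remaining case, without a request, completion and
  -- intervention time coincide.
  have e : {ω | (v.toRControl t a r).done j ω ≤ s}
      = (⋃ b, {ω | v.req j ω = some b ∧
          v.time j ω ≤ ((s - M.delay b.1 b.2 : ℝ) : WithTop ℝ)})
        ∪ ({ω | v.time j ω ≤ s} \ ⋃ b, {ω | v.req j ω = some b ∧ v.time j ω ≤ s}) := by
    ext ω
    simp only [Control.toRControl, mem_union, mem_iUnion, mem_ofPred_eq, Set.mem_sdiff, coe_add_le_iff]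
    cases v.req j ω with
    | none => simp
    | some b => simp
  rw [e]
  refine MeasurableSet.union (MeasurableSet.iUnion fun b => ?_)
    ((hτ s).diff (MeasurableSet.iUnion fun b => hb b s))
  exact F.mono (sub_le_self s (hM.delay_pos _ _).le) _ (hb b _)

omit mΩ in
theorem Control.isExact_schedule (v : Control M Ω) (t : ℝ) (a : M.Mode) (r : Fin nG → ℝ) (ω : Ω) :
    (v.schedule t a r ω).IsExact t a r :=
  ⟨fun _ => rfl, fun _ => rfl⟩

theorem controls_nonempty [IsProbabilityMeasure P] (hM : M.Valid) (t : ℝ)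
    (hr : r ∈ M.progSet a) : (controls M P W t a r).Nonempty := by
  refine ⟨⟨fun _ _ => ⊤, fun _ _ => none⟩, nonAnticipating_of_forall (fun j s => by simp)
    (fun j b s => by simp) (fun j b => by simp) (by simp), Eventually.of_forall fun ω => ?_⟩
  exact (feasible_of_no_request hM hr (fun _ => rfl) (fun _ => rfl)
    (Control.isExact_schedule _ t a r ω)).adm

/-- A control of the original problem, read as a control with completion times, violates only the
information constraint. Freezing the residual noise repairs this without raising the expected
relaxed cost, which is pathwise at most the original cost. -/
theorem valueLB_le_value_of_continuous [IsProbabilityMeasure P] [Nonempty (Fin nL)] (hM : M.Valid)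
    (hW : IsBrownianVec W P) (hWc : ∀ ω, Continuous fun s => W s ω) (ht : t ∈ Icc 0 M.T)
    {η : Fin nL → ℝ} (hη : ∀ k, 0 < η k) (g : Fin N → Fin nG → ℝ) (x : Fin nL → ℝ)
    (hr : r ∈ M.progSet a) :
    valueLB M P η g W t (η ⬝ᵥ x) a (∑ k, r k) ≤ value M P W t x a r := by
  refine le_csInf ((controls_nonempty hM t hr).image _) ?_
  rintro _ ⟨v, ⟨hv, hadm⟩, rfl⟩
  have hA := continuous_meanDemand hM (ht.1.trans ht.2) t x
  have hη0 := ne_zero_of_pos hη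
  have hβ := measurable_brownPath (M := M) (hWc := hWc) hW η
  have hBM := isPreBrownianReal_brownPath (hWc := hWc) hM hW hη0
  have hC : Measurable (residual M W η) := measurable_pi_iff.2 fun p =>
    ((measurable_pi_apply p.1).comp (hW.measurable p.2)).sub
      ((hW.measurable_dotProduct _ _).const_mul _)
  have hind : IndepFun (residual M W η) (brownPath M hWc η) P := by
    have h1 := (hW.indepFun_dotProduct (noiseDir_dotProduct_self hM hη0)).symm
    rw [IndepFun_iff_Indep] at h1 ⊢
    refine indep_of_indep_of_le_right h1 ?_
    change (MeasurableSpace.comap Subtype.val _).comap _ ≤ _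
    rw [MeasurableSpace.comap_comp]
    exact le_rfl
  have hF : ∀ s, genFiltration P M.T (demand M W 0 M.x₀) s ≤ eventuallyMeasurableSpace
      (pastSpace M.T (fun u ω => pairAt nL u (residual M W η ω, brownPath M hWc η ω)) s)
      (ae P) := fun s A hA => eventuallyMeasurableSpace_le_of_le
    ((pastSpace_le fun u h0 hs hT => measurable_demand_past hM hWc η M.x₀ h0 hs hT).trans
      le_eventuallyMeasurableSpace) _ (measurableSet_genFiltration.1 hA).1
  have hi : ∀ k, IsStoppingTime (genFiltration P M.T (demand M W 0 M.x₀))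
      ((v.toRControl t a r).initDone k) := fun k => isStoppingTime_const _ _
  have hd := Control.isStoppingTime_done hM hv t a r
  have hex := Control.isExact_schedule v t a r
  have hf : ∀ᵐ ω ∂P, ((v.toRControl t a r).schedule ω).Feasible t a (∑ k, r k) := by
    filter_upwards [hadm] with ω hω
    exact ⟨hω, (hex ω).le_initDone hr, (hex ω).time_le_done hM,
      fun s hs => hω.totProg_mem hM (hex ω) hr hs.1⟩
  obtain ⟨C₁, C₂, -, -, hbound⟩ := exists_abs_costLB_le hM hη g hA ht.2 a (∑ k, r k)
  have hG : Integrable (fun b : Path => C₁ + C₂ * ∫ s in t..M.T, |pathDev M.γ t b s|)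
      (P.map (brownPath M hWc η)) := by
    rw [integrable_map_measure (((measurable_integral_abs_pathDev _ _ _).const_mul
      _).const_add _).aestronglyMeasurable hβ.aemeasurable]
    exact (integrable_const C₁).add ((integrable_integral_abs_pathDev hβ hBM hM.γ_nonneg
      ht.2).const_mul C₂)
  -- Here the driving motion stays the same, `B' = B`, and only the residual is eliminated.
  obtain ⟨v', h1', h2', h3', h4', hle⟩ := exists_transfer (v := v.toRControl t a r) (T := M.T)
    hM hβ hβ hC hind rfl hBM hF hv hi hd ht.2 hf
    (Φ := costLB M η g (meanDemand M t x) t a (∑ k, r k))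
    (fun S hS hfin => measurable_costLB hM hη g hA hS hfin measurable_snd a _) hG hbound
  rw [← brownLB_eq hWc] at h1' h2' h3'
  refine (csInf_le (bddBelow_costToGoLB hM hW hWc ht hη g x)
    ⟨v', mem_controlsLB_iff.2 ⟨h1', h2', h3', h4'⟩, rfl⟩).trans ?_
  rw [costToGoLB_eq hWc ht, costToGo_eq hM hWc ht]
  refine hle.trans ?_
  obtain ⟨S, hS, hSf, hSe⟩ := exists_schedule_eq hF (v := v.toRControl t a r) hv hi hd
    (hf.mono fun ω h => h.adm.finite)
  have hS' := hS.comp (hC.prodMk hβ)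
  refine integral_mono_ae (integrable_costLB hM hη g hA ht.2 hS' (fun ω => hSf _) hSe hf hβ hBM)
    (integrable_costOrig hM hW hWc ht x hr hS' (fun ω => hSf _) hSe hf hex) ?_
  filter_upwards [hadm] with ω hω
  exact costLB_le_costOrig hM hWc ht hη g x hω (hex ω) hr ω


variable {nG nL nc N : ℕ} {M : Model nG nL nc} {Ω : Type*} [mΩ : MeasurableSpace Ω]
  {P : Measure Ω} {W W' : ℝ≥0 → Ω → Fin nL → ℝ}

/-! ### Modification of the driving Brownian motion -/

/-- The augmentation by null sets makes the filtration insensitive to modifications of the process.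
-/
theorem genFiltration_congr {E : Type*} [MeasurableSpace E] {T : ℝ} {Y Y' : ℝ → Ω → E}
    (h : ∀ u, Y u =ᵐ[P] Y' u) : genFiltration P T Y = genFiltration P T Y' := by
  have key : ∀ {Y Y' : ℝ → Ω → E}, (∀ u, Y u =ᵐ[P] Y' u) → ∀ s,
      genFiltration P T Y s ≤ genFiltration P T Y' s := by
    intro Y Y' h s
    refine inf_le_inf_right _ (eventuallyMeasurableSpace_le_of_le ?_)
    refine iSup₂_le fun u hu => comap_le_eventuallyMeasurableSpace (g := Y' u) ?_ (h u)
    exact measurable_pastSpace hu.1 (hu.2.trans (min_le_left _ _)) (hu.2.trans (min_le_right _ _))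
  refine Filtration.ext (funext fun s => ?_)
  exact le_antisymm (key h s) (key (fun u => (h u).symm) s)

theorem IsBrownianVec.exists_continuous (hW : IsBrownianVec W P) :
    ∃ W' : ℝ≥0 → Ω → Fin nL → ℝ, IsBrownianVec W' P ∧ (∀ ω, Continuous fun s => W' s ω) ∧
      ∀ᵐ ω ∂P, ∀ s, W s ω = W' s ω := by
  classical
  have hc : ∀ᵐ ω ∂P, ∀ k, Continuous fun s => W s ω k :=
    ae_all_iff.2 fun k => (hW.brownian k).cont
  -- The exceptional set is enlarged to a measurable null set, so that setting the process to zero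
  -- there preserves measurability.
  obtain ⟨A, hAc, hAm, hA0⟩ := exists_measurable_superset_of_null (ae_iff.1 hc)
  have hae : ∀ᵐ ω ∂P, ω ∉ A := measure_eq_zero_iff_ae_notMem.1 hA0
  refine ⟨fun s ω => if ω ∈ A then 0 else W s ω, ⟨fun s => ?_, fun k => ?_, ?_⟩, fun ω => ?_, ?_⟩
  · exact Measurable.ite hAm measurable_const (hW.measurable s)
  · refine ⟨(hW.brownian k).toIsPreBrownianReal.congr fun s => ?_, ?_⟩
    · filter_upwards [hae] with ω hω
      rw [if_neg hω]
    · filter_upwards [hae, hc] with ω hω h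
      simpa only [if_neg hω] using h k
  · refine hW.indep.congr fun k => ?_
    filter_upwards [hae] with ω hω
    funext s
    rw [if_neg hω]
  · by_cases hω : ω ∈ A
    · simp only [if_pos hω]
      exact continuous_const
    · simp only [if_neg hω]
      refine continuous_pi fun k => ?_
      by_contra h
      exact hω (hAc fun h' => h (h' k))
  · filter_upwards [hae] with ω hω s
    rw [if_neg hω]

theorem valueLB_congr (h : ∀ᵐ ω ∂P, ∀ s, W s ω = W' s ω) (η : Fin nL → ℝ)
    (g : Fin N → Fin nG → ℝ) (t y : ℝ) (a : M.Mode) (w : ℝ) :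
    valueLB M P η g W t y a w = valueLB M P η g W' t y a w := by
  have hF : genFiltration P M.T (brownLB M η W) = genFiltration P M.T (brownLB M η W') :=
    genFiltration_congr fun u => h.mono fun ω hω => by simp only [brownLB, hω]
  unfold valueLB
  have h1 : controlsLB M P η W t a w = controlsLB M P η W' t a w := by
    unfold controlsLB
    rw [hF]
  have h2 : costToGoLB M P η g W t y a w = costToGoLB M P η g W' t y a w := by
    funext v
    refine integral_congr_ae ?_
    filter_upwards [h] with ω hω
    simp only [demandLB, brownLB, hω]
  rw [h1, h2]

theorem value_congr (h : ∀ᵐ ω ∂P, ∀ s, W s ω = W' s ω) (t : ℝ) (x : Fin nL → ℝ) (a : M.Mode)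
    (r : Fin nG → ℝ) : value M P W t x a r = value M P W' t x a r := by
  have hF : genFiltration P M.T (demand M W 0 M.x₀) = genFiltration P M.T (demand M W' 0 M.x₀) :=
    genFiltration_congr fun u => h.mono fun ω hω => by simp only [demand, noise, hω]
  unfold value
  have h1 : controls M P W t a r = controls M P W' t a r := by
    unfold controls
    rw [hF]
  have h2 : costToGo M P W t x a r = costToGo M P W' t x a r := by
    funext v
    refine integral_congr_ae ?_
    filter_upwards [h] with ω hω
    simp only [demand, noise, hω]
  rw [h1, h2]

end GenPlan

/-! ### The corollary: attained minimum and lower bound. -/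

theorem mainTheorem4 {nG nL nc N : ℕ} (M : GenPlan.Model nG nL nc) (hM : M.Valid)
    {Ω : Type*} [MeasurableSpace Ω] (P : Measure Ω) [IsProbabilityMeasure P]
    (W : ℝ≥0 → Ω → Fin nL → ℝ) (hW : GenPlan.IsBrownianVec W P)
    (U : Set (Fin nL → ℝ)) (hUne : U.Nonempty) (hUcomp : IsCompact U)
    (hU : ∀ η ∈ U, ‖WithLp.toLp 2 η‖ = 1 ∧ ∀ k, 0 < η k)
    (hN : 1 ≤ N) (g : (Fin nL → ℝ) → Fin N → Fin nG → ℝ) (hg : ContinuousOn g U)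
    (t : ℝ) (ht : t ∈ Set.Icc 0 M.T) (x : Fin nL → ℝ) (a : M.Mode)
    (r : Fin nG → ℝ) (hr : r ∈ M.progSet a) :
    ∃ VLB : ℝ,
      IsLeast ((fun η => GenPlan.valueLB M P η (g η) W t (η ⬝ᵥ x) a (∑ k, r k)) '' U) VLB ∧
      VLB ≤ GenPlan.value M P W t x a r := by
  obtain ⟨W', hW', hWc, hWW'⟩ := hW.exists_continuous
  simp only [GenPlan.valueLB_congr hWW', GenPlan.value_congr hWW']
  -- `U` contains a unit vector, so there is at least one load node.
  have hne : Nonempty (Fin nL) := by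
    obtain ⟨η, hη⟩ := hUne
    by_contra hempty
    rw [not_nonempty_iff] at hempty
    have h0 : η = 0 := Subsingleton.elim _ _
    have h1 := (hU η hη).1
    rw [h0] at h1
    simp at h1
  have hpos : ∀ η ∈ U, ∀ k, 0 < η k := fun η hη => (hU η hη).2
  have hlsc : LowerSemicontinuousOn
      (fun η => GenPlan.valueLB M P η (g η) W' t (η ⬝ᵥ x) a (∑ k, r k)) U := by
    intro η₀ hη₀ y hy
    -- Half the gap between the value at `η₀` and `y` is used as `ε`, which leaves a strict
    -- inequality.
    filter_upwards [GenPlan.eventually_valueLB_le hM hW' hWc ht hpos hN hg hη₀ x hr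
      (half_pos (sub_pos.2 hy))] with η hη
    linarith
  obtain ⟨η, hη, hmin⟩ := hlsc.exists_isMinOn hUne hUcomp
  refine ⟨_, ⟨⟨η, hη, rfl⟩, ?_⟩,
    GenPlan.valueLB_le_value_of_continuous hM hW' hWc ht (hpos η hη) (g η) x hr⟩
  rintro _ ⟨η', hη', rfl⟩
  exact hmin hη'
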